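/- Throughout, $d,m\in\mathbb N$, $|\cdot|$ is the Euclidean norm, and on $\mathbb{R}^{d\times m}$ in particular the Frobenius norm. The barycenter of a probability measure $\nu$ on $\mathbb{R}^{d\times m}$ with finite first moment is $\bar\nu=\int X\,d\nu(X)$. *Laminates.* $\mu$ is obtained from $\nu$ by elementary splitting if $\nu=\lambda\delta_A+(1-\lambda)\tilde\nu$ and $\mu=\lambda(\lambda'\delta_B+(1-\lambda')\delta_{B'})+(1-\lambda)\tilde\nu$ with $\tilde\nu$ a probability measure, $\lambda\in[0,1]$, $\lambda'\in(0,1)$, $A=\lambda'B+(1-\lambda')B'$, $\operatorname{rank}(B'-B)=1$. The laminates of finite order are the elements of the smallest set of measures containing all Dirac masses and invariant under elementary splitting. *Staircase laminates.* Let $K\subset\mathbb{R}^{d\times m}$. A staircase laminate supported in $K$ with barycenter $A$ is a probability measure $\nu^\infty$ with $\overline{\nu^\infty}=A$ for which there are matrices $A_n\notin K$ ($n\ge 0$) with $A_0=A$, probability measures $\mu_n$ supported in $K$ and $\gamma_n\in(0,1)$ ($n\ge1$) such that: $\omega_n=(1-\gamma_n)\mu_n+\gamma_n\delta_{A_n}$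 is a laminate of finite order with barycenter $A_{n-1}$ for every $n\ge 1$; $|A_n|$ is non-decreasing with $|A_n|\to\infty$; $\beta_n:=\prod_{k=1}^n\gamma_k\to0$; and $\nu^\infty(E)=\lim_{N\to\infty}\big(\sum_{n=1}^N\beta_{n-1}(1-\gamma_n)\mu_n+\beta_N\delta_{A_N}\big)(E)$ for every Borel set $E$. *Domains and norms.* A regular domain is an open, bounded, connected (non-empty) set $\Omega\subset\mathbb{R}^m$ with $|\partial\Omega|=0$. Let $l_{A,b}(x)=Ax+b$. The norm $\|v\|_{C^\alpha(\overline\Omega)}$ is the supremum of $|v|$ plus the $\alpha$-Hölder seminorm of $v$ on $\overline\Omega$ (for $\alpha=0$ this is equivalent to the supremum norm). **Statement.** Let $K\subset\mathbb{R}^{d\times m}$, $1<p\le r<\infty$, $0\le\rho\le r$ and $M>1$. Suppose that for every $A\in\mathbb{R}^{d\times m}$ there is a probability measure $\nu_A^\infty$, supported on $K$ and with barycenter $A$, of the form $$\nu_A^\infty=\sum_{j=1}^{J'}\lambda_j\delta_{B_j}+\sum_{j=J'+1}^{J}\lambda_j\tilde\nu_j^\infty,$$ where $\lambda_j\ge0$,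 $\sum_{j=1}^J\lambda_j\delta_{B_j}$ is a laminate of finite order with barycenter $A$, $B_j\in K$ for $j\le J'$, and for $j>J'$ the measure $\tilde\nu_j^\infty$ is a staircase laminate supported in $K$ with barycenter $B_j$, and such that $$M^{-p}(1+|A|^\rho)t^{-p}\le\nu_A^\infty(\{X:|X|>t\})\le M^p(1+|A|^r)t^{-p}\qquad\text{for all }t>1+|A|.$$ Then for every regular domain $\Omega\subset\mathbb{R}^m$, every $A\in\mathbb{R}^{d\times m}$, $b\in\mathbb{R}^d$, $\delta>0$ and $\alpha\in[0,1)$ there exists $u\in W^{1,1}(\Omega;\mathbb R^d)\cap C^\alpha(\overline\Omega;\mathbb R^d)$ such that $u=l_{A,b}$ on $\partial\Omega$, $$\nabla u\in K\ \text{ a.e. in }\Omega,\qquad \|u-l_{A,b}\|_{C^\alpha(\overline\Omega)}<\delta,$$ and $$\int_B|\nabla u|^p\,dx=\infty\qquad\text{for every open ball }B\subset\Omega.$$ -/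

import Mathlib

open MeasureTheory Filter Set
open scoped NNReal ENNReal Topology Matrix Matrix.Norms.Frobenius

/-- The space of real `d × m` matrices. The norm `‖X‖` used below is the Euclidean (Frobenius)
norm. -/
abbrev Mat (d m : ℕ) := Matrix (Fin d) (Fin m) ℝ

/-- The Borel σ-algebra on matrices, as the product σ-algebra over the entries. -/
instance instMeasurableSpaceMat (d m : ℕ) : MeasurableSpace (Mat d m) :=
  inferInstanceAs (MeasurableSpace (Fin d → Fin m → ℝ))

noncomputable section

/-! ### Laminates -/

/-- `A` is the barycenter (center of mass) `∫ X dν(X)` of `ν`; the first moment is required to be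
finite. -/
def HasBarycenter {d m : ℕ} (ν : Measure (Mat d m)) (A : Mat d m) : Prop :=
  ∀ i j, Integrable (fun X : Mat d m => X i j) ν ∧ ∫ X : Mat d m, X i j ∂ν = A i j

/-- `μ` is obtained from `ν` by elementary splitting: `ν = l δ_A + (1 - l) ν'`, and
`μ = l (l' δ_B + (1 - l') δ_B') + (1 - l) ν'`, where `A = l' B + (1 - l') B'` and `B' - B` has
rank one. -/
def ElementarySplitting {d m : ℕ} (ν μ : Measure (Mat d m)) : Prop :=
  ∃ (ν' : Measure (Mat d m)) (A B B' : Mat d m) (l l' : ℝ),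
    IsProbabilityMeasure ν' ∧ l ∈ Icc (0 : ℝ) 1 ∧ l' ∈ Ioo (0 : ℝ) 1 ∧
    A = l' • B + (1 - l') • B' ∧ (B' - B).rank = 1 ∧
    ν = ENNReal.ofReal l • Measure.dirac A + ENNReal.ofReal (1 - l) • ν' ∧
    μ = ENNReal.ofReal l •
          (ENNReal.ofReal l' • Measure.dirac B + ENNReal.ofReal (1 - l') • Measure.dirac B') +
        ENNReal.ofReal (1 - l) • ν'

/-- Laminates of finite order: the smallest class of measures that contains all Dirac masses and is
invariant under elementary splitting. -/
inductive IsFiniteLaminate {d m : ℕ} : Measure (Mat d m) → Prop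
  | dirac (A : Mat d m) : IsFiniteLaminate (Measure.dirac A)
  | split {ν μ : Measure (Mat d m)} (hν : IsFiniteLaminate ν) (h : ElementarySplitting ν μ) :
      IsFiniteLaminate μ

/-- `β_n = γ_1 ⋯ γ_n`. The sequences are indexed from zero here: `γ n` and `μ n` are the
quantities usually called `γ_{n+1}` and `μ_{n+1}`. -/
def staircaseBeta (γ : ℕ → ℝ) (n : ℕ) : ℝ := ∏ k ∈ Finset.range n, γ k

/-- The finite-step staircase measure
`ν^N = ∑_{n=1}^N β_{n-1} (1 - γ_n) μ_n + β_N δ_{A_N}`. -/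
def staircaseStep {d m : ℕ} (A : ℕ → Mat d m) (μ : ℕ → Measure (Mat d m)) (γ : ℕ → ℝ) (N : ℕ) :
    Measure (Mat d m) :=
  ∑ n ∈ Finset.range N, ENNReal.ofReal (staircaseBeta γ n * (1 - γ n)) • μ n +
    ENNReal.ofReal (staircaseBeta γ N) • Measure.dirac (A N)

/-- `ν` is a staircase laminate supported in `K` with barycenter `A`: there are matrices
`A_n ∉ K` with `A_0 = A`, probability measures `μ_n` supported in `K` and numbers `γ_n ∈ (0,1)` such
that `ω_n = (1 - γ_n) μ_n + γ_n δ_{A_n}` is a laminate of finite order with barycenter `A_{n-1}`,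
`|A_n|` increases to infinity, `β_n → 0`, and `ν` is the setwise limit of the measures `ν^N`.
The last clause says that `A` is also the barycenter of the limit measure `ν` itself. -/
def IsStaircaseLaminate {d m : ℕ} (K : Set (Mat d m)) (A : Mat d m) (ν : Measure (Mat d m)) :
    Prop :=
  (∃ (As : ℕ → Mat d m) (μ : ℕ → Measure (Mat d m)) (γ : ℕ → ℝ),
    As 0 = A ∧
    (∀ n, As n ∉ K) ∧
    (∀ n, IsProbabilityMeasure (μ n) ∧ μ n Kᶜ = 0) ∧
    (∀ n, γ n ∈ Ioo (0 : ℝ) 1) ∧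
    (∀ n, IsFiniteLaminate
            (ENNReal.ofReal (1 - γ n) • μ n + ENNReal.ofReal (γ n) • Measure.dirac (As (n + 1))) ∧
          HasBarycenter
            (ENNReal.ofReal (1 - γ n) • μ n + ENNReal.ofReal (γ n) • Measure.dirac (As (n + 1)))
            (As n)) ∧
    Monotone (fun n => ‖As n‖) ∧
    Tendsto (fun n => ‖As n‖) atTop atTop ∧
    Tendsto (staircaseBeta γ) atTop (𝓝 0) ∧
    ∀ E : Set (Mat d m), MeasurableSet E →
      Tendsto (fun N => staircaseStep As μ γ N E) atTop (𝓝 (ν E))) ∧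
  HasBarycenter ν A

/-- `ν` is a finite mixture `∑_i λ_i δ_{B_i} + ∑_j κ_j ν_j`, where `∑_i λ_i δ_{B_i} + ∑_j κ_j δ_{C_j}`
is a laminate of finite order with barycenter `A`, all `B_i` lie in `K`, and each `ν_j` is a
staircase laminate supported in `K` with barycenter `C_j`. -/
def IsExtendedStaircaseLaminate {d m : ℕ} (K : Set (Mat d m)) (A : Mat d m)
    (ν : Measure (Mat d m)) : Prop :=
  ∃ (I J : ℕ) (lam : Fin I → ℝ) (B : Fin I → Mat d m) (kap : Fin J → ℝ) (C : Fin J → Mat d m)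
    (ν' : Fin J → Measure (Mat d m)),
    (∀ i, 0 ≤ lam i) ∧ (∀ j, 0 ≤ kap j) ∧
    IsFiniteLaminate (∑ i, ENNReal.ofReal (lam i) • Measure.dirac (B i) +
      ∑ j, ENNReal.ofReal (kap j) • Measure.dirac (C j)) ∧
    HasBarycenter (∑ i, ENNReal.ofReal (lam i) • Measure.dirac (B i) +
      ∑ j, ENNReal.ofReal (kap j) • Measure.dirac (C j)) A ∧
    (∀ i, B i ∈ K) ∧
    (∀ j, IsStaircaseLaminate K (C j) (ν' j)) ∧
    ν = ∑ i, ENNReal.ofReal (lam i) • Measure.dirac (B i) + ∑ j, ENNReal.ofReal (kap j) • ν' j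

/-! ### Domains and function spaces -/

/-- Regular domains: open, bounded, connected, with Lebesgue-null boundary. -/
structure IsRegularDomain {m : ℕ} (Ω : Set (EuclideanSpace ℝ (Fin m))) : Prop where
  isOpen : IsOpen Ω
  isBounded : Bornology.IsBounded Ω
  isConnected : IsConnected Ω
  volume_frontier : volume (frontier Ω) = 0

/-- The affine map `l_{A,b}(x) = A x + b`. -/
def affineMap {d m : ℕ} (A : Mat d m) (b : EuclideanSpace ℝ (Fin d))
    (x : EuclideanSpace ℝ (Fin m)) : EuclideanSpace ℝ (Fin d) :=
  WithLp.toLp 2 (A *ᵥ x.ofLp) + b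

/-- The `C^α` norm on a set `S`, with values in `[0,∞]`: the supremum of `|v|` over `S` plus the
`α`-Hölder seminorm of the restriction of `v` to `S`. (For `α = 0` the seminorm is the oscillation,
so that this is equivalent to the supremum norm.) -/
def holderNormOn {m d : ℕ} (α : ℝ≥0) (S : Set (EuclideanSpace ℝ (Fin m)))
    (v : EuclideanSpace ℝ (Fin m) → EuclideanSpace ℝ (Fin d)) : ℝ≥0∞ :=
  (⨆ x ∈ S, ‖v x‖ₑ) + eHolderNorm α (S.domRestrict v)

/-- `u ∈ C^α(S)`. -/
def MemHolderOn {m d : ℕ} (α : ℝ≥0) (S : Set (EuclideanSpace ℝ (Fin m)))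
    (u : EuclideanSpace ℝ (Fin m) → EuclideanSpace ℝ (Fin d)) : Prop :=
  ContinuousOn u S ∧ holderNormOn α S u < ⊤

/-- `u ∈ W^{1,1}(Ω)` with weak gradient `∇u = G`, where `(∇u)_{ij} = ∂_j u_i`. -/
structure IsSobolevW11 {m d : ℕ} (Ω : Set (EuclideanSpace ℝ (Fin m)))
    (u : EuclideanSpace ℝ (Fin m) → EuclideanSpace ℝ (Fin d))
    (G : EuclideanSpace ℝ (Fin m) → Mat d m) : Prop where
  integrable : IntegrableOn u Ω
  integrable_grad : ∀ i j, IntegrableOn (fun x => G x i j) Ω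
  weak_grad : ∀ φ : EuclideanSpace ℝ (Fin m) → ℝ, ContDiff ℝ (⊤ : ℕ∞) φ → HasCompactSupport φ →
    tsupport φ ⊆ Ω → ∀ i j,
      ∫ x in Ω, u x i * fderiv ℝ φ x (EuclideanSpace.single j 1) = -∫ x in Ω, G x i j * φ x

end

/-! The map is a limit of Lipschitz, piecewise affine maps. What must be arranged is that the
gradients settle in `K` almost everywhere and converge in `L^1`, while their `p`-energy is forced to
blow up in every ball.

Building blocks. A rank one splitting of `A` is, up to a small loss of volume, the distribution of
the gradients of a perturbation of an affine map with gradient `A`, supported in any bounded open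
set and small in `C^α`: the set is filled by tiny copies of one long tent (`exists_block`,
`realizable_twoPoint`). Superposing perturbations on the pieces of earlier ones (`Realizable.subst`)
gives the same for all laminates of finite order. A staircase is stopped after `N` steps, which
leaves a mass `β_N` at `A_N`. Here `β_N |A_N| → 0`, because `β_N A_N` is the barycenter minus the
mean of the part already on `K`, and these means converge to the barycenter of the limit measure
(`IsStaircaseLaminate.exists_staircase`).

Price. An unresolved gradient `X` is charged `1 + |X|` plus the least first moment of a mixture that
resolves it. The tail of a staircase is again a staircase, starting at `A_N`; hence the price of the
mass left at `A_N` is at most `β_N + β_N |A_N|` plus the tail of a convergent series, and tends to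
zero (`Staircase.tendsto_price`). Resolving all pending gradients changes the gradient in `L^1` by
about twice the pending price at most, and leaves a price as small as desired for the next stage
(`IsPiecewiseAffine.exists_resolve_step`). The increments are therefore summable in `L^1`.

Energy. The lower tail bound makes the `p`-th moment infinite, whereas the first moment is finite. A
late truncation, used on a tiny ball, thus inserts energy at least 2 at arbitrarily small cost in
`L^1` (`IsPiecewiseAffine.exists_energy_step`). At every stage there are only finitely many
gradients, so the sets on which gradients in `K` are changed later can be taken so small that at
most 1 of this energy is lost. The balls used return to every given ball infinitely often. Every
ball in `Ω` then contains sets of volume tending to zero that carry limit energy at least 1, which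
is impossible if its total energy is finite (`IsStageSeq.lintegral_eq_top`). Since the changed sets
have summable volume, Borel–Cantelli makes the gradients eventually constant
(`IsStageSeq.exists_grad`). -/

noncomputable section

/-- Euclidean space of dimension `n`. -/
abbrev Euc (n : ℕ) := EuclideanSpace ℝ (Fin n)

instance instMeasurableSingletonClassMat (d m : ℕ) : MeasurableSingletonClass (Mat d m) :=
  inferInstanceAs (MeasurableSingletonClass (Fin d → Fin m → ℝ))

/-! ### Locally affine maps -/

section LocallyAffine

variable {d m : ℕ}

theorem affineMap_apply (A : Mat d m) (b : Euc d) (x : Euc m) (i : Fin d) :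
    affineMap A b x i = ∑ j, A i j * x j + b i := by
  simp [affineMap, Matrix.mulVec, dotProduct]

theorem affineMap_add (A B : Mat d m) (b c : Euc d) (x : Euc m) :
    affineMap (A + B) (b + c) x = affineMap A b x + affineMap B c x := by
  ext i
  simp only [affineMap_apply, PiLp.add_apply, Matrix.add_apply, add_mul, Finset.sum_add_distrib]
  ring

theorem affineMap_zero_left (b : Euc d) (x : Euc m) : affineMap (0 : Mat d m) b x = b := by
  ext i
  simp [affineMap_apply]

theorem exists_lipschitzWith_affineMap (A : Mat d m) (b : Euc d) :
    ∃ L, LipschitzWith L (affineMap A b) := by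
  obtain ⟨L, hL⟩ : ∃ L, LipschitzWith L fun x : Euc m =>
      (LinearMap.toContinuousLinearMap (Matrix.toEuclideanLin A)) x :=
    ⟨_, ContinuousLinearMap.lipschitz _⟩
  refine ⟨L, fun x y => ?_⟩
  have := hL x y
  simp only [affineMap, edist_add_right]
  exact this

/-- The open set of points near which `u` is affine with gradient `X`. -/
def affineSet (u : Euc m → Euc d) (X : Mat d m) : Set (Euc m) :=
  {x | ∃ c, u =ᶠ[𝓝 x] affineMap X c}

theorem isOpen_affineSet (u : Euc m → Euc d) (X : Mat d m) : IsOpen (affineSet u X) := by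
  rw [isOpen_iff_eventually]
  rintro x ⟨c, hc⟩
  filter_upwards [eventually_eventually_nhds.2 hc] with y hy using ⟨c, hy⟩

theorem measurableSet_affineSet (u : Euc m → Euc d) (X : Mat d m) :
    MeasurableSet (affineSet u X) := (isOpen_affineSet u X).measurableSet

theorem affineSet_congr {u v : Euc m → Euc d} {X : Mat d m} {x : Euc m} (h : u =ᶠ[𝓝 x] v) :
    x ∈ affineSet u X ↔ x ∈ affineSet v X :=
  ⟨fun ⟨c, hc⟩ => ⟨c, h.symm.trans hc⟩, fun ⟨c, hc⟩ => ⟨c, h.trans hc⟩⟩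

theorem mem_affineSet_affineMap (A : Mat d m) (b : Euc d) (x : Euc m) :
    x ∈ affineSet (affineMap A b) A := ⟨b, EventuallyEq.rfl⟩

theorem mem_affineSet_zero {u : Euc m → Euc d} {x : Euc m} (h : u =ᶠ[𝓝 x] 0) :
    x ∈ affineSet u 0 :=
  ⟨0, h.trans (Eventually.of_forall fun y => (affineMap_zero_left 0 y).symm)⟩

theorem add_mem_affineSet {u v : Euc m → Euc d} {X Y : Mat d m} {x : Euc m}
    (hu : x ∈ affineSet u X) (hv : x ∈ affineSet v Y) : x ∈ affineSet (u + v) (X + Y) := by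
  obtain ⟨c, hc⟩ := hu
  obtain ⟨c', hc'⟩ := hv
  refine ⟨c + c', ?_⟩
  filter_upwards [hc, hc'] with y hy hy'
  rw [Pi.add_apply, hy, hy', affineMap_add]

/-- The matrix of partial derivatives of `u`. -/
def grad (u : Euc m → Euc d) (x : Euc m) : Mat d m :=
  Matrix.of fun i j => lineDeriv ℝ (fun y => u y i) x (EuclideanSpace.single j 1)

theorem grad_congr {u v : Euc m → Euc d} {x : Euc m} (h : u =ᶠ[𝓝 x] v) :
    grad u x = grad v x := by
  ext i j
  simp only [grad, Matrix.of_apply]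
  refine EventuallyEq.lineDeriv_eq ?_
  filter_upwards [h] with y hy
  rw [hy]

theorem grad_affineMap (A : Mat d m) (b : Euc d) (x : Euc m) : grad (affineMap A b) x = A := by
  ext i j
  simp only [grad, Matrix.of_apply, lineDeriv]
  have h : (fun t : ℝ => affineMap A b (x + t • EuclideanSpace.single j 1) i) =
      fun t : ℝ => affineMap A b x i + t * A i j := by
    funext t
    simp only [affineMap_apply, PiLp.add_apply, PiLp.smul_apply, mul_add, Finset.sum_add_distrib,
      PiLp.single_apply, smul_eq_mul]
    simp
    ring
  rw [h]
  simp

theorem grad_eq_of_mem {u : Euc m → Euc d} {X : Mat d m} {x : Euc m} (h : x ∈ affineSet u X) :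
    grad u x = X := by
  obtain ⟨c, hc⟩ := h
  rw [grad_congr hc, grad_affineMap]

theorem affineSet_unique {u : Euc m → Euc d} {X Y : Mat d m} {x : Euc m}
    (hX : x ∈ affineSet u X) (hY : x ∈ affineSet u Y) : X = Y :=
  (grad_eq_of_mem hX).symm.trans (grad_eq_of_mem hY)

theorem disjoint_affineSet (u : Euc m → Euc d) {X Y : Mat d m} (h : X ≠ Y) :
    Disjoint (affineSet u X) (affineSet u Y) :=
  Set.disjoint_left.2 fun _ hX hY => h (affineSet_unique hX hY)

/-- Line derivatives of a continuous function are measurable without any differentiability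
assumption, a reason to build `grad` from them. -/
theorem measurable_grad {u : Euc m → Euc d} (hu : Continuous u) : Measurable (grad u) := by
  refine measurable_pi_iff.2 fun i => measurable_pi_iff.2 fun j => ?_
  have h : Continuous fun y => u y i := by fun_prop
  exact measurable_lineDeriv h

end LocallyAffine

/-! ### Small perturbations -/

section Pert

variable {d m : ℕ} {α τ τ₁ τ₂ : ℝ≥0} {U V : Set (Euc m)} {w v : Euc m → Euc d}

/-- `w` is a Lipschitz map which vanishes outside `U`, and whose supremum and Hölder seminorm are
at most `τ`. -/
structure Pert (α τ : ℝ≥0) (U : Set (Euc m)) (w : Euc m → Euc d) : Prop where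
  lip : ∃ L, LipschitzWith L w
  zero : ∀ x ∉ U, w x = 0
  bound : ∀ x, ‖w x‖ ≤ τ
  holder : HolderWith τ α w

theorem Pert.mono (h : Pert α τ₁ U w) (hτ : τ₁ ≤ τ₂) (hU : U ⊆ V) : Pert α τ₂ V w :=
  ⟨h.lip, fun x hx => h.zero x fun hx' => hx (hU hx'), fun x =>
    (h.bound x).trans (by exact_mod_cast hτ), h.holder.mono hτ⟩

theorem Pert.add (h : Pert α τ₁ U w) (h' : Pert α τ₂ U v) : Pert α (τ₁ + τ₂) U (w + v) := by
  obtain ⟨L, hL⟩ := h.lip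
  obtain ⟨L', hL'⟩ := h'.lip
  refine ⟨⟨L + L', hL.add hL'⟩, fun x hx => ?_, fun x => ?_, h.holder.add h'.holder⟩
  · simp [h.zero x hx, h'.zero x hx]
  · exact (norm_add_le _ _).trans (by push_cast; exact add_le_add (h.bound x) (h'.bound x))

theorem Pert.of_zero : Pert α τ U (0 : Euc m → Euc d) :=
  ⟨⟨0, LipschitzWith.const' 0⟩, fun _ _ => rfl, fun _ => by simp, HolderWith.zero⟩

theorem Pert.sum {ι : Type*} (s : Finset ι) {t : ι → ℝ≥0} {W : ι → Euc m → Euc d}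
    (h : ∀ i ∈ s, Pert α (t i) U (W i)) : Pert α (∑ i ∈ s, t i) U (∑ i ∈ s, W i) := by
  classical
  induction s using Finset.induction_on with
  | empty => simpa using Pert.of_zero
  | insert a s ha ih =>
    rw [Finset.sum_insert ha, Finset.sum_insert ha]
    exact (h a (Finset.mem_insert_self _ _)).add
      (ih fun i hi => h i (Finset.mem_insert_of_mem hi))

theorem Pert.eventuallyEq_zero (h : Pert α τ U w) {x : Euc m} (hx : x ∉ closure U) :
    w =ᶠ[𝓝 x] 0 := by
  filter_upwards [isClosed_closure.isOpen_compl.mem_nhds hx] with y hy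
  exact h.zero y fun hy' => hy (subset_closure hy')

/-- A Lipschitz map with small supremum is small in `C^α`. -/
theorem exists_pert_of_lipschitz (hα : α < 1) (L : ℝ≥0) (hτ : 0 < τ) :
    ∃ η : ℝ, 0 < η ∧ ∀ (U : Set (Euc m)) (w : Euc m → Euc d), LipschitzWith L w →
      (∀ x ∉ U, w x = 0) → (∀ x, ‖w x‖ ≤ η) → Pert α τ U w := by
  -- Interpolation between the oscillation `2 η` and the Lipschitz constant `L` gives the Hölder
  -- constant `(2 η)^(1 - α) L^α`, which vanishes with `η` because `α < 1`.
  have hlim : Tendsto (fun η : ℝ≥0 => (2 * η) ^ ((1 : ℝ) - α) * L ^ (α : ℝ)) (𝓝 0) (𝓝 0) := by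
    have h1 : (0 : ℝ) < 1 - α := by
      have : (α : ℝ) < 1 := by exact_mod_cast hα
      linarith
    have h2 : Continuous fun η : ℝ≥0 => (2 * η) ^ ((1 : ℝ) - α) * L ^ (α : ℝ) :=
      ((NNReal.continuous_rpow_const h1.le).comp (by fun_prop)).mul continuous_const
    have h3 := h2.tendsto 0
    simpa [NNReal.zero_rpow h1.ne'] using h3
  obtain ⟨η₀, hη₀, h⟩ : ∃ η₀ : ℝ≥0, 0 < η₀ ∧
      (2 * η₀) ^ ((1 : ℝ) - α) * L ^ (α : ℝ) ≤ τ := by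
    have h1 := (hlim.mono_left nhdsWithin_le_nhds : Tendsto _ (𝓝[>] (0 : ℝ≥0)) _)
    obtain ⟨x, hx, hx'⟩ := ((h1.eventually (gt_mem_nhds hτ)).and self_mem_nhdsWithin).exists
    exact ⟨x, hx', hx.le⟩
  refine ⟨min η₀ τ, by positivity, fun U w hL h0 hb => ⟨⟨L, hL⟩, h0, fun x =>
    (hb x).trans (min_le_right _ _), ?_⟩⟩
  have hz : HolderWith (2 * η₀) 0 w := by
    intro x y
    have h1 : nndist (w x) (w y) ≤ 2 * η₀ := by
      rw [← NNReal.coe_le_coe, coe_nndist]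
      push_cast
      have h2 := dist_le_norm_add_norm (w x) (w y)
      have h3 := (hb x).trans (min_le_left _ _)
      have h4 := (hb y).trans (min_le_left _ _)
      linarith
    rw [edist_nndist]
    simpa using (ENNReal.coe_le_coe.2 h1)
  have h1 := hz.interpolate (holderWith_one.2 hL) (tsub_add_cancel_of_le hα.le)
  have h2 : HolderWith ((2 * η₀) ^ ((1 : ℝ) - α) * L ^ (α : ℝ)) α w := by
    simpa [NNReal.coe_sub hα.le] using h1
  exact h2.mono h

end Pert

/-! ### Positive parts of minima of affine functions -/

section Cutoff

variable {m : ℕ} {ι : Type*} [Fintype ι] [Nonempty ι]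

/-- The minimum of finitely many affine functions. -/
def minAffine (ξ : ι → Euc m) (c : ι → ℝ) (x : Euc m) : ℝ :=
  Finset.univ.inf' Finset.univ_nonempty fun k => inner ℝ (ξ k) x + c k

/-- The positive part of the minimum of finitely many affine functions. -/
def cutoff (ξ : ι → Euc m) (c : ι → ℝ) (x : Euc m) : ℝ := max 0 (minAffine ξ c x)

theorem minAffine_le (ξ : ι → Euc m) (c : ι → ℝ) (x : Euc m) (k : ι) :
    minAffine ξ c x ≤ inner ℝ (ξ k) x + c k :=
  Finset.inf'_le (fun k => inner ℝ (ξ k) x + c k) (Finset.mem_univ k)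

theorem exists_minAffine_eq (ξ : ι → Euc m) (c : ι → ℝ) (x : Euc m) :
    ∃ k, minAffine ξ c x = inner ℝ (ξ k) x + c k := by
  obtain ⟨k, -, hk⟩ := Finset.exists_mem_eq_inf' Finset.univ_nonempty
    (fun k => inner ℝ (ξ k) x + c k)
  exact ⟨k, hk⟩

theorem minAffine_eq_of_le {ξ : ι → Euc m} {c : ι → ℝ} {x : Euc m} {k : ι}
    (h : ∀ l, inner ℝ (ξ k) x + c k ≤ inner ℝ (ξ l) x + c l) :
    minAffine ξ c x = inner ℝ (ξ k) x + c k :=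
  le_antisymm (minAffine_le ξ c x k) (Finset.le_inf' _ _ fun l _ => h l)

theorem lipschitzWith_minAffine {ξ : ι → Euc m} (hξ : ∀ k, ‖ξ k‖ ≤ 1) (c : ι → ℝ) :
    LipschitzWith 1 (minAffine ξ c) := by
  refine LipschitzWith.of_le_add fun x y => ?_
  obtain ⟨k, hk⟩ := exists_minAffine_eq ξ c y
  have h1 := minAffine_le ξ c x k
  have h2 : inner ℝ (ξ k) (x - y) ≤ dist x y := by
    rw [dist_eq_norm]
    refine (real_inner_le_norm _ _).trans ?_
    exact mul_le_of_le_one_left (norm_nonneg _) (hξ k)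
  rw [inner_sub_right] at h2
  linarith

theorem lipschitzWith_cutoff {ξ : ι → Euc m} (hξ : ∀ k, ‖ξ k‖ ≤ 1) (c : ι → ℝ) :
    LipschitzWith 1 (cutoff ξ c) := (lipschitzWith_minAffine hξ c).const_max 0

theorem cutoff_nonneg (ξ : ι → Euc m) (c : ι → ℝ) (x : Euc m) : 0 ≤ cutoff ξ c x :=
  le_max_left _ _

/-- Rescaling of this type preserves the gradients `ξ` and only changes the constants, so what holds
for all cutoffs applies to the copies in a covering. -/
theorem minAffine_scale (ξ : ι → Euc m) (c : ι → ℝ) {r : ℝ} (hr : 0 < r) (a x : Euc m) :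
    r * minAffine ξ c (r⁻¹ • (x - a)) = minAffine ξ (fun k => r * c k - inner ℝ (ξ k) a) x := by
  have key : ∀ k, r * (inner ℝ (ξ k) (r⁻¹ • (x - a)) + c k) =
      inner ℝ (ξ k) x + (r * c k - inner ℝ (ξ k) a) := by
    intro k
    rw [inner_smul_right, inner_sub_right]
    field_simp
    ring
  obtain ⟨k, hk⟩ := exists_minAffine_eq ξ c (r⁻¹ • (x - a))
  rw [hk, key, minAffine_eq_of_le]
  intro l
  rw [← key, ← key, ← hk]
  exact mul_le_mul_of_nonneg_left (minAffine_le _ _ _ _) hr.le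

theorem cutoff_scale (ξ : ι → Euc m) (c : ι → ℝ) {r : ℝ} (hr : 0 < r) (a x : Euc m) :
    r * cutoff ξ c (r⁻¹ • (x - a)) = cutoff ξ (fun k => r * c k - inner ℝ (ξ k) a) x := by
  rw [cutoff, mul_max_of_nonneg _ _ hr.le, minAffine_scale ξ c hr, mul_zero, cutoff]

theorem volume_hyperplane {η : Euc m} (hη : η ≠ 0) (t : ℝ) :
    volume {x : Euc m | inner ℝ η x = t} = 0 := by
  set p : Euc m := (t / ‖η‖ ^ 2) • η
  have hp : inner ℝ η p = t := by
    rw [inner_smul_right, real_inner_self_eq_norm_sq]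
    field_simp [norm_ne_zero_iff.2 hη]
  have h1 : {x : Euc m | inner ℝ η x = t} =
      (fun x => x + (-p)) ⁻¹'
        ((LinearMap.ker (innerₛₗ ℝ η) : Submodule ℝ (Euc m)) : Set (Euc m)) := by
    ext x
    simp [← sub_eq_add_neg, inner_sub_right, hp, sub_eq_zero]
  rw [h1, measure_preimage_add_right]
  refine Measure.addHaar_submodule _ _ fun h => hη ?_
  have h2 : η ∈ LinearMap.ker (innerₛₗ ℝ η) := h ▸ Submodule.mem_top
  simpa using h2

theorem ae_inner_add_ne {ξ ξ' : Euc m} {c c' : ℝ} (h : ξ ≠ ξ' ∨ c ≠ c') :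
    ∀ᵐ x : Euc m, inner ℝ ξ x + c ≠ inner ℝ ξ' x + c' := by
  by_cases hξ : ξ = ξ'
  · subst hξ
    exact Eventually.of_forall fun x hx => by simp_all
  · rw [ae_iff]
    refine measure_mono_null ?_ (volume_hyperplane (sub_ne_zero.2 hξ) (c' - c))
    intro x hx
    simp only [ne_eq, not_not, mem_ofPred_eq, inner_sub_left] at hx ⊢
    linarith

/-- Off the null set where two different members of the family agree, the least one is strictly
below all members different from it, and remains so nearby. -/
theorem ae_exists_minAffine_eventuallyEq (ξ : ι → Euc m) (c : ι → ℝ) :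
    ∀ᵐ x : Euc m, ∃ k, minAffine ξ c =ᶠ[𝓝 x] fun y => inner ℝ (ξ k) y + c k := by
  have h : ∀ᵐ x : Euc m, ∀ k l, (ξ k ≠ ξ l ∨ c k ≠ c l) →
      inner ℝ (ξ k) x + c k ≠ inner ℝ (ξ l) x + c l := by
    refine ae_all_iff.2 fun k => ae_all_iff.2 fun l => ?_
    by_cases hkl : ξ k ≠ ξ l ∨ c k ≠ c l
    · filter_upwards [ae_inner_add_ne hkl] with x hx _ using hx
    · exact Eventually.of_forall fun x h => absurd h hkl
  filter_upwards [h] with x hx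
  obtain ⟨k, hk⟩ := exists_minAffine_eq ξ c x
  refine ⟨k, ?_⟩
  have h1 : ∀ l, ∀ᶠ y in 𝓝 x, inner ℝ (ξ k) y + c k ≤ inner ℝ (ξ l) y + c l := by
    intro l
    by_cases hkl : ξ k ≠ ξ l ∨ c k ≠ c l
    · have h2 : inner ℝ (ξ k) x + c k < inner ℝ (ξ l) x + c l :=
        lt_of_le_of_ne (hk ▸ minAffine_le ξ c x l) (hx k l hkl)
      have h3 : ContinuousAt (fun y => inner ℝ (ξ k) y + c k) x := by fun_prop
      have h4 : ContinuousAt (fun y => inner ℝ (ξ l) y + c l) x := by fun_prop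
      exact (h3.eventually_lt h4 h2).mono fun _ => le_of_lt
    · push Not at hkl
      simp [hkl.1, hkl.2]
  filter_upwards [eventually_all.2 h1] with y hy using minAffine_eq_of_le hy

theorem ae_exists_cutoff_eventuallyEq (ξ : ι → Euc m) (c : ι → ℝ) :
    ∀ᵐ x : Euc m, 0 < minAffine ξ c x →
      ∃ k, cutoff ξ c =ᶠ[𝓝 x] fun y => inner ℝ (ξ k) y + c k := by
  filter_upwards [ae_exists_minAffine_eventuallyEq ξ c] with x ⟨k, hk⟩ hx
  refine ⟨k, ?_⟩
  have h1 : ContinuousAt (fun y => inner ℝ (ξ k) y + c k) x := by fun_prop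
  have h2 : 0 < inner ℝ (ξ k) x + c k := lt_of_lt_of_eq hx hk.self_of_nhds
  filter_upwards [hk, h1.eventually (lt_mem_nhds h2)] with y hy hy'
  rw [cutoff, hy, max_eq_right hy'.le]

theorem ae_minAffine_ne_zero {ξ : ι → Euc m} (hξ : ∀ k, ξ k ≠ 0) (c : ι → ℝ) :
    ∀ᵐ x : Euc m, minAffine ξ c x ≠ 0 := by
  have h : ∀ᵐ x : Euc m, ∀ k, inner ℝ (ξ k) x + c k ≠ inner ℝ (0 : Euc m) x + 0 :=
    ae_all_iff.2 fun k => ae_inner_add_ne (Or.inl (hξ k))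
  filter_upwards [h] with x hx
  obtain ⟨k, hk⟩ := exists_minAffine_eq ξ c x
  rw [hk]
  simpa using hx k

end Cutoff

/-! ### Coverings by scaled copies of a convex body -/

section Covering

variable {m : ℕ}

theorem volume_scaled {r : ℝ} (hr : 0 < r) (a : Euc m) (S : Set (Euc m)) :
    volume {x : Euc m | r⁻¹ • (x - a) ∈ S} = ENNReal.ofReal (r ^ m) * volume S := by
  have h1 : {x : Euc m | r⁻¹ • (x - a) ∈ S} =
      (fun x => x + (-a)) ⁻¹' ((fun x => r⁻¹ • x) ⁻¹' S) := by
    ext x; simp [sub_eq_add_neg]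
  rw [h1, measure_preimage_add_right, Measure.addHaar_preimage_smul _ (inv_ne_zero hr.ne')]
  simp [abs_of_pos hr]

theorem exists_disjoint_scaled_covering {Q : Set (Euc m)} (hQ : IsClosed Q)
    (hQi : (interior Q).Nonempty) {D : ℝ} (hD : 0 < D) (hQD : Q ⊆ Metric.closedBall 0 D)
    {U : Set (Euc m)} (hU : IsOpen U) {r₀ : ℝ} (hr₀ : 0 < r₀) :
    ∃ t : Set (Euc m × ℝ), t.Countable ∧
      (∀ a ∈ t, 0 < a.2 ∧ a.2 ≤ r₀ ∧ {x | a.2⁻¹ • (x - a.1) ∈ Q} ⊆ U) ∧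
      t.PairwiseDisjoint (fun a => {x : Euc m | a.2⁻¹ • (x - a.1) ∈ Q}) ∧
      volume (U \ ⋃ a ∈ t, {x : Euc m | a.2⁻¹ • (x - a.1) ∈ Q}) = 0 := by
  have hcb : ∀ (a : Euc m) {r : ℝ} (_ : 0 < r) (s : ℝ), Metric.closedBall a (r * s) =
      {x | r⁻¹ • (x - a) ∈ Metric.closedBall (0 : Euc m) s} := by
    intro a r hr s
    ext x
    rw [Metric.mem_closedBall, mem_ofPred_eq, Metric.mem_closedBall, dist_zero_right, norm_smul,
      norm_inv, Real.norm_eq_abs, abs_of_pos hr, dist_eq_norm, inv_mul_le_iff₀ hr]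
  have hQpos : volume Q ≠ 0 :=
    (Measure.measure_pos_of_nonempty_interior _ hQi).ne'
  have hQfin : volume Q ≠ ⊤ :=
    ((measure_mono hQD).trans_lt measure_closedBall_lt_top).ne
  -- Vitali's theorem compares a ball of three times the radius with the set itself; for copies of
  -- one body this ratio does not depend on the scale.
  set C : ℝ≥0 := (volume (Metric.closedBall (0 : Euc m) (3 * D)) / volume Q).toNNReal
  have hC : (C : ℝ≥0∞) = volume (Metric.closedBall (0 : Euc m) (3 * D)) / volume Q :=
    ENNReal.coe_toNNReal (ENNReal.div_ne_top measure_closedBall_lt_top.ne hQpos)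
  obtain ⟨t, ht, htc, htd, ht0⟩ := Vitali.exists_disjoint_covering_ae (volume : Measure (Euc m)) U
    {a : Euc m × ℝ | 0 < a.2 ∧ a.2 ≤ r₀ ∧ {x | a.2⁻¹ • (x - a.1) ∈ Q} ⊆ U} C
    (fun a => a.2 * D) (fun a => a.1) (fun a => {x : Euc m | a.2⁻¹ • (x - a.1) ∈ Q})
    (fun a ha => by
      rw [hcb a.1 ha.1]
      exact fun x hx => hQD hx)
    (fun a ha => by
      rw [show 3 * (a.2 * D) = a.2 * (3 * D) by ring, hcb a.1 ha.1, volume_scaled ha.1,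
        volume_scaled ha.1, hC, mul_left_comm, ENNReal.div_mul_cancel hQpos hQfin])
    (fun a ha => by
      obtain ⟨y, hy⟩ := hQi
      refine ⟨a.1 + a.2 • y, ?_⟩
      have h1 : IsOpen {x : Euc m | a.2⁻¹ • (x - a.1) ∈ interior Q} :=
        isOpen_interior.preimage (by fun_prop)
      refine mem_interior.2 ⟨_, fun x hx => ?_, h1, ?_⟩
      · exact interior_subset (s := Q) hx
      simpa [smul_smul, inv_mul_cancel₀ ha.1.ne'] using hy)
    (fun a ha => hQ.preimage (by fun_prop))
    (fun x hx ε hε => by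
      obtain ⟨s, hs, hsU⟩ := Metric.isOpen_iff.1 hU x hx
      set r := min r₀ (min (ε / D) (s / (2 * D)))
      have hr : 0 < r := by positivity
      refine ⟨(x, r), ⟨hr, min_le_left _ _, fun y hy => hsU ?_⟩, ?_, rfl⟩
      · have h1 : y ∈ Metric.closedBall x (r * D) := by
          rw [hcb x hr]
          exact hQD hy
        refine Metric.closedBall_subset_ball ?_ h1
        have h2 : r ≤ s / (2 * D) := (min_le_right _ _).trans (min_le_right _ _)
        calc r * D ≤ s / (2 * D) * D := by gcongr
          _ = s / 2 := by field_simp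
          _ < s := by linarith
      · have h2 : r ≤ ε / D := (min_le_right _ _).trans (min_le_left _ _)
        calc r * D ≤ ε / D * D := by gcongr
          _ = ε := by field_simp)
  exact ⟨t, htc, ht, htd, ht0⟩

/-- Each scaling multiplies the volumes of `P` and `Q` by the same factor, so the fraction `θ`
survives in every copy, and the copies of `Q` exhaust `U` up to a null set. -/
theorem le_volume_iUnion_scaled {Q P U : Set (Euc m)} {t : Set (Euc m × ℝ)} (htc : t.Countable)
    (ht : ∀ a ∈ t, 0 < a.2) (htd : t.PairwiseDisjoint fun a => {x : Euc m | a.2⁻¹ • (x - a.1) ∈ Q})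
    (ht0 : volume (U \ ⋃ a ∈ t, {x : Euc m | a.2⁻¹ • (x - a.1) ∈ Q}) = 0)
    (hPQ : P ⊆ Q) (hP : MeasurableSet P) {θ : ℝ≥0∞} (hθ : θ * volume Q ≤ volume P) :
    θ * volume U ≤ volume (⋃ a ∈ t, {x : Euc m | a.2⁻¹ • (x - a.1) ∈ P}) := by
  have h0 : ∀ a : Euc m × ℝ, {x : Euc m | a.2⁻¹ • (x - a.1) ∈ P} ⊆
      {x : Euc m | a.2⁻¹ • (x - a.1) ∈ Q} := fun a x hx => hPQ (mem_ofPred_eq ▸ hx)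
  have hm : ∀ a : Euc m × ℝ, MeasurableSet {x : Euc m | a.2⁻¹ • (x - a.1) ∈ P} := fun a =>
    hP.preimage (by fun_prop)
  have hd : t.PairwiseDisjoint fun a => {x : Euc m | a.2⁻¹ • (x - a.1) ∈ P} :=
    fun a ha b hb hab => (htd ha hb hab).mono (h0 a) (h0 b)
  rw [measure_biUnion htc hd fun a _ => hm a]
  have : Countable t := htc.to_subtype
  have h1 : volume U ≤ ∑' a : t, volume {x : Euc m | a.1.2⁻¹ • (x - a.1.1) ∈ Q} := by
    refine (measure_le_inter_add_sdiff volume U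
      (⋃ a ∈ t, {x : Euc m | a.2⁻¹ • (x - a.1) ∈ Q})).trans ?_
    rw [ht0, add_zero, biUnion_eq_iUnion]
    exact (measure_mono inter_subset_right).trans (measure_iUnion_le _)
  refine (mul_le_mul_right h1 θ).trans ?_
  rw [← ENNReal.tsum_mul_left]
  refine ENNReal.tsum_le_tsum fun a => ?_
  rw [volume_scaled (ht a.1 a.2), volume_scaled (ht a.1 a.2), mul_left_comm]
  exact mul_le_mul_right hθ _

/-- Disjointly supported sums of nonnegative Lipschitz functions. -/
theorem tsum_eq_of_disjoint {ι : Type*} {h : ι → Euc m → ℝ} {S : ι → Set (Euc m)}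
    (hS : Pairwise fun k l => Disjoint (S k) (S l)) (h0 : ∀ k, ∀ x ∉ S k, h k x = 0)
    {k : ι} {x : Euc m} (hx : x ∈ S k) : ∑' l, h l x = h k x :=
  tsum_eq_single k fun l hl => h0 l x fun hxl => Set.disjoint_left.1 (hS hl) hxl hx

/-- At most one summand is nonzero at each point. By nonnegativity the summand active at `x` is
still at most the whole sum at `y`, so the one-sided estimate of that single summand suffices. -/
theorem lipschitzWith_tsum_of_disjoint {ι : Type*} {h : ι → Euc m → ℝ} {S : ι → Set (Euc m)}
    (hS : Pairwise fun k l => Disjoint (S k) (S l)) (h0 : ∀ k, ∀ x ∉ S k, h k x = 0)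
    (hpos : ∀ k x, 0 ≤ h k x) (hL : ∀ k, LipschitzWith 1 (h k)) :
    LipschitzWith 1 fun x => ∑' k, h k x := by
  refine LipschitzWith.of_le_add fun x y => ?_
  by_cases hx : ∃ k, x ∈ S k
  · obtain ⟨k, hk⟩ := hx
    rw [tsum_eq_of_disjoint hS h0 hk]
    have h1 : h k y ≤ ∑' l, h l y := by
      by_cases hy : ∃ l, y ∈ S l
      · obtain ⟨l, hl⟩ := hy
        rw [tsum_eq_of_disjoint hS h0 hl]
        by_cases hkl : k = l
        · rw [hkl]
        · rw [h0 k y fun hyk => Set.disjoint_left.1 (hS hkl) hyk hl]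
          exact hpos l y
      · rw [h0 k y fun h => hy ⟨k, h⟩]
        exact tsum_nonneg fun l => hpos l y
    have h2 := (le_abs_self _).trans (((hL k).dist_le_mul x y).trans_eq (by simp) :
      |h k x - h k y| ≤ dist x y)
    linarith
  · push Not at hx
    have : ∑' k, h k x = 0 := by simp [h0 _ _ (hx _)]
    rw [this]
    exact add_nonneg (tsum_nonneg fun l => hpos l y) dist_nonneg

end Covering

/-! ### The basic block -/

section Block

variable {m : ℕ}

theorem volume_orthonormal_box (b : OrthonormalBasis (Fin m) ℝ (Euc m)) {s : Fin m → Set ℝ}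
    (hs : ∀ i, MeasurableSet (s i)) :
    volume {x : Euc m | ∀ i, inner ℝ (b i) x ∈ s i} = ∏ i, volume (s i) := by
  have h1 := ((EuclideanSpace.volume_preserving_symm_measurableEquiv_toLp (Fin m)).comp
    b.measurePreserving_repr)
  rw [← volume_pi_pi, ← h1.measure_preimage (MeasurableSet.univ_pi hs).nullMeasurableSet]
  congr 1
  ext x
  simp [b.repr_apply_apply]

theorem exists_orthonormalBasis_apply_eq {n : Euc m} (hn : ‖n‖ = 1) (i₀ : Fin m) :
    ∃ b : OrthonormalBasis (Fin m) ℝ (Euc m), b i₀ = n := by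
  have h : Orthonormal ℝ (({i₀} : Set (Fin m)).domRestrict fun _ => n) := by
    constructor
    · intro i; simpa using hn
    · intro i j hij
      exact absurd (Subsingleton.elim i j) hij
  obtain ⟨b, hb⟩ := Orthonormal.exists_orthonormalBasis_extension_of_card_eq
    (𝕜 := ℝ) (E := Euc m) (by simp) h
  exact ⟨b, hb i₀ rfl⟩

/-- Bernoulli's inequality. It makes a box so long that the part at distance more than 1 from its
side walls has almost full volume. -/
theorem exists_pow_sub_one_ge (N : ℕ) {ε : ℝ} (hε : 0 < ε) :
    ∃ R : ℝ, 1 < R ∧ (1 - ε) * (2 * R) ^ N ≤ (2 * (R - 1)) ^ N := by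
  have h0 : (0 : ℝ) ≤ N / ε := by positivity
  have hR : (0 : ℝ) < N / ε + 2 := by positivity
  refine ⟨N / ε + 2, by linarith, ?_⟩
  set R := N / ε + 2
  have h1 : (1 : ℝ) + N * (-(1 / R)) ≤ (1 + -(1 / R)) ^ N := by
    refine one_add_mul_le_pow ?_ N
    have : 1 / R ≤ 1 := by rw [div_le_one hR]; linarith
    linarith
  have h2 : N * (1 / R) ≤ ε := by
    rw [mul_one_div, div_le_iff₀ hR]
    have : ε * (N / ε) = N := by field_simp
    simp only [R]
    nlinarith
  have h3 : 2 * (R - 1) = (1 + -(1 / R)) * (2 * R) := by field_simp; ring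
  rw [h3, mul_pow (1 + -(1 / R))]
  exact mul_le_mul_of_nonneg_right (by linarith) (by positivity)

/-- The gradients of the basic block. -/
def blockGrad (b : OrthonormalBasis (Fin m) ℝ (Euc m)) (i₀ : Fin m) (l : ℝ)
    (k : Fin m × Bool) : Euc m :=
  if k.1 = i₀ then (if k.2 then l else -(1 - l)) • b i₀ else (if k.2 then (1 : ℝ) else -1) • b k.1

/-- The constants of the basic block. -/
def blockConst (i₀ : Fin m) (l R : ℝ) (k : Fin m × Bool) : ℝ :=
  if k.1 = i₀ then l * (1 - l) else R

/-- The box has width 1 in the direction `b i₀`, where the slab takes the fraction `q - p`; the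
factor `1 - ε` is the loss in the `m - 1` other directions. -/
theorem volume_ge_of_core {b : OrthonormalBasis (Fin m) ℝ (Euc m)} {i₀ : Fin m} {R ε p q : ℝ}
    (hR : 1 < R) (hRε : (1 - ε) * (2 * R) ^ (m - 1) ≤ (2 * (R - 1)) ^ (m - 1)) (hp : 0 ≤ q - p)
    {l : ℝ} :
    ENNReal.ofReal ((1 - ε) * (q - p)) *
      volume {x : Euc m | ∀ i, inner ℝ (b i) x ∈
        if i = i₀ then Icc (-(1 - l)) l else Icc (-R) R} ≤
    volume {x : Euc m | ∀ i, inner ℝ (b i) x ∈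
        if i = i₀ then Ioo p q else Ioo (-(R - 1)) (R - 1)} := by
  rw [volume_orthonormal_box b fun i => by split_ifs <;> measurability,
    volume_orthonormal_box b fun i => by split_ifs <;> measurability,
    ← Finset.mul_prod_erase _ _ (Finset.mem_univ i₀),
    ← Finset.mul_prod_erase _ _ (Finset.mem_univ i₀)]
  have h1 : ∏ x ∈ Finset.univ.erase i₀, volume (if x = i₀ then Icc (-(1 - l)) l else Icc (-R) R) =
      ENNReal.ofReal ((2 * R) ^ (m - 1)) := by
    rw [Finset.prod_congr rfl (g := fun _ => ENNReal.ofReal (2 * R))]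
    · simp [ENNReal.ofReal_pow (by linarith : 0 ≤ 2 * R)]
    · intro i hi
      rw [if_neg (Finset.ne_of_mem_erase hi), Real.volume_Icc]
      congr 1; ring
  have h2 : ∏ x ∈ Finset.univ.erase i₀,
      volume (if x = i₀ then Ioo p q else Ioo (-(R - 1)) (R - 1)) =
      ENNReal.ofReal ((2 * (R - 1)) ^ (m - 1)) := by
    rw [Finset.prod_congr rfl (g := fun _ => ENNReal.ofReal (2 * (R - 1)))]
    · simp [ENNReal.ofReal_pow (by linarith : 0 ≤ 2 * (R - 1))]
    · intro i hi
      rw [if_neg (Finset.ne_of_mem_erase hi), Real.volume_Ioo]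
      congr 1; ring
  rw [h1, h2, if_pos rfl, if_pos rfl, Real.volume_Icc, Real.volume_Ioo]
  have h3 : l - -(1 - l) = 1 := by ring
  rw [h3, ENNReal.ofReal_one, one_mul, ← ENNReal.ofReal_mul' (by positivity),
    ← ENNReal.ofReal_mul hp]
  refine ENNReal.ofReal_le_ofReal ?_
  nlinarith

theorem inner_blockGrad_add {b : OrthonormalBasis (Fin m) ℝ (Euc m)} {i₀ : Fin m} {l R : ℝ}
    (x : Euc m) (k : Fin m × Bool) :
    inner ℝ (blockGrad b i₀ l k) x + blockConst i₀ l R k =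
      if k.1 = i₀ then (if k.2 then l else -(1 - l)) * inner ℝ (b i₀) x + l * (1 - l)
      else (if k.2 then (1 : ℝ) else -1) * inner ℝ (b k.1) x + R := by
  unfold blockGrad blockConst
  split_ifs <;> simp [real_inner_smul_left]

theorem norm_blockGrad_le (b : OrthonormalBasis (Fin m) ℝ (Euc m)) (i₀ : Fin m) {l : ℝ}
    (hl : l ∈ Ioo (0 : ℝ) 1) (k : Fin m × Bool) : ‖blockGrad b i₀ l k‖ ≤ 1 := by
  obtain ⟨h0, h1⟩ := hl
  unfold blockGrad
  split_ifs <;> rw [norm_smul, b.norm_eq_one, mul_one, Real.norm_eq_abs, abs_le] <;>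
    constructor <;> linarith

theorem blockGrad_ne_zero (b : OrthonormalBasis (Fin m) ℝ (Euc m)) (i₀ : Fin m) {l : ℝ}
    (hl : l ∈ Ioo (0 : ℝ) 1) (k : Fin m × Bool) : blockGrad b i₀ l k ≠ 0 := by
  obtain ⟨h0, h1⟩ := hl
  unfold blockGrad
  split_ifs <;> refine smul_ne_zero ?_ (b.orthonormal.ne_zero _) <;> linarith

theorem block_body_subset [Nonempty (Fin m)] {b : OrthonormalBasis (Fin m) ℝ (Euc m)}
    {i₀ : Fin m} {l R : ℝ} (hl : l ∈ Ioo (0 : ℝ) 1) :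
    {x | 0 ≤ minAffine (blockGrad b i₀ l) (blockConst i₀ l R) x} ⊆
      {x : Euc m | ∀ i, inner ℝ (b i) x ∈ if i = i₀ then Icc (-(1 - l)) l else Icc (-R) R} := by
  intro x hx i
  obtain ⟨h0, h1⟩ := hl
  have ht := hx.trans (minAffine_le _ _ x (i, true))
  have hf := hx.trans (minAffine_le _ _ x (i, false))
  rw [inner_blockGrad_add] at ht hf
  by_cases hi : i = i₀
  · subst hi
    simp only [if_true, Bool.false_eq_true, if_false] at ht hf ⊢
    constructor <;> nlinarith
  · simp only [if_neg hi, if_true, Bool.false_eq_true, if_false] at ht hf ⊢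
    constructor <;> linarith

theorem isOpen_block_core (b : OrthonormalBasis (Fin m) ℝ (Euc m)) (i₀ : Fin m) (p q p' q' : ℝ) :
    IsOpen {x : Euc m | ∀ i, inner ℝ (b i) x ∈ if i = i₀ then Ioo p q else Ioo p' q'} := by
  rw [ofPred_forall]
  refine isOpen_iInter_of_finite fun i => ?_
  have h : Continuous fun x : Euc m => (inner ℝ (b i) x : ℝ) := by fun_prop
  refine IsOpen.preimage h ?_
  split_ifs <;> exact isOpen_Ioo

/-- Along `b i₀` the profile is a tent with its ridge at 0 and height `l (1 - l) ≤ 1`. In the core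
the side walls `R ± ⟨b k, x⟩` exceed 1, so only the faces of the tent compete, one on each side of
the ridge. -/
theorem cutoff_block_eventuallyEq [Nonempty (Fin m)] {b : OrthonormalBasis (Fin m) ℝ (Euc m)}
    {i₀ : Fin m} {l R p q : ℝ} (hl : l ∈ Ioo (0 : ℝ) 1) (σ : Bool)
    (hp : if σ then p = -(1 - l) ∧ q = 0 else p = 0 ∧ q = l) :
    {x : Euc m | ∀ i, inner ℝ (b i) x ∈ if i = i₀ then Ioo p q else Ioo (-(R - 1)) (R - 1)} ⊆
    {x | 0 < minAffine (blockGrad b i₀ l) (blockConst i₀ l R) x ∧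
      cutoff (blockGrad b i₀ l) (blockConst i₀ l R) =ᶠ[𝓝 x]
        fun y => inner ℝ (blockGrad b i₀ l (i₀, σ)) y + blockConst i₀ l R (i₀, σ)} := by
  obtain ⟨h0, h1⟩ := hl
  have key : ∀ x ∈ {x : Euc m | ∀ i, inner ℝ (b i) x ∈
      if i = i₀ then Ioo p q else Ioo (-(R - 1)) (R - 1)},
      minAffine (blockGrad b i₀ l) (blockConst i₀ l R) x =
        inner ℝ (blockGrad b i₀ l (i₀, σ)) x + blockConst i₀ l R (i₀, σ) ∧
      0 < inner ℝ (blockGrad b i₀ l (i₀, σ)) x + blockConst i₀ l R (i₀, σ) := by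
    intro x hx
    have hx0 := hx i₀
    rw [if_pos rfl] at hx0
    have hpos : 0 < inner ℝ (blockGrad b i₀ l (i₀, σ)) x + blockConst i₀ l R (i₀, σ) ∧
        inner ℝ (blockGrad b i₀ l (i₀, σ)) x + blockConst i₀ l R (i₀, σ) ≤ 1 := by
      rw [inner_blockGrad_add, if_pos rfl]
      cases σ
      · obtain ⟨rfl, rfl⟩ : p = 0 ∧ q = l := by simpa using hp
        simp only [Bool.false_eq_true, if_false]
        constructor <;> nlinarith [hx0.1, hx0.2]
      · obtain ⟨rfl, rfl⟩ : p = -(1 - l) ∧ q = 0 := by simpa using hp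
        simp only [if_true]
        constructor <;> nlinarith [hx0.1, hx0.2]
    refine ⟨minAffine_eq_of_le fun k => ?_, hpos.1⟩
    by_cases hk : k.1 = i₀
    · rw [inner_blockGrad_add, inner_blockGrad_add, if_pos rfl, if_pos hk]
      cases σ
      · obtain ⟨rfl, rfl⟩ : p = 0 ∧ q = l := by simpa using hp
        cases k.2 <;> simp only [Bool.false_eq_true, if_false, if_true] <;>
          nlinarith [hx0.1, hx0.2]
      · obtain ⟨rfl, rfl⟩ : p = -(1 - l) ∧ q = 0 := by simpa using hp
        cases k.2 <;> simp only [Bool.false_eq_true, if_false, if_true] <;>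
          nlinarith [hx0.1, hx0.2]
    · refine hpos.2.trans ?_
      have hxk := hx k.1
      rw [if_neg hk] at hxk
      rw [inner_blockGrad_add, if_neg hk]
      cases k.2 <;> simp only [Bool.false_eq_true, if_false, if_true] <;>
        linarith [hxk.1, hxk.2]
  intro x hx
  refine ⟨(key x hx).1 ▸ (key x hx).2, ?_⟩
  filter_upwards [(isOpen_block_core b i₀ p q _ _).mem_nhds hx] with y hy
  rw [cutoff, (key y hy).1, max_eq_right (key y hy).2.le]

/-- A cut-off tent function, whose gradient is `l • n` or `-(1 - l) • n` on most of its support,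
the two values being taken in the ratio `(1 - l) : l`. -/
theorem exists_block [Nonempty (Fin m)] {n : Euc m} (hn : ‖n‖ = 1) {l : ℝ}
    (hl : l ∈ Ioo (0 : ℝ) 1) :
    ∃ (ξ : Fin m × Bool → Euc m) (k₁ k₂ : Fin m × Bool), (∀ k, ‖ξ k‖ ≤ 1) ∧ (∀ k, ξ k ≠ 0) ∧
      ξ k₁ = l • n ∧ ξ k₂ = (-(1 - l)) • n ∧ ∀ ε : ℝ, 0 < ε → ∃ (c : Fin m × Bool → ℝ) (D : ℝ),
        0 < D ∧ {x | 0 ≤ minAffine ξ c x} ⊆ Metric.closedBall 0 D ∧ 0 < minAffine ξ c 0 ∧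
        ENNReal.ofReal ((1 - ε) * (1 - l)) * volume {x | 0 ≤ minAffine ξ c x} ≤
          volume {x | 0 < minAffine ξ c x ∧
            cutoff ξ c =ᶠ[𝓝 x] fun y => inner ℝ (ξ k₁) y + c k₁} ∧
        ENNReal.ofReal ((1 - ε) * l) * volume {x | 0 ≤ minAffine ξ c x} ≤
          volume {x | 0 < minAffine ξ c x ∧
            cutoff ξ c =ᶠ[𝓝 x] fun y => inner ℝ (ξ k₂) y + c k₂} := by
  obtain ⟨i₀⟩ := ‹Nonempty (Fin m)›
  have : Nonempty (Fin m) := ⟨i₀⟩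
  obtain ⟨b, hb⟩ := exists_orthonormalBasis_apply_eq hn i₀
  refine ⟨blockGrad b i₀ l, (i₀, true), (i₀, false), norm_blockGrad_le b i₀ hl,
    blockGrad_ne_zero b i₀ hl, by simp [blockGrad, hb], by simp [blockGrad, hb], fun ε hε => ?_⟩
  -- Only the constants depend on `R`, hence on `ε`. The gradients are already fixed, which allows
  -- the finite set in `Realizable` to be independent of `ε`.
  obtain ⟨R, hR, hRε⟩ := exists_pow_sub_one_ge (m - 1) hε
  obtain ⟨h0, h1⟩ := hl
  refine ⟨blockConst i₀ l R, m * R + 1, by positivity, fun x hx => ?_, ?_, ?_, ?_⟩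
  · have hx' := block_body_subset ⟨h0, h1⟩ hx
    rw [mem_closedBall_zero_iff, ← b.sum_repr x]
    refine (norm_sum_le _ _).trans ?_
    have : ∀ i ∈ Finset.univ, ‖b.repr x i • b i‖ ≤ R := by
      intro i _
      rw [norm_smul, b.norm_eq_one, mul_one, b.repr_apply_apply, Real.norm_eq_abs, abs_le]
      have := hx' i
      split_ifs at this <;> constructor <;> linarith [this.1, this.2]
    refine (Finset.sum_le_card_nsmul _ _ _ this).trans ?_
    simp
  · obtain ⟨k, hk⟩ := exists_minAffine_eq (blockGrad b i₀ l) (blockConst i₀ l R) 0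
    rw [hk, inner_zero_right, zero_add, blockConst]
    split_ifs
    · nlinarith
    · linarith
  · refine (mul_le_mul_right (measure_mono (block_body_subset ⟨h0, h1⟩)) _).trans ?_
    refine le_trans ?_ (measure_mono (cutoff_block_eventuallyEq (p := -(1 - l)) (q := 0) ⟨h0, h1⟩
      true (by simp)))
    simpa using volume_ge_of_core (b := b) (i₀ := i₀) (p := -(1 - l)) (q := 0) (l := l) hR hRε
      (by linarith)
  · refine (mul_le_mul_right (measure_mono (block_body_subset ⟨h0, h1⟩)) _).trans ?_
    refine le_trans ?_ (measure_mono (cutoff_block_eventuallyEq (p := 0) (q := l) ⟨h0, h1⟩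
      false (by simp)))
    simpa using volume_ge_of_core (b := b) (i₀ := i₀) (p := 0) (q := l) (l := l) hR hRε
      (by linarith)

end Block

/-! ### Realizable weights -/

section Realizable

variable {d m : ℕ}

/-- The finitely supported weights `f` are realizable at `A` if `A + ∇w` can take the value `X` on
a portion of volume almost `f X` of any given bounded open set, where `w` is a perturbation which
vanishes outside of this set, is small in `C^α`, and is such that `A + ∇w` takes almost everywhere
one of finitely many values depending on `A` and `f` only. -/
structure Realizable (α : ℝ≥0) (A : Mat d m) (f : Mat d m →₀ ℝ) : Prop where
  nonneg : ∀ X, 0 ≤ f X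
  mass : Finsupp.linearCombination ℝ (fun _ => (1 : ℝ)) f = 1
  mean : Finsupp.linearCombination ℝ id f = A
  exists_pert : ∃ F : Finset (Mat d m), f.support ⊆ F ∧
    ∀ (ε : ℝ) (τ : ℝ≥0) (U : Set (Euc m)), 0 < ε → 0 < τ → IsOpen U → Bornology.IsBounded U →
      ∃ w : Euc m → Euc d, Pert α τ U w ∧
        (∀ᵐ x ∂volume.restrict U, ∃ X ∈ F, x ∈ affineSet w (X - A)) ∧
        ∀ X, (1 - ε) * f X * volume.real U ≤ volume.real (U ∩ affineSet w (X - A))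

/-- The rank one matrix `a ⊗ n`. -/
def tensor (a : Euc d) (n : Euc m) : Mat d m := Matrix.of fun i j => a i * n j

theorem tensor_smul (a : Euc d) (n : Euc m) (c : ℝ) : tensor a (c • n) = c • tensor a n := by
  ext i j
  simp [tensor]
  ring

theorem exists_tensor_of_rank_eq_one {C : Mat d m} (hC : C.rank = 1) :
    ∃ (a : Euc d) (n : Euc m), ‖n‖ = 1 ∧ C = tensor a n := by
  obtain ⟨⟨v, hv⟩, -, hspan⟩ := finrank_eq_one_iff'.1 hC
  have h1 : ∀ j, ∃ c : ℝ, ∀ i, C i j = v i * c := by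
    intro j
    obtain ⟨c, hc⟩ := hspan ⟨C.mulVecLin (Pi.single j 1), ⟨_, rfl⟩⟩
    refine ⟨c, fun i => ?_⟩
    have h2 := congrFun (congrArg Subtype.val hc) i
    simp at h2
    linarith
  choose c hc using h1
  have hn : WithLp.toLp 2 c ≠ (0 : Euc m) := by
    intro h
    have hc0 : C = 0 := by
      ext i j
      have : c j = 0 := congrFun (congrArg WithLp.ofLp h) j
      simp [hc, this]
    simp [hc0] at hC
  have hn' : ‖(WithLp.toLp 2 c : Euc m)‖ ≠ 0 := norm_ne_zero_iff.2 hn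
  refine ⟨‖(WithLp.toLp 2 c : Euc m)‖ • WithLp.toLp 2 v,
    ‖(WithLp.toLp 2 c : Euc m)‖⁻¹ • WithLp.toLp 2 c, ?_, ?_⟩
  · rw [norm_smul, norm_inv, norm_norm, inv_mul_cancel₀ hn']
  · ext i j
    simp only [tensor, Matrix.of_apply, PiLp.smul_apply, smul_eq_mul, hc]
    field_simp

theorem smul_mem_affineSet {H : Euc m → ℝ} {a : Euc d} {ξ : Euc m} {c : ℝ} {x : Euc m}
    (h : H =ᶠ[𝓝 x] fun y => inner ℝ ξ y + c) :
    x ∈ affineSet (fun y => H y • a) (tensor a ξ) := by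
  refine ⟨c • a, ?_⟩
  filter_upwards [h] with y hy
  ext i
  rw [hy, affineMap_apply]
  simp only [tensor, PiLp.smul_apply, smul_eq_mul, Matrix.of_apply, PiLp.inner_apply, add_mul,
    Finset.sum_mul]
  congr 1
  refine Finset.sum_congr rfl fun j _ => ?_
  simp
  ring

theorem nonempty_of_rank_eq_one {C : Mat d m} (hC : C.rank = 1) : Nonempty (Fin m) := by
  rcases isEmpty_or_nonempty (Fin m) with h | h
  · have := C.rank_le_width
    have hm : m = 0 := by rw [← Fintype.card_fin m]; exact Fintype.card_eq_zero
    omega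
  · exact h

/-- With `B' - B = a ⊗ n`, the differences `B' - A` and `B - A` are `l (a ⊗ n)` and `-(1 - l) (a ⊗
n)`: the gradients of the tent times `a`. Small disjoint copies of the tent fill `U`; they keep the
Lipschitz constant while the supremum becomes as small as needed. -/
theorem realizable_twoPoint {α : ℝ≥0} (hα : α < 1) {B B' : Mat d m} (hB : (B' - B).rank = 1)
    {l : ℝ} (hl : l ∈ Ioo (0 : ℝ) 1) :
    Realizable α (l • B + (1 - l) • B') (Finsupp.single B l + Finsupp.single B' (1 - l)) := by
  classical
  have hm := nonempty_of_rank_eq_one hB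
  obtain ⟨a, n, hn, hC⟩ := exists_tensor_of_rank_eq_one hB
  obtain ⟨ξ, k₁, k₂, hξ, hξ0, hk₁, hk₂, hblock⟩ := exists_block hn hl
  set A := l • B + (1 - l) • B' with hA
  have hB'A : B' - A = tensor a (ξ k₁) := by
    rw [hk₁, tensor_smul, ← hC, hA]; module
  have hBA : B - A = tensor a (ξ k₂) := by
    rw [hk₂, tensor_smul, ← hC, hA]; module
  have hne : B ≠ B' := by
    rintro rfl
    simp at hB
  refine ⟨fun X => ?_, by simp, by simp [hA, sub_smul],
    Finset.univ.image fun k => A + tensor a (ξ k),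
    ?_, ?_⟩
  · rw [Finsupp.add_apply, Finsupp.single_apply, Finsupp.single_apply]
    have := hl.1; have := hl.2
    split_ifs <;> linarith
  · refine Finsupp.support_add.trans (Finset.union_subset ?_ ?_) <;>
      refine Finsupp.support_single_subset.trans ?_ <;>
      rw [Finset.singleton_subset_iff, Finset.mem_image]
    · exact ⟨k₂, Finset.mem_univ _, by rw [← hBA]; abel⟩
    · exact ⟨k₁, Finset.mem_univ _, by rw [← hB'A]; abel⟩
  intro ε τ U hε hτ hU hUb
  obtain ⟨η, hη, hpert⟩ := exists_pert_of_lipschitz (m := m) (d := d) hα ‖a‖₊ hτ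
  obtain ⟨c, D, hD, hQD, h0Q, hP₁, hP₂⟩ := hblock ε hε
  set Q := {x | 0 ≤ minAffine ξ c x} with hQ
  have hcont : Continuous (minAffine ξ c) := (lipschitzWith_minAffine hξ c).continuous
  have hQc : IsClosed Q := isClosed_le continuous_const hcont
  have hQi : (interior Q).Nonempty :=
    ⟨0, mem_interior.2 ⟨{x | 0 < minAffine ξ c x}, fun x (hx : 0 < minAffine ξ c x) => hx.le,
      isOpen_lt continuous_const hcont, h0Q⟩⟩
  set S := cutoff ξ c 0 + D with hS
  have hS0 : 0 < S := add_pos_of_nonneg_of_pos (cutoff_nonneg _ _ _) hD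
  have hQS : ∀ x ∈ Q, cutoff ξ c x ≤ S := by
    intro x hx
    have h1 := (le_abs_self _).trans (((lipschitzWith_cutoff hξ c).dist_le_mul x 0).trans_eq
      (by simp) : |cutoff ξ c x - cutoff ξ c 0| ≤ ‖x‖)
    have h2 := mem_closedBall_zero_iff.1 (hQD hx)
    linarith
  -- A copy of size `r` has height at most `r * S`, so sizes up to `r₀` keep the perturbation below
  -- `η`; the added 1 keeps the denominator positive.
  set r₀ := η / (S * (‖a‖ + 1)) with hr₀
  have hr₀pos : 0 < r₀ := by positivity
  obtain ⟨t, htc, ht, htd, ht0⟩ := exists_disjoint_scaled_covering hQc hQi hD hQD hU hr₀pos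
  have hct : Countable t := htc.to_subtype
  set Sc : t → Set (Euc m) := fun k => {x | k.1.2⁻¹ • (x - k.1.1) ∈ Q} with hSc
  set h : t → Euc m → ℝ := fun k x => k.1.2 * cutoff ξ c (k.1.2⁻¹ • (x - k.1.1)) with hh
  have hscale : ∀ k : t, h k =
      cutoff ξ (fun i => k.1.2 * c i - inner ℝ (ξ i) k.1.1) := fun k =>
    funext fun x => cutoff_scale ξ c (ht k.1 k.2).1 k.1.1 x
  have hdis : Pairwise fun k l => Disjoint (Sc k) (Sc l) := fun k l hkl =>
    htd k.2 l.2 fun h => hkl (Subtype.ext h)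
  have hzero : ∀ k, ∀ x ∉ Sc k, h k x = 0 := by
    intro k x hx
    have h1 : minAffine ξ c (k.1.2⁻¹ • (x - k.1.1)) < 0 := not_le.1 hx
    simp only [hh, cutoff, max_eq_left h1.le, mul_zero]
  have hpos : ∀ k x, 0 ≤ h k x := fun k x =>
    mul_nonneg (ht k.1 k.2).1.le (cutoff_nonneg _ _ _)
  have hLip : ∀ k, LipschitzWith 1 (h k) := fun k => by
    rw [hscale]; exact lipschitzWith_cutoff hξ _
  set H : Euc m → ℝ := fun x => ∑' k, h k x with hH
  have hHL : LipschitzWith 1 H := lipschitzWith_tsum_of_disjoint hdis hzero hpos hLip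
  have hH0 : ∀ x, (∀ k, x ∉ Sc k) → H x = 0 := fun x hx => by
    simp [hH, hzero _ _ (hx _)]
  have hHeq : ∀ k, ∀ x ∈ Sc k, H x = h k x := fun k x hx =>
    tsum_eq_of_disjoint hdis hzero hx
  have hHb : ∀ x, |H x| ≤ r₀ * S := by
    intro x
    by_cases hx : ∃ k, x ∈ Sc k
    · obtain ⟨k, hk⟩ := hx
      rw [hHeq k x hk, abs_of_nonneg (hpos k x)]
      exact mul_le_mul (ht k.1 k.2).2.1 (hQS _ hk) (cutoff_nonneg _ _ _) hr₀pos.le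
    · push Not at hx
      rw [hH0 x hx, abs_zero]
      positivity
  -- near interior points of a scaled copy only one summand matters
  have hnear : ∀ (k : t) x, 0 < minAffine ξ c (k.1.2⁻¹ • (x - k.1.1)) → H =ᶠ[𝓝 x] h k := by
    intro k x hx
    have hc : Continuous fun y : Euc m => minAffine ξ c (k.1.2⁻¹ • (y - k.1.1)) :=
      hcont.comp (by fun_prop)
    filter_upwards [hc.continuousAt.eventually (lt_mem_nhds hx)] with y hy
    exact hHeq k y (le_of_lt hy)
  refine ⟨fun x => H x • a, hpert U _ ?_ ?_ ?_, ?_, ?_⟩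
  · refine LipschitzWith.of_dist_le_mul fun x y => ?_
    rw [dist_eq_norm, ← sub_smul, norm_smul, mul_comm, coe_nnnorm]
    refine mul_le_mul_of_nonneg_left ?_ (norm_nonneg _)
    simpa [Real.dist_eq] using hHL.dist_le_mul x y
  · intro x hx
    rw [hH0 x fun k hk => hx ((ht k.1 k.2).2.2 hk), zero_smul]
  · intro x
    rw [norm_smul, Real.norm_eq_abs]
    calc |H x| * ‖a‖ ≤ r₀ * S * (‖a‖ + 1) := by
          have := hHb x
          gcongr
          linarith
      _ = η := by rw [hr₀]; field_simp
  · have h1 : ∀ᵐ x : Euc m, ∀ k : t,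
        minAffine ξ (fun i => k.1.2 * c i - inner ℝ (ξ i) k.1.1) x ≠ 0 ∧
        (0 < minAffine ξ (fun i => k.1.2 * c i - inner ℝ (ξ i) k.1.1) x →
          ∃ j, cutoff ξ (fun i => k.1.2 * c i - inner ℝ (ξ i) k.1.1) =ᶠ[𝓝 x]
            fun y => inner ℝ (ξ j) y + (k.1.2 * c j - inner ℝ (ξ j) k.1.1)) :=
      ae_all_iff.2 fun k => (ae_minAffine_ne_zero hξ0 _).and (ae_exists_cutoff_eventuallyEq ξ _)
    have h2 : ∀ᵐ x ∂volume.restrict U, ∃ k, x ∈ Sc k := by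
      rw [ae_restrict_iff' hU.measurableSet, ae_iff]
      refine measure_mono_null ?_ ht0
      intro x hx
      simp only [mem_ofPred_eq, Classical.not_imp, not_exists] at hx
      refine ⟨hx.1, fun hx' => ?_⟩
      simp only [mem_iUnion] at hx'
      obtain ⟨k, hk, hxk⟩ := hx'
      exact hx.2 ⟨k, hk⟩ hxk
    filter_upwards [ae_restrict_of_ae h1, h2] with x hx ⟨k, hk⟩
    have hr := (ht k.1 k.2).1
    have h3 : 0 < minAffine ξ (fun i => k.1.2 * c i - inner ℝ (ξ i) k.1.1) x := by
      refine lt_of_le_of_ne ?_ (hx k).1.symm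
      rw [← minAffine_scale ξ c hr]
      exact mul_nonneg hr.le hk
    obtain ⟨j, hj⟩ := (hx k).2 h3
    refine ⟨A + tensor a (ξ j), Finset.mem_image_of_mem _ (Finset.mem_univ j), ?_⟩
    rw [add_sub_cancel_left]
    rw [← minAffine_scale ξ c hr] at h3
    refine smul_mem_affineSet (c := k.1.2 * c j - inner ℝ (ξ j) k.1.1)
      ((hnear k x (pos_of_mul_pos_right h3 hr.le)).trans ?_)
    rw [hscale]
    exact hj
  · have hmeas : ∀ j (θ : ℝ), 0 ≤ θ → ENNReal.ofReal ((1 - ε) * θ) * volume Q ≤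
        volume {x | 0 < minAffine ξ c x ∧ cutoff ξ c =ᶠ[𝓝 x] fun y => inner ℝ (ξ j) y + c j} →
        (1 - ε) * θ * volume.real U ≤
          volume.real (U ∩ affineSet (fun x => H x • a) (tensor a (ξ j))) := by
      intro j θ hθ hP
      set P := {x | 0 < minAffine ξ c x ∧ cutoff ξ c =ᶠ[𝓝 x] fun y => inner ℝ (ξ j) y + c j}
        with hPdef
      have hPo : IsOpen P := by
        have : IsOpen {x | cutoff ξ c =ᶠ[𝓝 x] fun y => inner ℝ (ξ j) y + c j} := by
          rw [isOpen_iff_eventually]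
          exact fun x hx => eventually_eventually_nhds.2 hx
        exact (isOpen_lt continuous_const hcont).inter this
      have h1 := le_volume_iUnion_scaled htc (fun a ha => (ht a ha).1) htd ht0
        (fun x hx => le_of_lt hx.1 : P ⊆ Q) hPo.measurableSet hP
      have h2 : (⋃ a ∈ t, {x : Euc m | a.2⁻¹ • (x - a.1) ∈ P}) ⊆
          U ∩ affineSet (fun x => H x • a) (tensor a (ξ j)) := by
        intro x hx
        simp only [mem_iUnion] at hx
        obtain ⟨k, hk, hxk⟩ := hx
        refine ⟨(ht k hk).2.2 (show _ ∈ Q from le_of_lt hxk.1), ?_⟩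
        refine smul_mem_affineSet (c := k.2 * c j - inner ℝ (ξ j) k.1)
          ((hnear ⟨k, hk⟩ x hxk.1).trans ?_)
        have hc : ContinuousAt (fun y : Euc m => k.2⁻¹ • (y - k.1)) x := by fun_prop
        filter_upwards [hc.eventually hxk.2] with y hy
        simp only [hh, hy, inner_smul_right, inner_sub_right]
        have := (ht k hk).1.ne'
        field_simp
        ring
      have h3 := h1.trans (measure_mono h2)
      have hfin : volume (U ∩ affineSet (fun x => H x • a) (tensor a (ξ j))) ≠ ⊤ :=
        ((measure_mono inter_subset_left).trans_lt hUb.measure_lt_top).ne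
      have h4 := ENNReal.toReal_mono hfin h3
      rw [ENNReal.toReal_mul] at h4
      refine le_trans ?_ h4
      exact mul_le_mul_of_nonneg_right (by rw [ENNReal.toReal_ofReal']; exact le_max_left _ _)
        measureReal_nonneg
    intro X
    rw [Finsupp.add_apply, Finsupp.single_apply, Finsupp.single_apply]
    by_cases h1 : B = X
    · subst h1
      rw [if_pos rfl, if_neg hne.symm, hBA, add_zero]
      exact hmeas k₂ l hl.1.le hP₂
    · rw [if_neg h1, zero_add]
      by_cases h2 : B' = X
      · subst h2
        rw [if_pos rfl, hB'A]
        exact hmeas k₁ (1 - l) (by linarith [hl.2]) hP₁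
      · rw [if_neg h2]
        simp

end Realizable

/-! ### Composition of realizable weights -/

section Subst

variable {d m : ℕ}

/-- Spheres are null sets, so the volume of `V` in the ball of radius `s` depends continuously on
`s`, and it runs from 0 to the full volume. -/
theorem exists_volume_inter_ball_eq [Nonempty (Fin m)] {V : Set (Euc m)}
    (hVb : Bornology.IsBounded V) {θ : ℝ} (hθ : θ ∈ Icc (0 : ℝ) 1) :
    ∃ s : ℝ, volume.real (V ∩ Metric.ball 0 s) = θ * volume.real V ∧
      volume.real (V \ Metric.closedBall 0 s) = (1 - θ) * volume.real V := by
  have : IsFiniteMeasure (volume.restrict V) := ⟨by simpa using hVb.measure_lt_top⟩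
  obtain ⟨D, hD, hVD⟩ := hVb.subset_ball_lt 0 0
  set g : ℝ → ℝ := fun s => ∫ x in V, (Metric.ball (0 : Euc m) s).indicator (fun _ => (1 : ℝ)) x
  have hg : ∀ s, g s = volume.real (V ∩ Metric.ball 0 s) := by
    intro s
    simp only [g]
    rw [integral_indicator_const _ Metric.isOpen_ball.measurableSet, smul_eq_mul, mul_one,
      measureReal_restrict_apply Metric.isOpen_ball.measurableSet, inter_comm]
  have hsph : ∀ s, ∀ᵐ x : Euc m, ‖x‖ ≠ s := fun s => by
    rw [ae_iff]
    refine measure_mono_null (fun x hx => ?_) (Measure.addHaar_sphere volume (0 : Euc m) s)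
    simpa using hx
  have hcont : Continuous g := by
    rw [continuous_iff_continuousAt]
    intro s
    refine continuousAt_of_dominated (bound := fun _ => 1) ?_ ?_ (integrable_const _) ?_
    · exact Eventually.of_forall fun t =>
        (aestronglyMeasurable_const.indicator Metric.isOpen_ball.measurableSet)
    · refine Eventually.of_forall fun t => Eventually.of_forall fun x => ?_
      exact (norm_indicator_le_norm_self _ _).trans (by simp)
    · filter_upwards [ae_restrict_of_ae (hsph s)] with x hx
      rcases lt_or_gt_of_ne hx with h | h
      · refine (continuousAt_const (y := (1 : ℝ))).congr ?_
        filter_upwards [lt_mem_nhds h] with t ht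
        rw [indicator_of_mem (by simpa using ht)]
      · refine (continuousAt_const (y := (0 : ℝ))).congr ?_
        filter_upwards [gt_mem_nhds h] with t ht
        rw [indicator_of_notMem (by simpa using ht.le)]
  have h0 : g 0 = 0 := by rw [hg]; simp
  have h1 : g D = volume.real V := by rw [hg, inter_eq_left.2 hVD]
  obtain ⟨s, -, hs⟩ := intermediate_value_Icc hD.le hcont.continuousOn
    (show θ * volume.real V ∈ Icc (g 0) (g D) by
      rw [h0, h1]
      exact ⟨mul_nonneg hθ.1 measureReal_nonneg,
        mul_le_of_le_one_left measureReal_nonneg hθ.2⟩)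
  refine ⟨s, (hg s).symm.trans hs, ?_⟩
  have h2 : volume.real (V ∩ Metric.closedBall 0 s) = volume.real (V ∩ Metric.ball 0 s) := by
    refine measureReal_congr ?_
    filter_upwards [hsph s] with x hx
    refine propext (and_congr_right fun _ => ?_)
    rw [mem_closedBall_zero_iff, mem_ball_zero_iff]
    exact ⟨fun h => lt_of_le_of_ne h hx, le_of_lt⟩
  have h3 := measureReal_inter_add_sdiff (μ := volume) (s := V)
    (Metric.isClosed_closedBall (x := (0 : Euc m)) (ε := s)).measurableSet hVb.measure_lt_top.ne
  rw [h2, ← hg, hs] at h3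
  linarith

/-- A perturbation realizing `ω` is superposed on the open set where the gradient is `A`. If `h`
charges `A` as well, only the share `l / (l + h A)` of that set may be used; it is cut out by a
ball, whose sphere is negligible. -/
theorem Realizable.subst [Nonempty (Fin m)] {α : ℝ≥0} {A₀ A : Mat d m} {h ω : Mat d m →₀ ℝ}
    {l : ℝ} (hf : Realizable α A₀ (Finsupp.single A l + h)) (hl : 0 ≤ l) (hh : ∀ X, 0 ≤ h X)
    (hω : Realizable α A ω) : Realizable α A₀ (l • ω + h) := by
  classical
  have hmass := hf.mass
  have hmean := hf.mean
  rw [map_add, Finsupp.linearCombination_single] at hmass hmean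
  obtain ⟨F₁, hF₁, hex₁⟩ := hf.exists_pert
  obtain ⟨F₂, hF₂, hex₂⟩ := hω.exists_pert
  refine ⟨fun X => ?_, ?_, ?_, F₁ ∪ F₂, ?_, ?_⟩
  · simpa using add_nonneg (mul_nonneg hl (hω.nonneg X)) (hh X)
  · rw [map_add, map_smul, hω.mass, hmass]
  · rw [map_add, map_smul, hω.mean]
    exact hmean
  · refine Finsupp.support_add.trans (Finset.union_subset ?_ ?_)
    · exact Finsupp.support_smul.trans (hF₂.trans Finset.subset_union_right)
    · refine Finset.Subset.trans (fun X hX => ?_) (hF₁.trans Finset.subset_union_left)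
      have h1 : 0 < h X := lt_of_le_of_ne (hh X) (Finsupp.mem_support_iff.1 hX).symm
      refine Finsupp.mem_support_iff.2 (ne_of_gt ?_)
      rw [Finsupp.add_apply, Finsupp.single_apply]
      split_ifs <;> linarith
  intro ε τ U hε hτ hU hUb
  -- Two losses are incurred in succession, and `(1 - ε')² ≥ 1 - ε`; the bound `ε' ≤ 1` keeps the
  -- factors nonnegative.
  set ε' := min (ε / 2) 1 with hε'
  have hε'0 : 0 < ε' := by positivity
  have hε'1 : ε' ≤ 1 := min_le_right _ _
  have hε'2 : ε' ≤ ε / 2 := min_le_left _ _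
  obtain ⟨w₁, hp₁, hae₁, hv₁⟩ := hex₁ ε' (τ / 2) U hε'0 (by positivity) hU hUb
  set V₀ := U ∩ affineSet w₁ (A - A₀) with hV₀
  have hV₀o : IsOpen V₀ := hU.inter (isOpen_affineSet _ _)
  have hV₀b : Bornology.IsBounded V₀ := hUb.subset inter_subset_left
  set q := l + h A with hq
  have hq0 : 0 ≤ q := add_nonneg hl (hh A)
  have hθ : l / q ∈ Icc (0 : ℝ) 1 :=
    ⟨by positivity, div_le_one_of_le₀ (le_add_of_nonneg_right (hh A)) hq0⟩
  -- If `q = 0`, the quotient is 0 by convention and `l` vanishes too.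
  have hθq : l / q * q = l := by
    rcases hq0.eq_or_lt with h0 | h0
    · have : l = 0 := by have := hh A; linarith
      simp [this]
    · field_simp
  obtain ⟨s, hs₁, hs₂⟩ := exists_volume_inter_ball_eq hV₀b hθ
  set θ := l / q with hθdef
  set V := V₀ ∩ Metric.ball 0 s with hV
  have hVo : IsOpen V := hV₀o.inter Metric.isOpen_ball
  have hVU : V ⊆ U := inter_subset_left.trans inter_subset_left
  have hVb : Bornology.IsBounded V := hUb.subset hVU
  obtain ⟨w₂, hp₂, hae₂, hv₂⟩ := hex₂ ε' (τ / 2) V hε'0 (by positivity) hVo hVb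
  have hp : Pert α τ U (w₁ + w₂) := by
    simpa using hp₁.add (hp₂.mono le_rfl hVU)
  have hVcl : closure V ⊆ Metric.closedBall 0 s :=
    (closure_mono inter_subset_right).trans Metric.closure_ball_subset_closedBall
  have hout : ∀ {x : Euc m} {X : Mat d m}, x ∉ closure V → x ∈ affineSet w₁ (X - A₀) →
      x ∈ affineSet (w₁ + w₂) (X - A₀) := by
    intro x X hx hX
    simpa using add_mem_affineSet hX (mem_affineSet_zero (hp₂.eventuallyEq_zero hx))
  have hin : ∀ {x : Euc m} {X : Mat d m}, x ∈ V → x ∈ affineSet w₂ (X - A) →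
      x ∈ affineSet (w₁ + w₂) (X - A₀) := by
    intro x X hx hX
    simpa using add_mem_affineSet hx.1.2 hX
  have hne : ∀ {x : Euc m} {X : Mat d m}, X ≠ A → x ∈ affineSet w₁ (X - A₀) → x ∉ closure V := by
    intro x X hX hx hxV
    have h1 : Disjoint (affineSet w₁ (X - A₀)) V :=
      (disjoint_affineSet w₁ fun h => hX (sub_left_injective h)).mono_right
        (inter_subset_left.trans inter_subset_right)
    exact Set.disjoint_left.1 (h1.closure_right (isOpen_affineSet _ _)) hx hxV
  have hsph : ∀ᵐ x : Euc m, ‖x‖ ≠ s := by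
    rw [ae_iff]
    refine measure_mono_null (fun x hx => ?_) (Measure.addHaar_sphere volume (0 : Euc m) s)
    simpa using hx
  refine ⟨w₁ + w₂, hp, ?_, fun X => ?_⟩
  · have h2 := ae_restrict_of_ae (s := U) ((ae_restrict_iff' hVo.measurableSet).1 hae₂)
    filter_upwards [hae₁, h2, ae_restrict_of_ae hsph, ae_restrict_mem hU.measurableSet]
      with x ⟨X, hX, hxX⟩ hx₂ hxs hxU
    by_cases hXA : X = A
    · subst hXA
      rcases lt_or_gt_of_ne hxs with hlt | hgt
      · have hxV : x ∈ V := ⟨⟨hxU, hxX⟩, by simpa using hlt⟩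
        obtain ⟨Y, hY, hxY⟩ := hx₂ hxV
        exact ⟨Y, Finset.mem_union_right _ hY, hin hxV hxY⟩
      · refine ⟨X, Finset.mem_union_left _ hX, hout (fun hx => ?_) hxX⟩
        have := hVcl hx
        rw [mem_closedBall_zero_iff] at this
        linarith
    · exact ⟨X, Finset.mem_union_left _ hX, hout (hne hXA hxX) hxX⟩
  · set S₁ := (U ∩ affineSet w₁ (X - A₀)) \ closure V
    set S₂ := V ∩ affineSet w₂ (X - A)
    have hS : S₁ ∪ S₂ ⊆ U ∩ affineSet (w₁ + w₂) (X - A₀) := by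
      rintro x (hx | hx)
      · exact ⟨hx.1.1, hout hx.2 hx.1.2⟩
      · exact ⟨hVU hx.1, hin hx.1 hx.2⟩
    have hfin : ∀ {T : Set (Euc m)}, T ⊆ U → volume T ≠ ⊤ := fun hT =>
      (hUb.subset hT).measure_lt_top.ne
    have hdisj : Disjoint S₁ S₂ :=
      Set.disjoint_left.2 fun x hx hx' => hx.2 (subset_closure hx'.1)
    have hadd := measureReal_union (μ := volume) hdisj
      (hVo.inter (isOpen_affineSet _ _)).measurableSet
      (hfin fun x hx => hx.1.1) (hfin fun x hx => hVU hx.1)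
    have hle := measureReal_mono (μ := volume) hS (hfin inter_subset_left)
    rw [hadd] at hle
    have hV₀v := hv₁ A
    rw [Finsupp.add_apply, Finsupp.single_eq_same, ← hV₀, ← hq] at hV₀v
    have hU0 : 0 ≤ volume.real U := measureReal_nonneg
    have hX0 := hω.nonneg X
    have h₁ : (1 - ε') * h X * volume.real U ≤ volume.real S₁ := by
      by_cases hXA : X = A
      · subst hXA
        have h1 : V₀ \ Metric.closedBall 0 s ⊆ S₁ := fun x hx => ⟨hx.1, fun h => hx.2 (hVcl h)⟩
        refine le_trans ?_ (measureReal_mono h1 (hfin fun x hx => hx.1.1))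
        rw [hs₂]
        calc (1 - ε') * h X * volume.real U = (1 - θ) * ((1 - ε') * q * volume.real U) := by
              have : h X = (1 - θ) * q := by rw [sub_mul, hθq]; simp [hq]
              rw [this]; ring
          _ ≤ _ := mul_le_mul_of_nonneg_left hV₀v (by linarith [hθ.2])
      · have h1 : U ∩ affineSet w₁ (X - A₀) ⊆ S₁ := fun x hx => ⟨hx, hne hXA hx.2⟩
        refine le_trans ?_ (measureReal_mono h1 (hfin fun x hx => hx.1.1))
        have := hv₁ X
        rwa [Finsupp.add_apply, Finsupp.single_apply, if_neg (Ne.symm hXA), zero_add] at this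
    have h₂ : (1 - ε') * ω X * ((1 - ε') * l * volume.real U) ≤ volume.real S₂ := by
      refine le_trans ?_ (hv₂ X)
      refine mul_le_mul_of_nonneg_left ?_ (mul_nonneg (by linarith) hX0)
      rw [hs₁]
      calc (1 - ε') * l * volume.real U = θ * ((1 - ε') * q * volume.real U) := by
            rw [← hθq]; ring
        _ ≤ _ := mul_le_mul_of_nonneg_left hV₀v hθ.1
    refine le_trans ?_ hle
    refine le_trans ?_ (add_le_add h₁ h₂)
    have h3 : 1 - ε ≤ (1 - ε') * (1 - ε') := by nlinarith
    have h4 : 1 - ε ≤ 1 - ε' := by linarith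
    have h5 : 0 ≤ h X * volume.real U := mul_nonneg (hh X) hU0
    have h6 : 0 ≤ ω X * l * volume.real U := by positivity
    rw [Finsupp.add_apply, Finsupp.smul_apply, smul_eq_mul]
    nlinarith [mul_le_mul_of_nonneg_right h3 h6, mul_le_mul_of_nonneg_right h4 h5]

end Subst

/-! ### Finitely supported measures and their weights -/

section HasWeights

variable {d m : ℕ} {ν ν' : Measure (Mat d m)} {k k' : Mat d m →₀ ℝ}

/-- The measure `ν` is the finite combination of Dirac masses with weights `k`. -/
structure HasWeights (ν : Measure (Mat d m)) (k : Mat d m →₀ ℝ) : Prop where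
  nonneg : ∀ X, 0 ≤ k X
  compl : ν (↑k.support)ᶜ = 0
  singleton : ∀ X, ν {X} = ENNReal.ofReal (k X)

theorem HasWeights.unique (h : HasWeights ν k) (h' : HasWeights ν k') : k = k' := by
  ext X
  have h1 := (h.singleton X).symm.trans (h'.singleton X)
  rwa [ENNReal.ofReal_eq_ofReal_iff (h.nonneg X) (h'.nonneg X)] at h1

theorem HasWeights.add (h : HasWeights ν k) (h' : HasWeights ν' k') :
    HasWeights (ν + ν') (k + k') := by
  refine ⟨fun X => add_nonneg (h.nonneg X) (h'.nonneg X), ?_, fun X => ?_⟩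
  · rw [Measure.add_apply, add_eq_zero]
    constructor
    · refine measure_mono_null (compl_subset_compl.2 fun X hX' => ?_) h.compl
      have h1 : 0 < k X := lt_of_le_of_ne (h.nonneg X) (Finsupp.mem_support_iff.1 hX').symm
      exact Finsupp.mem_support_iff.2 (add_pos_of_pos_of_nonneg h1 (h'.nonneg X)).ne'
    · refine measure_mono_null (compl_subset_compl.2 fun X hX' => ?_) h'.compl
      have h1 : 0 < k' X := lt_of_le_of_ne (h'.nonneg X) (Finsupp.mem_support_iff.1 hX').symm
      exact Finsupp.mem_support_iff.2 (add_pos_of_nonneg_of_pos (h.nonneg X) h1).ne'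
  · rw [Measure.add_apply, h.singleton, h'.singleton, Finsupp.add_apply,
      ENNReal.ofReal_add (h.nonneg X) (h'.nonneg X)]

theorem HasWeights.smul (h : HasWeights ν k) {c : ℝ} (hc : 0 ≤ c) :
    HasWeights (ENNReal.ofReal c • ν) (c • k) := by
  refine ⟨fun X => mul_nonneg hc (h.nonneg X), ?_, fun X => ?_⟩
  · rw [Measure.smul_apply, smul_eq_mul, mul_eq_zero]
    rcases hc.eq_or_lt with h0 | h0
    · left; simp [← h0]
    · right
      rw [Finsupp.support_smul_eq h0.ne']
      exact h.compl
  · rw [Measure.smul_apply, smul_eq_mul, h.singleton, Finsupp.smul_apply, smul_eq_mul,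
      ENNReal.ofReal_mul hc]

theorem HasWeights.of_zero : HasWeights (0 : Measure (Mat d m)) 0 :=
  ⟨fun _ => le_rfl, by simp, fun _ => by simp⟩

theorem HasWeights.dirac (A : Mat d m) : HasWeights (Measure.dirac A) (Finsupp.single A 1) := by
  refine ⟨fun X => ?_, ?_, fun X => ?_⟩
  · rw [Finsupp.single_apply]; split_ifs <;> norm_num
  · rw [Finsupp.support_single A one_ne_zero]
    simp
  · rw [Measure.dirac_apply' _ (measurableSet_singleton X), Finsupp.single_apply]
    by_cases h : A = X <;> simp [h]

theorem HasWeights.smul_dirac (A : Mat d m) {c : ℝ} (hc : 0 ≤ c) :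
    HasWeights (ENNReal.ofReal c • Measure.dirac A) (Finsupp.single A c) := by
  simpa using (HasWeights.dirac A).smul hc

theorem HasWeights.sum {ι : Type*} (s : Finset ι) {ν : ι → Measure (Mat d m)}
    {k : ι → Mat d m →₀ ℝ} (h : ∀ i ∈ s, HasWeights (ν i) (k i)) :
    HasWeights (∑ i ∈ s, ν i) (∑ i ∈ s, k i) := by
  classical
  induction s using Finset.induction_on with
  | empty => simpa using HasWeights.of_zero
  | insert a s ha ih =>
    rw [Finset.sum_insert ha, Finset.sum_insert ha]
    exact (h a (Finset.mem_insert_self _ _)).add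
      (ih fun i hi => h i (Finset.mem_insert_of_mem hi))

/-- A part of a laminate, such as the one untouched by a splitting, is known only as a measure below
a finitely atomic one; this already makes it finitely atomic. -/
theorem HasWeights.exists_of_le (h : HasWeights ν k) (hν : ν' ≤ ν) :
    ∃ k', HasWeights ν' k' := by
  classical
  have hlt : ∀ X, ν' {X} ≠ ⊤ := fun X =>
    ((hν {X}).trans_lt (by rw [h.singleton]; exact ENNReal.ofReal_lt_top)).ne
  have hs : ∀ X, ν'.real {X} ≠ 0 → X ∈ k.support := by
    intro X hX
    by_contra hX'
    have h1 : ν' {X} ≤ 0 := (hν {X}).trans (by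
      rw [h.singleton, Finsupp.notMem_support_iff.1 hX']; simp)
    exact hX (by simp [Measure.real, le_antisymm h1 bot_le])
  have h0 : ν' (↑k.support)ᶜ = 0 := le_antisymm ((hν _).trans h.compl.le) bot_le
  refine ⟨Finsupp.onFinset k.support (fun X => ν'.real {X}) hs, fun X => measureReal_nonneg, ?_,
    fun X => (ENNReal.ofReal_toReal (hlt X)).symm⟩
  rw [Finsupp.support_onFinset, ← le_zero_iff]
  have hsub : (↑(k.support.filter fun X => ν'.real {X} ≠ 0) : Set (Mat d m))ᶜ ⊆
      (↑k.support)ᶜ ∪ ⋃ X ∈ k.support.filter fun X => ν'.real {X} = 0, {X} := by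
    intro X hX
    by_cases hXk : X ∈ k.support
    · right
      simp only [Finset.coe_filter, mem_compl_iff, mem_ofPred_eq, not_and, not_not] at hX
      simpa using ⟨Finsupp.mem_support_iff.1 hXk, hX hXk⟩
    · left; simpa using hXk
  refine (measure_mono hsub).trans ((measure_union_le _ _).trans ?_)
  rw [h0, zero_add]
  refine (measure_biUnion_finset_le _ _).trans (le_of_eq (Finset.sum_eq_zero fun X hX => ?_))
  have h1 := (Finset.mem_filter.1 hX).2
  rw [Measure.real, ENNReal.toReal_eq_zero_iff] at h1
  exact h1.resolve_right (hlt X)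

theorem HasWeights.restrict_support (h : HasWeights ν k) :
    ν.restrict (↑k.support : Set (Mat d m)) = ν :=
  Measure.restrict_eq_self_of_ae_mem h.compl

theorem HasWeights.isFiniteMeasure (h : HasWeights ν k) : IsFiniteMeasure ν := by
  refine ⟨?_⟩
  rw [← h.restrict_support, Measure.restrict_apply_univ, ← sum_measure_singleton]
  refine ENNReal.sum_lt_top.2 fun X _ => ?_
  rw [h.singleton]
  exact ENNReal.ofReal_lt_top

theorem HasWeights.integral_eq (h : HasWeights ν k) (g : Mat d m → ℝ) :
    ∫ X, g X ∂ν = Finsupp.linearCombination ℝ g k := by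
  have := h.isFiniteMeasure
  rw [← h.restrict_support, setIntegral_finset _ IntegrableOn.finset,
    Finsupp.linearCombination_apply, Finsupp.sum]
  refine Finset.sum_congr rfl fun X _ => ?_
  rw [Measure.real, h.singleton, ENNReal.toReal_ofReal (h.nonneg X)]

theorem linearCombination_nonneg {φ : Mat d m → ℝ} (hφ : ∀ X, 0 ≤ φ X) (hk : ∀ X, 0 ≤ k X) :
    0 ≤ Finsupp.linearCombination ℝ φ k := by
  rw [Finsupp.linearCombination_apply, Finsupp.sum]
  exact Finset.sum_nonneg fun X _ => mul_nonneg (hk X) (hφ X)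

theorem HasWeights.lintegral_eq (h : HasWeights ν k) {φ : Mat d m → ℝ} (hφ : ∀ X, 0 ≤ φ X) :
    ∫⁻ X, ENNReal.ofReal (φ X) ∂ν = ENNReal.ofReal (Finsupp.linearCombination ℝ φ k) := by
  rw [← h.restrict_support, lintegral_finset, Finsupp.linearCombination_apply, Finsupp.sum,
    ENNReal.ofReal_sum_of_nonneg fun X _ => smul_nonneg (h.nonneg X) (hφ X)]
  refine Finset.sum_congr rfl fun X _ => ?_
  rw [h.singleton, smul_eq_mul, ENNReal.ofReal_mul (h.nonneg X), mul_comm]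

end HasWeights

/-! ### Laminates of finite order are realizable -/

section FiniteLaminate

variable {d m : ℕ} {α : ℝ≥0}

theorem realizable_single (α : ℝ≥0) (A : Mat d m) : Realizable α A (Finsupp.single A 1) := by
  classical
  refine ⟨(HasWeights.dirac A).nonneg, by simp, by simp, {A}, Finsupp.support_single_subset,
    fun ε τ U hε hτ hU hUb => ⟨0, Pert.of_zero, ?_, fun X => ?_⟩⟩
  · exact Eventually.of_forall fun x => ⟨A, Finset.mem_singleton_self A, by
      rw [sub_self]; exact mem_affineSet_zero EventuallyEq.rfl⟩
  · by_cases hX : A = X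
    · subst hX
      have h1 : U ∩ affineSet (0 : Euc m → Euc d) (A - A) = U :=
        inter_eq_left.2 fun x _ => by
          rw [sub_self]; exact mem_affineSet_zero EventuallyEq.rfl
      rw [h1, Finsupp.single_eq_same]
      have : 0 ≤ volume.real U := measureReal_nonneg
      nlinarith
    · rw [Finsupp.single_apply, if_neg hX]
      simp

/-- Induction on the splittings. The untouched part `(1 - l) ν'` has weights by domination, and the
mass `l` at `A` is replaced by two-point weights through `Realizable.subst`. -/
theorem IsFiniteLaminate.exists_weights [Nonempty (Fin m)] (hα : α < 1) {ν : Measure (Mat d m)}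
    (hν : IsFiniteLaminate ν) : ∃ f A, Realizable α A f ∧ HasWeights ν f := by
  induction hν with
  | dirac A => exact ⟨Finsupp.single A 1, A, realizable_single α A, HasWeights.dirac A⟩
  | @split ν μ hν h ih =>
    obtain ⟨f, A₀, hf, hw⟩ := ih
    obtain ⟨ν', A, B, B', l, l', -, hl, hl', hA, hB, hν, hμ⟩ := h
    obtain ⟨h, hh⟩ := hw.exists_of_le (ν' := ENNReal.ofReal (1 - l) • ν')
      (by rw [hν]; exact Measure.le_add_left le_rfl)
    have hf' : f = Finsupp.single A l + h :=
      hw.unique (by rw [hν]; exact (HasWeights.smul_dirac A hl.1).add hh)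
    subst hf' hA
    refine ⟨_, _, hf.subst hl.1 hh.nonneg (realizable_twoPoint hα hB hl'), ?_⟩
    rw [hμ]
    exact (((HasWeights.smul_dirac B hl'.1.le).add
      (HasWeights.smul_dirac B' (by linarith [hl'.2]))).smul hl.1).add hh

theorem HasWeights.mean_eq {ν : Measure (Mat d m)} {k : Mat d m →₀ ℝ} {A : Mat d m}
    (h : HasWeights ν k) (hA : HasBarycenter ν A) : Finsupp.linearCombination ℝ id k = A := by
  ext i j
  rw [← (hA i j).2, h.integral_eq]
  simp only [Finsupp.linearCombination_apply, Finsupp.sum]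
  simp [Matrix.sum_apply]

theorem IsFiniteLaminate.exists_realizable [Nonempty (Fin m)] (hα : α < 1)
    {ν : Measure (Mat d m)} {A : Mat d m} (hν : IsFiniteLaminate ν) (hA : HasBarycenter ν A) :
    ∃ f, Realizable α A f ∧ HasWeights ν f := by
  obtain ⟨f, B, hf, hw⟩ := hν.exists_weights hα
  have : A = B := (hw.mean_eq hA).symm.trans hf.mean
  exact ⟨f, this ▸ hf, hw⟩

end FiniteLaminate

/-! ### Staircases -/

section Staircase

variable {d m : ℕ} {α : ℝ≥0} {K : Set (Mat d m)}

/-- The integral of `φ` with respect to the finitely supported weights `f`. -/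
abbrev moment (φ : Mat d m → ℝ) (f : Mat d m →₀ ℝ) : ℝ := Finsupp.linearCombination ℝ φ f

theorem moment_add (φ : Mat d m → ℝ) (f g : Mat d m →₀ ℝ) :
    moment φ (f + g) = moment φ f + moment φ g := map_add _ f g

theorem moment_eq_sum (φ : Mat d m → ℝ) (f : Mat d m →₀ ℝ) :
    moment φ f = ∑ X ∈ f.support, f X * φ X := Finsupp.linearCombination_apply _ _

theorem norm_sq_eq_sum (X : Mat d m) : ‖X‖ ^ 2 = ∑ i, ∑ j, X i j ^ 2 := by
  have h0 : (0 : ℝ) ≤ ∑ i, ∑ j, X i j ^ 2 :=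
    Finset.sum_nonneg fun i _ => Finset.sum_nonneg fun j _ => sq_nonneg _
  rw [Matrix.frobenius_norm_def, ← Real.sqrt_eq_rpow]
  simp only [Real.norm_eq_abs, Real.rpow_two, sq_abs]
  exact Real.sq_sqrt h0

theorem norm_le_sum_abs (X : Mat d m) : ‖X‖ ≤ ∑ i, ∑ j, |X i j| := by
  conv_lhs => rw [Matrix.matrix_eq_sum_single X]
  refine (norm_sum_le _ _).trans (Finset.sum_le_sum fun i _ => ?_)
  refine (norm_sum_le _ _).trans (Finset.sum_le_sum fun j _ => ?_)
  refine abs_le_of_sq_le_sq' ?_ (abs_nonneg _) |>.2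
  rw [norm_sq_eq_sum, sq_abs, Finset.sum_eq_single i, Finset.sum_eq_single j]
  · simp
  · intro b _ hb
    simp [hb.symm]
  · simp
  · intro b _ hb
    simp [hb.symm]
  · simp

theorem abs_apply_le_norm (X : Mat d m) (i : Fin d) (j : Fin m) : |X i j| ≤ ‖X‖ := by
  refine abs_le_of_sq_le_sq ?_ (norm_nonneg _)
  rw [norm_sq_eq_sum]
  refine le_trans ?_ (Finset.single_le_sum (f := fun i => ∑ j, X i j ^ 2)
    (fun i _ => Finset.sum_nonneg fun j _ => sq_nonneg _) (Finset.mem_univ i))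
  exact Finset.single_le_sum (f := fun j => X i j ^ 2) (fun j _ => sq_nonneg _) (Finset.mem_univ j)

theorem HasBarycenter.lintegral_norm_lt_top {ν : Measure (Mat d m)} {A : Mat d m}
    (h : HasBarycenter ν A) : ∫⁻ X, ENNReal.ofReal ‖X‖ ∂ν < ⊤ := by
  have h1 : Integrable (fun X : Mat d m => ∑ i, ∑ j, |X i j|) ν :=
    integrable_finsetSum _ fun i _ => integrable_finsetSum _ fun j _ => (h i j).1.abs
  refine lt_of_le_of_lt (lintegral_mono fun X => ?_) h1.lintegral_lt_top
  exact ENNReal.ofReal_le_ofReal (norm_le_sum_abs X)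

/-- The combinatorial data of a staircase laminate. The weights `k n` are those of
`(1 - γ n) μ n`. -/
structure Staircase (α : ℝ≥0) (K : Set (Mat d m)) (As : ℕ → Mat d m) (k : ℕ → Mat d m →₀ ℝ)
    (γ : ℕ → ℝ) : Prop where
  notMem : ∀ n, As n ∉ K
  nonneg : ∀ n X, 0 ≤ k n X
  eq_zero : ∀ n, ∀ X ∉ K, k n X = 0
  gamma : ∀ n, γ n ∈ Ioo (0 : ℝ) 1
  realizable : ∀ n, Realizable α (As n) (k n + Finsupp.single (As (n + 1)) (γ n))
  tendsto_beta : Tendsto (staircaseBeta γ) atTop (𝓝 0)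
  tendsto_norm : Tendsto (fun n => staircaseBeta γ n * ‖As n‖) atTop (𝓝 0)
  summable : Summable fun n => staircaseBeta γ n * moment norm (k n)

variable {As : ℕ → Mat d m} {k : ℕ → Mat d m →₀ ℝ} {γ : ℕ → ℝ}

theorem staircaseBeta_pos (h : ∀ n, γ n ∈ Ioo (0 : ℝ) 1) (n : ℕ) : 0 < staircaseBeta γ n :=
  Finset.prod_pos fun i _ => (h i).1

theorem staircaseBeta_succ (γ : ℕ → ℝ) (n : ℕ) :
    staircaseBeta γ (n + 1) = staircaseBeta γ n * γ n := Finset.prod_range_succ _ _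

theorem staircaseBeta_shift (γ : ℕ → ℝ) (N n : ℕ) :
    staircaseBeta γ (n + N) = staircaseBeta γ N * staircaseBeta (fun n => γ (n + N)) n := by
  rw [add_comm n N, staircaseBeta, Finset.prod_range_add]
  simp only [staircaseBeta, add_comm]

/-- The Dirac remainder has mass `β_N → 0`, so the setwise limit is the countable sum of the parts
on `K`, and integrals of nonnegative functions become series. -/
theorem IsStaircaseLaminate.exists_staircase [Nonempty (Fin m)] (hα : α < 1) {A : Mat d m}
    {ν : Measure (Mat d m)} (h : IsStaircaseLaminate K A ν) :
    ∃ As k γ, As 0 = A ∧ Staircase α K As k γ ∧ ∀ φ : Mat d m → ℝ, (∀ X, 0 ≤ φ X) →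
      ∫⁻ X, ENNReal.ofReal (φ X) ∂ν =
        ∑' n, ENNReal.ofReal (staircaseBeta γ n) * ENNReal.ofReal (moment φ (k n)) := by
  obtain ⟨⟨As, μ, γ, hA0, hAK, hμ, hγ, hω, -, -, hβ, hlim⟩, hbar⟩ := h
  have hβ0 : ∀ n, 0 < staircaseBeta γ n := staircaseBeta_pos hγ
  choose f hf hwf using fun n => (hω n).1.exists_realizable hα (hω n).2
  choose k hk using fun n => (hwf n).exists_of_le
    (ν' := ENNReal.ofReal (1 - γ n) • μ n) (Measure.le_add_right le_rfl)
  have hfk : ∀ n, f n = k n + Finsupp.single (As (n + 1)) (γ n) := fun n =>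
    (hwf n).unique ((hk n).add (HasWeights.smul_dirac _ (hγ n).1.le))
  have hterm : ∀ n, ENNReal.ofReal (staircaseBeta γ n * (1 - γ n)) • μ n =
      ENNReal.ofReal (staircaseBeta γ n) • ENNReal.ofReal (1 - γ n) • μ n := fun n => by
    rw [smul_smul, ENNReal.ofReal_mul (hβ0 n).le]
  have hν : ν = Measure.sum fun n =>
      ENNReal.ofReal (staircaseBeta γ n) • ENNReal.ofReal (1 - γ n) • μ n := by
    ext E hE
    rw [Measure.sum_apply _ hE]
    refine tendsto_nhds_unique (hlim E hE) ?_
    have h1 : Tendsto (fun N => ENNReal.ofReal (staircaseBeta γ N) * Measure.dirac (As N) E)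
        atTop (𝓝 0) := by
      have h2 : Tendsto (fun N => ENNReal.ofReal (staircaseBeta γ N)) atTop (𝓝 0) := by
        simpa using ENNReal.tendsto_ofReal hβ
      refine tendsto_of_tendsto_of_tendsto_of_le_of_le tendsto_const_nhds h2
        (fun _ => bot_le) fun N => ?_
      exact mul_le_of_le_one_right bot_le prob_le_one
    have h3 := (ENNReal.tendsto_nat_tsum fun n =>
      (ENNReal.ofReal (staircaseBeta γ n) • ENNReal.ofReal (1 - γ n) • μ n) E).add h1
    rw [add_zero] at h3
    refine h3.congr fun N => ?_
    rw [staircaseStep, Measure.add_apply, Measure.finsetSum_apply, Measure.smul_apply, smul_eq_mul]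
    simp_rw [hterm]
  have hlint : ∀ φ : Mat d m → ℝ, (∀ X, 0 ≤ φ X) → ∫⁻ X, ENNReal.ofReal (φ X) ∂ν =
      ∑' n, ENNReal.ofReal (staircaseBeta γ n) * ENNReal.ofReal (moment φ (k n)) := by
    intro φ hφ
    rw [hν, lintegral_sum_measure]
    refine tsum_congr fun n => ?_
    rw [lintegral_smul_measure, (hk n).lintegral_eq hφ, smul_eq_mul]
  refine ⟨As, k, γ, hA0, ⟨hAK, fun n => (hk n).nonneg, fun n X hX => ?_, hγ, fun n => ?_, hβ,
    ?_, ?_⟩, hlint⟩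
  · have h1 := (hk n).singleton X
    have h2 : μ n {X} = 0 := measure_mono_null (singleton_subset_iff.2 hX) (hμ n).2
    rw [Measure.smul_apply, h2, smul_zero] at h1
    exact le_antisymm (ENNReal.ofReal_eq_zero.1 h1.symm) ((hk n).nonneg X)
  · rw [← hfk]; exact hf n
  -- Each step preserves the mean, so `β_N A_N` is `A` minus the mean of the part already on `K`.
  -- These means converge to the barycenter of `ν`, which is again `A`.
  · have hrec : ∀ N, staircaseBeta γ N • As N = A - ∑ n ∈ Finset.range N,
        staircaseBeta γ n • Finsupp.linearCombination ℝ id (k n) := by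
      intro N
      induction N with
      | zero => simp [staircaseBeta, hA0]
      | succ N ih =>
        have h1 := (hf N).mean
        rw [hfk, map_add, Finsupp.linearCombination_single] at h1
        rw [Finset.sum_range_succ, ← sub_sub, ← ih, staircaseBeta_succ, mul_smul]
        conv_rhs => rw [← h1]
        simp
    have hentry : ∀ i j, Tendsto (fun N => (staircaseBeta γ N • As N) i j) atTop (𝓝 0) := by
      intro i j
      have h1 := (hbar i j).1
      rw [hν] at h1
      have h2 := (hasSum_integral_measure h1).tendsto_sum_nat
      rw [← hν, (hbar i j).2] at h2
      have h3 := h2.const_sub (A i j)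
      rw [sub_self] at h3
      refine h3.congr fun N => ?_
      rw [hrec, Matrix.sub_apply, Matrix.sum_apply]
      congr 1
      refine Finset.sum_congr rfl fun n _ => ?_
      rw [integral_smul_measure, (hk n).integral_eq, ENNReal.toReal_ofReal (hβ0 n).le,
        Matrix.smul_apply]
      congr 1
      simp only [Finsupp.linearCombination_apply, Finsupp.sum]
      simp [Matrix.sum_apply]
    have hmat : Tendsto (fun N => staircaseBeta γ N • As N) atTop (𝓝 0) :=
      tendsto_pi_nhds.2 fun i => tendsto_pi_nhds.2 fun j => hentry i j
    refine hmat.norm.congr' (Eventually.of_forall fun N => ?_) |>.trans (by simp)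
    rw [norm_smul, Real.norm_eq_abs, abs_of_pos (hβ0 N)]
  · have h1 := hbar.lintegral_norm_lt_top
    rw [hlint _ fun X => norm_nonneg X] at h1
    have h2 := ENNReal.summable_toReal h1.ne
    refine h2.congr fun n => ?_
    rw [ENNReal.toReal_mul, ENNReal.toReal_ofReal (hβ0 n).le,
      ENNReal.toReal_ofReal (linearCombination_nonneg (fun X => norm_nonneg X) (hk n).nonneg)]

end Staircase

/-! ### Resolution of a matrix by weights on `K` -/

section Resolution

variable {d m : ℕ} {α : ℝ≥0} {K : Set (Mat d m)}

/-- The first moment of the limit of a staircase. -/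
def staircaseCost (k : ℕ → Mat d m →₀ ℝ) (γ : ℕ → ℝ) : ℝ :=
  ∑' n, staircaseBeta γ n * moment norm (k n)

/-- The part on `K` of the `N`-th step of a staircase. -/
def staircaseTrunc (k : ℕ → Mat d m →₀ ℝ) (γ : ℕ → ℝ) (N : ℕ) : Mat d m →₀ ℝ :=
  ∑ n ∈ Finset.range N, staircaseBeta γ n • k n

section

variable {As : ℕ → Mat d m} {k : ℕ → Mat d m →₀ ℝ} {γ : ℕ → ℝ}

theorem Staircase.term_nonneg (h : Staircase α K As k γ) {φ : Mat d m → ℝ} (hφ : ∀ X, 0 ≤ φ X)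
    (n : ℕ) : 0 ≤ staircaseBeta γ n * moment φ (k n) :=
  mul_nonneg (staircaseBeta_pos h.gamma n).le (linearCombination_nonneg hφ (h.nonneg n))

theorem Staircase.cost_nonneg (h : Staircase α K As k γ) : 0 ≤ staircaseCost k γ :=
  tsum_nonneg fun n => h.term_nonneg (fun X => norm_nonneg X) n

theorem Staircase.trunc_nonneg (h : Staircase α K As k γ) (N : ℕ) (X : Mat d m) :
    0 ≤ staircaseTrunc k γ N X := by
  rw [staircaseTrunc, Finsupp.finsetSum_apply]
  exact Finset.sum_nonneg fun n _ => mul_nonneg (staircaseBeta_pos h.gamma n).le (h.nonneg n X)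

theorem Staircase.trunc_eq_zero (h : Staircase α K As k γ) (N : ℕ) {X : Mat d m} (hX : X ∉ K) :
    staircaseTrunc k γ N X = 0 := by
  rw [staircaseTrunc, Finsupp.finsetSum_apply]
  exact Finset.sum_eq_zero fun n _ => by simp [h.eq_zero n X hX]

theorem mean_staircaseTrunc (φ : Mat d m → ℝ) (N : ℕ) :
    moment φ (staircaseTrunc k γ N) = ∑ n ∈ Finset.range N, staircaseBeta γ n * moment φ (k n) := by
  simp [staircaseTrunc, map_sum]

theorem Staircase.realizable_trunc [Nonempty (Fin m)] (h : Staircase α K As k γ) (N : ℕ) :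
    Realizable α (As 0)
      (Finsupp.single (As N) (staircaseBeta γ N) + staircaseTrunc k γ N) := by
  induction N with
  | zero => simpa [staircaseBeta, staircaseTrunc] using realizable_single α (As 0)
  | succ N ih =>
    have h1 := ih.subst (staircaseBeta_pos h.gamma N).le (h.trunc_nonneg N) (h.realizable N)
    convert h1 using 1
    rw [staircaseTrunc, Finset.sum_range_succ, staircaseBeta_succ, smul_add, Finsupp.smul_single,
      smul_eq_mul, staircaseTrunc]
    abel

/-- The new products are the old ones divided by the fixed number `β_N`, so limits and summability
are inherited. -/
theorem Staircase.shift (h : Staircase α K As k γ) (N : ℕ) :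
    Staircase α K (fun n => As (n + N)) (fun n => k (n + N)) (fun n => γ (n + N)) := by
  have hN := staircaseBeta_pos h.gamma N
  have hs : ∀ n, staircaseBeta (fun n => γ (n + N)) n =
      (staircaseBeta γ N)⁻¹ * staircaseBeta γ (n + N) := fun n => by
    rw [staircaseBeta_shift]; field_simp
  refine ⟨fun n => h.notMem _, fun n => h.nonneg _, fun n => h.eq_zero _, fun n => h.gamma _,
    fun n => ?_, ?_, ?_, ?_⟩
  · have := h.realizable (n + N)
    rwa [add_right_comm] at this
  · simp_rw [funext hs]
    simpa using ((tendsto_add_atTop_iff_nat N).2 h.tendsto_beta).const_mul (staircaseBeta γ N)⁻¹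
  · simp_rw [hs, mul_assoc]
    simpa using ((tendsto_add_atTop_iff_nat N).2 h.tendsto_norm).const_mul (staircaseBeta γ N)⁻¹
  · simp_rw [hs, mul_assoc]
    exact ((summable_nat_add_iff N).2 h.summable).mul_left _

theorem staircaseBeta_mul_cost_shift (k : ℕ → Mat d m →₀ ℝ) (γ : ℕ → ℝ) (N : ℕ) :
    staircaseBeta γ N * staircaseCost (fun n => k (n + N)) (fun n => γ (n + N)) =
      ∑' n, staircaseBeta γ (n + N) * moment norm (k (n + N)) := by
  rw [staircaseCost, ← tsum_mul_left]
  exact tsum_congr fun n => by rw [staircaseBeta_shift, mul_assoc]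

end

/-- One matrix is substituted at a time, the remaining ones being absorbed into `h`, which only has
to be nonnegative and may charge the same matrices. -/
theorem Realizable.subst_sum [Nonempty (Fin m)] {ι : Type*} (s : Finset ι) {X : Mat d m}
    {C : ι → Mat d m} {kap : ι → ℝ} {ω : ι → Mat d m →₀ ℝ} {h : Mat d m →₀ ℝ}
    (hX : Realizable α X (h + ∑ j ∈ s, Finsupp.single (C j) (kap j))) (hh : ∀ Y, 0 ≤ h Y)
    (hkap : ∀ j, 0 ≤ kap j) (hω : ∀ j, Realizable α (C j) (ω j)) :
    Realizable α X (h + ∑ j ∈ s, kap j • ω j) := by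
  classical
  induction s using Finset.induction_on generalizing h with
  | empty => simpa using hX
  | insert a s ha ih =>
    rw [Finset.sum_insert ha] at hX ⊢
    rw [add_left_comm] at hX
    have h1 : ∀ Y, 0 ≤ (h + ∑ j ∈ s, Finsupp.single (C j) (kap j)) Y := by
      intro Y
      rw [Finsupp.add_apply, Finsupp.finsetSum_apply]
      refine add_nonneg (hh Y) (Finset.sum_nonneg fun j _ => ?_)
      rw [Finsupp.single_apply]
      split_ifs
      exacts [hkap j, le_rfl]
    have h2 := hX.subst (hkap a) h1 (hω a)
    rw [← add_assoc] at h2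
    have h3 := ih h2 fun Y => add_nonneg (mul_nonneg (hkap a) ((hω a).nonneg Y)) (hh Y)
    rwa [add_comm (kap a • ω a) h, add_assoc] at h3

/-- A finite mixture of Dirac masses on `K` and of staircases, realizable at `X`. -/
structure Mixture (α : ℝ≥0) (K : Set (Mat d m)) (X : Mat d m) {I J : ℕ} (lam : Fin I → ℝ)
    (B : Fin I → Mat d m) (kap : Fin J → ℝ) (As : Fin J → ℕ → Mat d m)
    (k : Fin J → ℕ → Mat d m →₀ ℝ) (γ : Fin J → ℕ → ℝ) : Prop where
  lam_nonneg : ∀ i, 0 ≤ lam i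
  kap_nonneg : ∀ j, 0 ≤ kap j
  mem : ∀ i, B i ∈ K
  staircase : ∀ j, Staircase α K (As j) (k j) (γ j)
  realizable : Realizable α X
    (∑ i, Finsupp.single (B i) (lam i) + ∑ j, Finsupp.single (As j 0) (kap j))

/-- `c` is the first moment of some mixture realizable at `X`. -/
def HasCost (α : ℝ≥0) (K : Set (Mat d m)) (X : Mat d m) (c : ℝ) : Prop :=
  ∃ (I J : ℕ) (lam : Fin I → ℝ) (B : Fin I → Mat d m) (kap : Fin J → ℝ)
    (As : Fin J → ℕ → Mat d m) (k : Fin J → ℕ → Mat d m →₀ ℝ) (γ : Fin J → ℕ → ℝ),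
    Mixture α K X lam B kap As k γ ∧
    c = ∑ i, lam i * ‖B i‖ + ∑ j, kap j * staircaseCost (k j) (γ j)

/-- The price of the gradient `X`, as long as it is not resolved. -/
def price (α : ℝ≥0) (K : Set (Mat d m)) (X : Mat d m) : ℝ :=
  1 + ‖X‖ + sInf {c | HasCost α K X c}

theorem HasCost.nonneg {X : Mat d m} {c : ℝ} (h : HasCost α K X c) : 0 ≤ c := by
  obtain ⟨I, J, lam, B, kap, As, k, γ, h, rfl⟩ := h
  exact add_nonneg (Finset.sum_nonneg fun i _ => mul_nonneg (h.lam_nonneg i) (norm_nonneg _))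
    (Finset.sum_nonneg fun j _ => mul_nonneg (h.kap_nonneg j) (h.staircase j).cost_nonneg)

/-- This needs no mixture at `X`: the infimum of the empty set is 0. -/
theorem one_add_norm_le_price (X : Mat d m) : 1 + ‖X‖ ≤ price α K X :=
  le_add_of_nonneg_right (Real.sInf_nonneg fun _ hc => HasCost.nonneg hc)

theorem price_nonneg (X : Mat d m) : 0 ≤ price α K X :=
  (add_nonneg zero_le_one (norm_nonneg X)).trans (one_add_norm_le_price X)

theorem Staircase.hasCost {As : ℕ → Mat d m} {k : ℕ → Mat d m →₀ ℝ} {γ : ℕ → ℝ}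
    (h : Staircase α K As k γ) : HasCost α K (As 0) (staircaseCost k γ) := by
  refine ⟨0, 1, Fin.elim0, Fin.elim0, fun _ => 1, fun _ => As, fun _ => k, fun _ => γ,
    ⟨fun i => i.elim0, fun _ => zero_le_one, fun i => i.elim0, fun _ => h, ?_⟩, by simp⟩
  simpa using realizable_single α (As 0)

/-- The shifted staircase competes in the infimum defining the price of `A_N`. Multiplied by `β_N`,
its cost is a tail of the convergent series of first moments; the terms `β_N` and `β_N |A_N|` vanish
as well. -/
theorem Staircase.tendsto_price {As : ℕ → Mat d m} {k : ℕ → Mat d m →₀ ℝ} {γ : ℕ → ℝ}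
    (h : Staircase α K As k γ) :
    Tendsto (fun N => staircaseBeta γ N * price α K (As N)) atTop (𝓝 0) := by
  have h1 := (h.tendsto_beta.add h.tendsto_norm).add
    (tendsto_sum_nat_add fun n => staircaseBeta γ n * moment norm (k n))
  rw [add_zero, add_zero] at h1
  refine tendsto_of_tendsto_of_tendsto_of_le_of_le tendsto_const_nhds h1
    (fun N => mul_nonneg (staircaseBeta_pos h.gamma N).le (price_nonneg _)) fun N => ?_
  dsimp only
  rw [← staircaseBeta_mul_cost_shift, price, mul_add, mul_add, mul_one]
  have hc := (h.shift N).hasCost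
  rw [zero_add] at hc
  have h2 : sInf {c | HasCost α K (As N) c} ≤ _ :=
    csInf_le ⟨0, fun c hc => HasCost.nonneg hc⟩ hc
  have := mul_le_mul_of_nonneg_left h2 (staircaseBeta_pos h.gamma N).le
  linarith

/-- Approximate resolutions of `X`: weights `k N` on `K` with first moments bounded by `c`, and
remaining weights `g N` whose price tends to zero. -/
structure IsResolution (α : ℝ≥0) (K : Set (Mat d m)) (X : Mat d m) (k g : ℕ → Mat d m →₀ ℝ)
    (c : ℝ) : Prop where
  realizable : ∀ N, Realizable α X (k N + g N)
  nonneg_left : ∀ N Y, 0 ≤ k N Y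
  nonneg_right : ∀ N Y, 0 ≤ g N Y
  eq_zero : ∀ N, ∀ Y ∉ K, k N Y = 0
  mean_le : ∀ N, moment norm (k N) ≤ c
  tendsto_price : Tendsto (fun N => moment (price α K) (g N)) atTop (𝓝 0)

/-- All staircases are stopped at step `N`. What remains sits at the matrices `As j N`, whose price
vanishes, and the resolved parts have first moments given by partial sums of the cost. -/
theorem Mixture.exists_resolution [Nonempty (Fin m)] {X : Mat d m} {I J : ℕ} {lam : Fin I → ℝ}
    {B : Fin I → Mat d m} {kap : Fin J → ℝ} {As : Fin J → ℕ → Mat d m}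
    {k : Fin J → ℕ → Mat d m →₀ ℝ} {γ : Fin J → ℕ → ℝ} (h : Mixture α K X lam B kap As k γ) :
    ∃ k' g, IsResolution α K X k' g
        (∑ i, lam i * ‖B i‖ + ∑ j, kap j * staircaseCost (k j) (γ j)) ∧
      ∀ (φ : Mat d m → ℝ) (N : ℕ), moment φ (k' N) = ∑ i, lam i * φ (B i) +
        ∑ j, kap j * ∑ n ∈ Finset.range N, staircaseBeta (γ j) n * moment φ (k j n) := by
  classical
  have hsingle : ∀ (Y : Mat d m) (c : ℝ), 0 ≤ c → ∀ Z, 0 ≤ Finsupp.single Y c Z := by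
    intro Y c hc Z
    rw [Finsupp.single_apply]
    split_ifs
    exacts [hc, le_rfl]
  have hB : ∀ Z, 0 ≤ (∑ i, Finsupp.single (B i) (lam i)) Z := fun Z => by
    rw [Finsupp.finsetSum_apply]
    exact Finset.sum_nonneg fun i _ => hsingle _ _ (h.lam_nonneg i) Z
  have hmean : ∀ (φ : Mat d m → ℝ) (N : ℕ), moment φ (∑ i, Finsupp.single (B i) (lam i) +
      ∑ j, kap j • staircaseTrunc (k j) (γ j) N) = ∑ i, lam i * φ (B i) +
        ∑ j, kap j * ∑ n ∈ Finset.range N, staircaseBeta (γ j) n * moment φ (k j n) := by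
    intro φ N
    simp only [map_add, map_sum, map_smul, mean_staircaseTrunc,
      Finsupp.linearCombination_single, smul_eq_mul]
  refine ⟨fun N => ∑ i, Finsupp.single (B i) (lam i) +
      ∑ j, kap j • staircaseTrunc (k j) (γ j) N,
    fun N => ∑ j, Finsupp.single (As j N) (kap j * staircaseBeta (γ j) N),
    ⟨fun N => ?_, fun N Y => ?_, fun N Y => ?_, fun N Y hY => ?_, fun N => ?_, ?_⟩, hmean⟩
  · have h1 := Realizable.subst_sum Finset.univ h.realizable hB h.kap_nonneg
      fun j => (h.staircase j).realizable_trunc N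
    convert h1 using 1
    rw [add_assoc, ← Finset.sum_add_distrib]
    congr 1
    refine Finset.sum_congr rfl fun j _ => ?_
    rw [smul_add, Finsupp.smul_single, smul_eq_mul, add_comm]
  · rw [Finsupp.add_apply, Finsupp.finsetSum_apply Finset.univ fun j => kap j • _]
    exact add_nonneg (hB Y) (Finset.sum_nonneg fun j _ =>
      mul_nonneg (h.kap_nonneg j) ((h.staircase j).trunc_nonneg N Y))
  · rw [Finsupp.finsetSum_apply]
    exact Finset.sum_nonneg fun j _ => hsingle _ _
      (mul_nonneg (h.kap_nonneg j) (staircaseBeta_pos (h.staircase j).gamma N).le) Y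
  · rw [Finsupp.add_apply, Finsupp.finsetSum_apply, Finsupp.finsetSum_apply,
      Finset.sum_eq_zero, Finset.sum_eq_zero, add_zero]
    · intro j _
      rw [Finsupp.smul_apply, (h.staircase j).trunc_eq_zero N hY, smul_zero]
    · intro i _
      rw [Finsupp.single_apply, if_neg]
      rintro rfl
      exact hY (h.mem i)
  · rw [hmean]
    refine add_le_add le_rfl (Finset.sum_le_sum fun j _ =>
      mul_le_mul_of_nonneg_left ?_ (h.kap_nonneg j))
    exact (h.staircase j).summable.sum_le_tsum _
      fun n _ => (h.staircase j).term_nonneg (fun X => norm_nonneg X) n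
  · have h1 : Tendsto (fun N => ∑ j, kap j * (staircaseBeta (γ j) N * price α K (As j N)))
        atTop (𝓝 (∑ j, kap j * 0)) :=
      tendsto_finsetSum _ fun j _ => (h.staircase j).tendsto_price.const_mul (kap j)
    simp only [mul_zero, Finset.sum_const_zero] at h1
    refine h1.congr fun N => ?_
    simp only [map_sum, Finsupp.linearCombination_single, smul_eq_mul, mul_assoc]

end Resolution

/-! ### Resolution by staircase laminates -/

section Laminate

variable {d m : ℕ} {α : ℝ≥0} {K : Set (Mat d m)}

/-- The weights `k` on `K` together with the unresolved weights `g` are realizable at `X`; the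
first moment of `k` is at most `c`, and the price of `g` is at most `ε`. -/
structure PartialResolution (α : ℝ≥0) (K : Set (Mat d m)) (X : Mat d m) (k g : Mat d m →₀ ℝ)
    (c ε : ℝ) : Prop where
  realizable : Realizable α X (k + g)
  nonneg_left : ∀ Y, 0 ≤ k Y
  nonneg_right : ∀ Y, 0 ≤ g Y
  eq_zero : ∀ Y ∉ K, k Y = 0
  mean_le : moment norm k ≤ c
  price_le : moment (price α K) g ≤ ε

theorem IsResolution.eventually_partialResolution {X : Mat d m} {k g : ℕ → Mat d m →₀ ℝ} {c : ℝ}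
    (h : IsResolution α K X k g c) {ε : ℝ} (hε : 0 < ε) :
    ∀ᶠ N in atTop, PartialResolution α K X (k N) (g N) c ε := by
  filter_upwards [h.tendsto_price.eventually (ge_mem_nhds hε)] with N hN
  exact ⟨h.realizable N, h.nonneg_left N, h.nonneg_right N, h.eq_zero N, h.mean_le N, hN⟩

theorem IsExtendedStaircaseLaminate.exists_mixture [Nonempty (Fin m)] (hα : α < 1)
    {A : Mat d m} {ν : Measure (Mat d m)} (h : IsExtendedStaircaseLaminate K A ν) :
    ∃ (I J : ℕ) (lam : Fin I → ℝ) (B : Fin I → Mat d m) (kap : Fin J → ℝ)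
      (As : Fin J → ℕ → Mat d m) (k : Fin J → ℕ → Mat d m →₀ ℝ) (γ : Fin J → ℕ → ℝ),
      Mixture α K A lam B kap As k γ ∧ ∀ φ : Mat d m → ℝ, (∀ X, 0 ≤ φ X) →
        ∫⁻ X, ENNReal.ofReal (φ X) ∂ν = ∑ i, ENNReal.ofReal (lam i) * ENNReal.ofReal (φ (B i)) +
          ∑ j, ENNReal.ofReal (kap j) * ∑' n, ENNReal.ofReal (staircaseBeta (γ j) n) *
            ENNReal.ofReal (moment φ (k j n)) := by
  obtain ⟨I, J, lam, B, kap, C, ν', hlam, hkap, hfin, hbar, hB, hstair, hν⟩ := h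
  choose As k γ hAs hst hφ using fun j => (hstair j).exists_staircase hα
  obtain ⟨f, hf, hw⟩ := hfin.exists_realizable hα hbar
  have hf' : f = ∑ i, Finsupp.single (B i) (lam i) + ∑ j, Finsupp.single (C j) (kap j) :=
    hw.unique ((HasWeights.sum _ fun i _ => HasWeights.smul_dirac _ (hlam i)).add
      (HasWeights.sum _ fun j _ => HasWeights.smul_dirac _ (hkap j)))
  refine ⟨I, J, lam, B, kap, As, k, γ, ⟨hlam, hkap, hB, hst, ?_⟩, fun φ h0 => ?_⟩
  · simp_rw [hAs, ← hf']
    exact hf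
  · rw [hν, lintegral_add_measure, lintegral_finsetSum_measure, lintegral_finsetSum_measure]
    simp only [lintegral_smul_measure, lintegral_dirac, smul_eq_mul, hφ _ φ h0]

theorem IsExtendedStaircaseLaminate.exists_hasCost [Nonempty (Fin m)] (hα : α < 1)
    {A : Mat d m} {ν : Measure (Mat d m)} (h : IsExtendedStaircaseLaminate K A ν) :
    ∃ c, HasCost α K A c := by
  obtain ⟨I, J, lam, B, kap, As, k, γ, hmix, -⟩ := h.exists_mixture hα
  exact ⟨_, I, J, lam, B, kap, As, k, γ, hmix, rfl⟩

/-- The infimum need not be attained; a mixture within 1 of it is used, and the summand 1 in the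
price absorbs the excess. -/
theorem exists_partialResolution_price [Nonempty (Fin m)] {X : Mat d m}
    (hX : ∃ c, HasCost α K X c) {ε : ℝ} (hε : 0 < ε) :
    ∃ k g, PartialResolution α K X k g (price α K X) ε := by
  obtain ⟨c, hc, hlt⟩ := exists_lt_of_csInf_lt (s := {c | HasCost α K X c}) hX
    (lt_add_one (sInf {c | HasCost α K X c}))
  obtain ⟨I, J, lam, B, kap, As, k, γ, hmix, rfl⟩ := hc
  obtain ⟨k', g, hres, -⟩ := hmix.exists_resolution
  obtain ⟨N, hN⟩ := (hres.eventually_partialResolution hε).exists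
  refine ⟨k' N, g N, hN.1, hN.2, hN.3, hN.4, hN.5.trans ?_, hN.6⟩
  have := norm_nonneg X
  rw [price]
  linarith

/-- Later truncations have `φ`-moments tending to infinity, while their first moments stay below the
cost of the full mixture. Hence `c` is fixed before the accuracy `ε` and the demanded energy `L`. -/
theorem IsExtendedStaircaseLaminate.exists_partialResolution_energy [Nonempty (Fin m)]
    (hα : α < 1) {X : Mat d m}
    {ν : Measure (Mat d m)} (h : IsExtendedStaircaseLaminate K X ν) {φ : Mat d m → ℝ}
    (hφ : ∀ Y, 0 ≤ φ Y) (hν : ∫⁻ Y, ENNReal.ofReal (φ Y) ∂ν = ⊤) :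
    ∃ c, 0 ≤ c ∧ ∀ ε : ℝ, 0 < ε → ∀ L : ℝ, ∃ k g, PartialResolution α K X k g c ε ∧
      L ≤ moment φ k := by
  obtain ⟨I, J, lam, B, kap, As, k, γ, hmix, hint⟩ := h.exists_mixture hα
  obtain ⟨k', g, hres, hmean⟩ := hmix.exists_resolution
  refine ⟨_, HasCost.nonneg ⟨I, J, lam, B, kap, As, k, γ, hmix, rfl⟩, fun ε hε L => ?_⟩
  have hlim : Tendsto (fun N => ENNReal.ofReal (moment φ (k' N))) atTop (𝓝 ⊤) := by
    rw [← hν, hint φ hφ]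
    have h1 : Tendsto (fun N => ∑ i, ENNReal.ofReal (lam i) * ENNReal.ofReal (φ (B i)) +
        ∑ j, ENNReal.ofReal (kap j) * ∑ n ∈ Finset.range N,
          ENNReal.ofReal (staircaseBeta (γ j) n) * ENNReal.ofReal (moment φ (k j n))) atTop
        (𝓝 (∑ i, ENNReal.ofReal (lam i) * ENNReal.ofReal (φ (B i)) +
          ∑ j, ENNReal.ofReal (kap j) * ∑' n, ENNReal.ofReal (staircaseBeta (γ j) n) *
            ENNReal.ofReal (moment φ (k j n)))) :=
      tendsto_const_nhds.add (tendsto_finsetSum _ fun j _ =>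
        ENNReal.Tendsto.const_mul (ENNReal.tendsto_nat_tsum _) (Or.inr ENNReal.ofReal_ne_top))
    refine h1.congr fun N => ?_
    have ht : ∀ j n, 0 ≤ staircaseBeta (γ j) n * moment φ (k j n) := fun j n =>
      (hmix.staircase j).term_nonneg hφ n
    have hj : ∀ j, ∑ n ∈ Finset.range N,
        ENNReal.ofReal (staircaseBeta (γ j) n) * ENNReal.ofReal (moment φ (k j n)) =
        ENNReal.ofReal (∑ n ∈ Finset.range N, staircaseBeta (γ j) n * moment φ (k j n)) := by
      intro j
      rw [ENNReal.ofReal_sum_of_nonneg fun n _ => ht j n]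
      exact Finset.sum_congr rfl fun n _ => (ENNReal.ofReal_mul
        (staircaseBeta_pos (hmix.staircase j).gamma n).le).symm
    have hs : ∀ j, 0 ≤ kap j * ∑ n ∈ Finset.range N, staircaseBeta (γ j) n * moment φ (k j n) :=
      fun j => mul_nonneg (hmix.kap_nonneg j) (Finset.sum_nonneg fun n _ => ht j n)
    have hl : ∀ i, 0 ≤ lam i * φ (B i) := fun i => mul_nonneg (hmix.lam_nonneg i) (hφ _)
    rw [hmean, ENNReal.ofReal_add (Finset.sum_nonneg fun i _ => hl i)
      (Finset.sum_nonneg fun j _ => hs j), ENNReal.ofReal_sum_of_nonneg fun i _ => hl i,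
      ENNReal.ofReal_sum_of_nonneg fun j _ => hs j]
    simp only [hj, ENNReal.ofReal_mul (hmix.lam_nonneg _), ENNReal.ofReal_mul (hmix.kap_nonneg _)]
  obtain ⟨N, hN, hL⟩ := ((hres.eventually_partialResolution hε).and
    (hlim.eventually (lt_mem_nhds (ENNReal.ofReal_lt_top (r := L))))).exists
  refine ⟨k' N, g N, hN, ?_⟩
  by_contra hlt
  exact absurd hL (not_lt.2 (ENNReal.ofReal_le_ofReal (not_le.1 hlt).le))

theorem measurable_norm_mat : Measurable fun X : Mat d m => ‖X‖ := by
  have h : (fun X : Mat d m => ‖X‖) = fun X => √(∑ i, ∑ j, X i j ^ 2) := by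
    funext X
    rw [← norm_sq_eq_sum, Real.sqrt_sq (norm_nonneg X)]
  rw [h]
  refine (Finset.measurable_sum _ fun i _ => Finset.measurable_sum _ fun j _ => ?_).sqrt
  exact (((measurable_pi_apply j).comp (measurable_pi_apply i)) :
    Measurable fun X : Fin d → Fin m → ℝ => X i j).pow_const 2

/-- A power-type lower bound of the tail makes the moment of the same order infinite. -/
theorem lintegral_norm_rpow_eq_top {ν : Measure (Mat d m)} [IsFiniteMeasure ν] {p c t₀ : ℝ}
    (hp : 0 < p) (hc : 0 < c) (h : ∀ t, t₀ < t → c * t ^ (-p) ≤ ν.real {X | t < ‖X‖}) :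
    ∫⁻ X, ENNReal.ofReal (‖X‖ ^ p) ∂ν = ⊤ := by
  by_contra hfin
  have hmeas : ∀ t : ℝ, MeasurableSet {X : Mat d m | t < ‖X‖} := fun t =>
    measurableSet_lt measurable_const measurable_norm_mat
  have h0 : Tendsto (ν ∘ fun n : ℕ => {X : Mat d m | (n : ℝ) < ‖X‖}) atTop (𝓝 0) := by
    have h1 := tendsto_measure_iInter_atTop (μ := ν)
      (s := fun n : ℕ => {X : Mat d m | (n : ℝ) < ‖X‖})
      (fun n => (hmeas n).nullMeasurableSet)
      (fun n n' hn X (hX : (n' : ℝ) < ‖X‖) => lt_of_le_of_lt (by exact_mod_cast hn) hX)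
      ⟨0, measure_ne_top _ _⟩
    have h2 : (⋂ n : ℕ, {X : Mat d m | (n : ℝ) < ‖X‖}) = ∅ := by
      refine eq_empty_of_forall_notMem fun X hX => ?_
      obtain ⟨n, hn⟩ := exists_nat_ge ‖X‖
      exact absurd (mem_iInter.1 hX n) (not_lt.2 hn)
    rwa [h2, measure_empty] at h1
  have h1 := tendsto_setLIntegral_zero hfin h0
  -- On the tail the integrand exceeds `n ^ p`, and the mass of the tail is at least `c n ^ (-p)`. A
  -- finite moment would make these integrals tend to zero.
  have h2 : ∀ᶠ n : ℕ in atTop, ENNReal.ofReal c ≤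
      ∫⁻ X in {X : Mat d m | (n : ℝ) < ‖X‖}, ENNReal.ofReal (‖X‖ ^ p) ∂ν := by
    obtain ⟨n₀, hn₀⟩ := exists_nat_gt (max t₀ 0)
    filter_upwards [eventually_ge_atTop n₀] with n hn
    have hn' : max t₀ 0 < (n : ℝ) := hn₀.trans_le (by exact_mod_cast hn)
    have hn0 : (0 : ℝ) < n := (le_max_right _ _).trans_lt hn'
    calc ENNReal.ofReal c = ENNReal.ofReal ((n : ℝ) ^ p) * ENNReal.ofReal (c * (n : ℝ) ^ (-p)) := by
          rw [← ENNReal.ofReal_mul (by positivity), Real.rpow_neg hn0.le]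
          congr 1
          field_simp
      _ ≤ ENNReal.ofReal ((n : ℝ) ^ p) * ν {X | (n : ℝ) < ‖X‖} := by
          gcongr
          rw [← ofReal_measureReal]
          exact ENNReal.ofReal_le_ofReal (h n ((le_max_left _ _).trans_lt hn'))
      _ = ∫⁻ _ in {X : Mat d m | (n : ℝ) < ‖X‖}, ENNReal.ofReal ((n : ℝ) ^ p) ∂ν := by
          rw [setLIntegral_const]
      _ ≤ _ := by
          refine setLIntegral_mono' (hmeas n) fun X hX => ENNReal.ofReal_le_ofReal ?_
          exact Real.rpow_le_rpow hn0.le (le_of_lt hX) hp.le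
  have h3 := ge_of_tendsto h1 h2
  exact absurd h3 (not_le.2 (by simpa using hc))

end Laminate

/-! ### Replacing the gradient on open pieces -/

section Stage

variable {d m : ℕ} {α : ℝ≥0} {K : Set (Mat d m)} {Ω : Set (Euc m)}

/-- `u` is a Lipschitz map which is locally affine almost everywhere in `Ω`, with finitely many
gradients. -/
structure IsPiecewiseAffine (Ω : Set (Euc m)) (u : Euc m → Euc d) (F : Finset (Mat d m)) :
    Prop where
  lip : ∃ L, LipschitzWith L u
  ae_mem : ∀ᵐ x ∂volume.restrict Ω, ∃ X ∈ F, x ∈ affineSet u X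

theorem IsPiecewiseAffine.setLIntegral_eq {u : Euc m → Euc d} {F : Finset (Mat d m)}
    (h : IsPiecewiseAffine Ω u F) (hΩ : MeasurableSet Ω) (f : Euc m → ℝ≥0∞) :
    ∫⁻ x in Ω, f x = ∑ X ∈ F, ∫⁻ x in Ω ∩ affineSet u X, f x := by
  rw [← lintegral_biUnion_finset]
  · refine setLIntegral_congr ?_
    have h1 := (ae_restrict_iff' hΩ).1 h.ae_mem
    filter_upwards [h1] with x hx
    refine propext ⟨fun hxΩ => ?_, fun hx' => ?_⟩
    · obtain ⟨X, hX, hxX⟩ := hx hxΩ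
      exact mem_biUnion (Finset.mem_coe.2 hX) ⟨hxΩ, hxX⟩
    · obtain ⟨X, -, hxX⟩ := mem_iUnion₂.1 hx'
      exact hxX.1
  · exact fun X _ Y _ hXY =>
      (disjoint_affineSet u hXY).mono inter_subset_right inter_subset_right
  · exact fun X _ => hΩ.inter (measurableSet_affineSet u X)

theorem IsPiecewiseAffine.lintegral_comp_grad {u : Euc m → Euc d} {F : Finset (Mat d m)}
    (h : IsPiecewiseAffine Ω u F) (hΩ : MeasurableSet Ω) (ψ : Mat d m → ℝ≥0∞) :
    ∫⁻ x in Ω, ψ (grad u x) = ∑ X ∈ F, ψ X * volume (Ω ∩ affineSet u X) := by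
  rw [h.setLIntegral_eq hΩ]
  refine Finset.sum_congr rfl fun X _ => ?_
  rw [← setLIntegral_const]
  refine setLIntegral_congr_fun (hΩ.inter (measurableSet_affineSet u X)) fun x hx => ?_
  simp only [grad_eq_of_mem hx.2]

/-- Realizable weights, in terms of the integrals of functions of the gradient. -/
theorem Realizable.exists_pert_integral {X : Mat d m} {f : Mat d m →₀ ℝ}
    (hf : Realizable α X f) (φ : Mat d m → ℝ) {ε : ℝ} (hε : 0 < ε) {τ : ℝ≥0} (hτ : 0 < τ)
    {U : Set (Euc m)} (hU : IsOpen U) (hUb : Bornology.IsBounded U) :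
    ∃ (w : Euc m → Euc d) (F : Finset (Mat d m)), Pert α τ U w ∧
      (∀ᵐ x ∂volume.restrict U, ∃ Y ∈ F, x ∈ affineSet w (Y - X)) ∧
      (∀ ψ : Mat d m → ℝ, (∀ Y, 0 ≤ ψ Y) → (∀ Y, ψ Y ≤ φ Y) →
        ∫⁻ x in U, ENNReal.ofReal (ψ (X + grad w x)) ≤
          ENNReal.ofReal (moment ψ f + ε) * volume U) ∧
      (∀ ψ : Mat d m → ℝ, (∀ Y, 0 ≤ ψ Y) → ENNReal.ofReal ((1 - ε) * moment ψ f) * volume U ≤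
        ∫⁻ x in U, ENNReal.ofReal (ψ (X + grad w x))) := by
  classical
  obtain ⟨F, hF, hex⟩ := hf.exists_pert
  -- Since `F` is given before the accuracy, `S` is available for the choice of `ε'`; excess volumes
  -- then cost at most `ε' * S ≤ ε` for every `ψ ≤ φ`.
  set S := ∑ Y ∈ F, |φ Y| with hS
  have hS0 : 0 ≤ S := Finset.sum_nonneg fun Y _ => abs_nonneg _
  set ε' := min ε (ε / (1 + S)) with hε'
  have hε'0 : 0 < ε' := by positivity
  obtain ⟨w, hw, hae, hvol⟩ := hex ε' τ U hε'0 hτ hU hUb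
  have hUfin : volume U ≠ ⊤ := hUb.measure_lt_top.ne
  have hpw : IsPiecewiseAffine U w (F.image fun Y => Y - X) := by
    refine ⟨hw.lip, ?_⟩
    filter_upwards [hae] with x ⟨Y, hY, hx⟩
    exact ⟨Y - X, Finset.mem_image_of_mem _ hY, hx⟩
  set v : Mat d m → ℝ := fun Y => volume.real (U ∩ affineSet w (Y - X)) with hv
  have hv0 : ∀ Y, 0 ≤ v Y := fun Y => measureReal_nonneg
  have hint : ∀ ψ : Mat d m → ℝ, (∀ Y, 0 ≤ ψ Y) →
      ∫⁻ x in U, ENNReal.ofReal (ψ (X + grad w x)) = ENNReal.ofReal (∑ Y ∈ F, ψ Y * v Y) := by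
    intro ψ hψ
    rw [hpw.lintegral_comp_grad hU.measurableSet fun Z => ENNReal.ofReal (ψ (X + Z)),
      Finset.sum_image fun Y _ Z _ h => sub_left_injective h,
      ENNReal.ofReal_sum_of_nonneg fun Y _ => mul_nonneg (hψ Y) (hv0 Y)]
    refine Finset.sum_congr rfl fun Y _ => ?_
    rw [add_sub_cancel, ENNReal.ofReal_mul (hψ Y), ofReal_measureReal
      ((measure_mono inter_subset_left).trans_lt hUb.measure_lt_top).ne]
  have hmean : ∀ ψ : Mat d m → ℝ, moment ψ f = ∑ Y ∈ F, f Y * ψ Y := by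
    intro ψ
    rw [moment_eq_sum]
    exact Finset.sum_subset hF fun Y _ hY => by rw [Finsupp.notMem_support_iff.1 hY, zero_mul]
  have hconst : ∀ c : ℝ, ENNReal.ofReal c * volume U = ENNReal.ofReal (c * volume.real U) := by
    intro c
    rw [ENNReal.ofReal_mul' measureReal_nonneg, ofReal_measureReal hUfin]
  have hU0 : 0 ≤ volume.real U := measureReal_nonneg
  have hε'le : ε' ≤ ε := min_le_left _ _
  -- the total volume of the pieces
  have htot : ∑ Y ∈ F, v Y = volume.real U := by
    have h1 := hint (fun _ => 1) fun _ => zero_le_one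
    simp only [ENNReal.ofReal_one, lintegral_one, Measure.restrict_apply_univ, one_mul] at h1
    rw [Measure.real, h1, ENNReal.toReal_ofReal (Finset.sum_nonneg fun Y _ => hv0 Y)]
  have hmass : ∑ Y ∈ F, f Y = 1 := by
    rw [← hf.mass]
    refine Eq.trans ?_ (hmean fun _ => 1).symm
    simp
  -- Lower bounds for all other pieces yield this upper bound, because the volumes add up to that of
  -- `U` and the weights to 1.
  have hupper : ∀ Y ∈ F, v Y ≤ (f Y + ε') * volume.real U := by
    intro Y hY
    have h1 := Finset.sum_erase_add F v hY
    have h2 : ∑ Z ∈ F.erase Y, (1 - ε') * f Z * volume.real U ≤ ∑ Z ∈ F.erase Y, v Z :=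
      Finset.sum_le_sum fun Z _ => hvol Z
    rw [← Finset.sum_mul, ← Finset.mul_sum] at h2
    have h3 := Finset.sum_erase_add F (fun Z => f Z) hY
    rw [hmass] at h3
    have h4 : ∑ Z ∈ F.erase Y, f Z = 1 - f Y := by linarith
    rw [h4] at h2
    have h5 : 0 ≤ ε' * f Y * volume.real U :=
      mul_nonneg (mul_nonneg hε'0.le (hf.nonneg Y)) hU0
    nlinarith
  refine ⟨w, F, hw, hae, fun ψ hψ hψφ => ?_, fun ψ hψ => ?_⟩
  · rw [hint ψ hψ, hconst]
    refine ENNReal.ofReal_le_ofReal ?_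
    have h1 : ∑ Y ∈ F, ψ Y * v Y ≤ ∑ Y ∈ F, (f Y * ψ Y + ε' * |φ Y|) * volume.real U := by
      refine Finset.sum_le_sum fun Y hY => ?_
      have h2 := mul_le_mul_of_nonneg_left (hupper Y hY) (hψ Y)
      have h3 : ε' * ψ Y ≤ ε' * |φ Y| :=
        mul_le_mul_of_nonneg_left ((hψφ Y).trans (le_abs_self _)) hε'0.le
      have h4 := mul_le_mul_of_nonneg_right h3 hU0
      nlinarith
    refine h1.trans ?_
    rw [← Finset.sum_mul, Finset.sum_add_distrib, ← hmean, ← Finset.mul_sum, ← hS]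
    refine mul_le_mul_of_nonneg_right (add_le_add le_rfl ?_) hU0
    calc ε' * S ≤ ε / (1 + S) * (1 + S) :=
          mul_le_mul (min_le_right _ _) (by linarith) hS0 (by positivity)
      _ = ε := by field_simp
  · rw [hint ψ hψ, hconst, hmean]
    refine ENNReal.ofReal_le_ofReal ?_
    rw [Finset.mul_sum, Finset.sum_mul]
    refine Finset.sum_le_sum fun Y hY => ?_
    have h1 := mul_le_mul_of_nonneg_left (hvol Y) (hψ Y)
    have h2 : 0 ≤ (ε - ε') * (f Y * ψ Y * volume.real U) :=
      mul_nonneg (by linarith) (mul_nonneg (mul_nonneg (hf.nonneg Y) (hψ Y)) hU0)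
    nlinarith

/-- The price of a gradient outside of `K`; gradients in `K` are free. -/
def pending (α : ℝ≥0) (K : Set (Mat d m)) (X : Mat d m) : ℝ :=
  open Classical in if X ∈ K then 0 else price α K X

/-- The `p`-energy of a gradient in `K`. -/
def energyOn (K : Set (Mat d m)) (p : ℝ) (X : Mat d m) : ℝ :=
  open Classical in if X ∈ K then ‖X‖ ^ p else 0

theorem pending_nonneg (X : Mat d m) : 0 ≤ pending α K X := by
  unfold pending
  split_ifs
  exacts [le_rfl, price_nonneg X]

theorem pending_le_price (X : Mat d m) : pending α K X ≤ price α K X := by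
  unfold pending
  split_ifs
  exacts [price_nonneg X, le_rfl]

theorem norm_le_price (X : Mat d m) : ‖X‖ ≤ price α K X := by
  have := one_add_norm_le_price (α := α) (K := K) X
  linarith

theorem energyOn_nonneg (p : ℝ) (X : Mat d m) : 0 ≤ energyOn K p X := by
  unfold energyOn
  split_ifs
  exacts [Real.rpow_nonneg (norm_nonneg X) p, le_rfl]

theorem moment_mono {φ ψ : Mat d m → ℝ} {f : Mat d m →₀ ℝ} (hf : ∀ X, 0 ≤ f X)
    (h : ∀ X, f X ≠ 0 → φ X ≤ ψ X) : moment φ f ≤ moment ψ f := by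
  rw [moment_eq_sum, moment_eq_sum]
  exact Finset.sum_le_sum fun X hX =>
    mul_le_mul_of_nonneg_left (h X (Finsupp.mem_support_iff.1 hX)) (hf X)

theorem PartialResolution.mean_pending_le {X : Mat d m} {k g : Mat d m →₀ ℝ} {c ε : ℝ}
    (h : PartialResolution α K X k g c ε) : moment (pending α K) (k + g) ≤ ε := by
  rw [moment_add]
  have h1 : moment (pending α K) k ≤ moment (fun _ => 0) k := by
    refine moment_mono h.nonneg_left fun Y hY => ?_
    have : Y ∈ K := by
      by_contra hYK
      exact hY (h.eq_zero Y hYK)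
    simp [pending, this]
  have h2 : moment (pending α K) g ≤ moment (price α K) g :=
    moment_mono h.nonneg_right fun Y _ => pending_le_price Y
  have h3 : moment (fun _ => 0) k = 0 := by simp [moment_eq_sum]
  linarith [h.price_le]

theorem PartialResolution.mean_norm_le {X : Mat d m} {k g : Mat d m →₀ ℝ} {c ε : ℝ}
    (h : PartialResolution α K X k g c ε) : moment norm (k + g) ≤ c + ε := by
  rw [moment_add]
  have h2 : moment norm g ≤ moment (price α K) g :=
    moment_mono h.nonneg_right fun Y _ => norm_le_price Y
  linarith [h.price_le, h.mean_le]

theorem PartialResolution.le_mean_energyOn {X : Mat d m} {k g : Mat d m →₀ ℝ} {c ε : ℝ}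
    (h : PartialResolution α K X k g c ε) (p : ℝ) :
    moment (fun Y => ‖Y‖ ^ p) k ≤ moment (energyOn K p) (k + g) := by
  rw [moment_add]
  have h1 : moment (fun Y => ‖Y‖ ^ p) k ≤ moment (energyOn K p) k := by
    refine moment_mono h.nonneg_left fun Y hY => ?_
    have : Y ∈ K := by
      by_contra hYK
      exact hY (h.eq_zero Y hYK)
    simp [energyOn, this]
  have h2 : 0 ≤ moment (energyOn K p) g :=
    linearCombination_nonneg (energyOn_nonneg p) h.nonneg_right
  linarith

/-- The map-level form of a partial resolution on an open set `U`. -/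
theorem PartialResolution.exists_pert {X : Mat d m} {k g : Mat d m →₀ ℝ} {c ε : ℝ}
    (h : PartialResolution α K X k g c ε) (hc : 0 ≤ c) (hε : 0 < ε) (hε2 : ε ≤ 1 / 2) (p : ℝ)
    {τ : ℝ≥0} (hτ : 0 < τ) {U : Set (Euc m)} (hU : IsOpen U) (hUb : Bornology.IsBounded U) :
    ∃ (w : Euc m → Euc d) (F : Finset (Mat d m)), Pert α τ U w ∧
      (∀ᵐ x ∂volume.restrict U, ∃ Y ∈ F, x ∈ affineSet w (Y - X)) ∧
      ∫⁻ x in U, ENNReal.ofReal (pending α K (X + grad w x)) ≤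
        ENNReal.ofReal (2 * ε) * volume U ∧
      ∫⁻ x in U, ENNReal.ofReal ‖grad w x‖ ≤
        ENNReal.ofReal (c + 2 * ε + ‖X‖) * volume U ∧
      ENNReal.ofReal (moment (fun Y => ‖Y‖ ^ p) k / 2) * volume U ≤
        ∫⁻ x in U, ENNReal.ofReal (energyOn K p (X + grad w x)) := by
  obtain ⟨w, F, hw, hae, hup, hlow⟩ := h.realizable.exists_pert_integral (price α K) hε hτ hU hUb
  refine ⟨w, F, hw, hae, ?_, ?_, ?_⟩
  · refine (hup _ pending_nonneg pending_le_price).trans ?_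
    gcongr
    linarith [h.mean_pending_le]
  · have h1 := hup norm (fun Y => norm_nonneg Y) norm_le_price
    have h2 : ∀ x, ENNReal.ofReal ‖grad w x‖ ≤
        ENNReal.ofReal ‖X + grad w x‖ + ENNReal.ofReal ‖X‖ := by
      intro x
      rw [← ENNReal.ofReal_add (norm_nonneg _) (norm_nonneg _)]
      refine ENNReal.ofReal_le_ofReal ?_
      have := norm_sub_le (X + grad w x) X
      rwa [add_sub_cancel_left] at this
    refine (lintegral_mono h2).trans ?_
    rw [lintegral_add_right _ measurable_const, setLIntegral_const,
      ENNReal.ofReal_add (by positivity) (norm_nonneg X), add_mul]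
    refine add_le_add (h1.trans (mul_le_mul_left (ENNReal.ofReal_le_ofReal ?_) _)) le_rfl
    linarith [h.mean_norm_le]
  -- The energy is halved because `1 - ε ≥ 1 / 2`.
  · refine le_trans ?_ (hlow _ (energyOn_nonneg p))
    gcongr
    have h1 := h.le_mean_energyOn p
    have h2 : 0 ≤ moment (energyOn K p) (k + g) :=
      linearCombination_nonneg (energyOn_nonneg p) fun Y =>
        add_nonneg (h.nonneg_left Y) (h.nonneg_right Y)
    nlinarith

end Stage

/-! ### Resolving the pending gradients, and inserting energy into a small ball. -/

section Step

variable {d m : ℕ} {α : ℝ≥0} {K : Set (Mat d m)} {Ω : Set (Euc m)}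

theorem IsPiecewiseAffine.sum_volume {u : Euc m → Euc d} {F : Finset (Mat d m)}
    (h : IsPiecewiseAffine Ω u F) (hΩ : MeasurableSet Ω) :
    ∑ X ∈ F, volume (Ω ∩ affineSet u X) = volume Ω := by
  have := h.lintegral_comp_grad hΩ fun _ => 1
  simpa using this.symm

theorem pending_eq_zero {X : Mat d m} (h : X ∈ K) : pending α K X = 0 := if_pos h

theorem pending_eq_price {X : Mat d m} (h : X ∉ K) : pending α K X = price α K X := if_neg h

/-- All gradients outside of `K` are replaced, up to a small remainder, by gradients in `K`. -/
theorem IsPiecewiseAffine.exists_resolve_step [Nonempty (Fin m)]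
    (hK : ∀ X : Mat d m, ∃ c, HasCost α K X c) (hΩ : IsOpen Ω) (hΩb : Bornology.IsBounded Ω)
    {u : Euc m → Euc d} {F : Finset (Mat d m)} (hu : IsPiecewiseAffine Ω u F) {ε : ℝ} (hε : 0 < ε)
    {τ : ℝ≥0} (hτ : 0 < τ) :
    ∃ (v : Euc m → Euc d) (F' : Finset (Mat d m)), Pert α τ Ω v ∧
      IsPiecewiseAffine Ω (u + v) F' ∧
      (∀ᵐ x ∂volume.restrict Ω, grad u x ∈ K → grad (u + v) x = grad u x) ∧
      ∫⁻ x in Ω, ENNReal.ofReal (pending α K (grad (u + v) x)) ≤ ENNReal.ofReal ε ∧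
      ∫⁻ x in Ω, ENNReal.ofReal ‖grad (u + v) x - grad u x‖ ≤
        2 * (∫⁻ x in Ω, ENNReal.ofReal (pending α K (grad u x))) + ENNReal.ofReal ε := by
  classical
  set V := volume.real Ω with hV
  have hV0 : 0 ≤ V := measureReal_nonneg
  set ε₁ := min (1 / 2) (ε / (2 * (1 + V))) with hε₁
  have hε₁0 : 0 < ε₁ := by positivity
  have hsmall : ENNReal.ofReal (2 * ε₁) * volume Ω ≤ ENNReal.ofReal ε := by
    rw [← ofReal_measureReal hΩb.measure_lt_top.ne, ← ENNReal.ofReal_mul (by positivity)]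
    refine ENNReal.ofReal_le_ofReal ?_
    calc 2 * ε₁ * V ≤ 2 * (ε / (2 * (1 + V))) * (1 + V) := by
          gcongr
          · exact min_le_right _ _
          · linarith
      _ = ε := by field_simp
  set U : Mat d m → Set (Euc m) := fun X => Ω ∩ affineSet u X with hU
  have hUo : ∀ X, IsOpen (U X) := fun X => hΩ.inter (isOpen_affineSet u X)
  have hUm : ∀ X, MeasurableSet (U X) := fun X => (hUo X).measurableSet
  have hUd : ∀ {X Y x}, X ≠ Y → x ∈ U X → x ∉ U Y := fun hXY hx hy =>
    hXY (affineSet_unique hx.2 hy.2)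
  set N := F.filter (· ∉ K) with hN
  -- `N.card` perturbations of size `τ'` will be added; the extra 1 covers an empty `N`.
  set τ' : ℝ≥0 := τ / (N.card + 1) with hτ'
  choose k g hres using fun X => exists_partialResolution_price (hK X) hε₁0
  -- The exponent 1 is a dummy: the energy estimate is discarded.
  choose w Fw hw hae hpend hgrad _ using fun X => (hres X).exists_pert (price_nonneg X) hε₁0
    (min_le_left _ _) 1 (τ := τ') (by positivity) (hUo X) (hΩb.subset inter_subset_left)
  set v := ∑ X ∈ N, w X with hv
  have hnear : ∀ X ∈ N, ∀ x ∈ U X, v =ᶠ[𝓝 x] w X := by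
    intro X hX x hx
    filter_upwards [(hUo X).mem_nhds hx] with y hy
    rw [hv, Finset.sum_apply]
    exact Finset.sum_eq_single_of_mem X hX fun Y _ hYX => (hw Y).zero y (hUd hYX.symm hy)
  have hnear0 : ∀ X ∉ N, ∀ x ∈ U X, v =ᶠ[𝓝 x] 0 := by
    intro X hX x hx
    filter_upwards [(hUo X).mem_nhds hx] with y hy
    rw [hv, Finset.sum_apply]
    refine Finset.sum_eq_zero fun Y hY => (hw Y).zero y (hUd ?_ hy)
    rintro rfl
    exact hX hY
  have hin : ∀ X ∈ N, ∀ᵐ x : Euc m, x ∈ U X → grad (u + v) x = X + grad (w X) x ∧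
      ∃ Y ∈ Fw X, x ∈ affineSet (u + v) Y := by
    intro X hX
    filter_upwards [(ae_restrict_iff' (hUm X)).1 (hae X)] with x hx hxU
    obtain ⟨Y, hY, hxY⟩ := hx hxU
    have h1 : x ∈ affineSet (u + v) (X + (Y - X)) :=
      add_mem_affineSet hxU.2 ((affineSet_congr (hnear X hX x hxU)).2 hxY)
    refine ⟨by rw [grad_eq_of_mem h1, grad_eq_of_mem hxY], Y, hY, ?_⟩
    rwa [add_sub_cancel] at h1
  have hout : ∀ X ∉ N, ∀ x ∈ U X, x ∈ affineSet (u + v) X := by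
    intro X hX x hx
    simpa using add_mem_affineSet hx.2 (mem_affineSet_zero (hnear0 X hX x hx))
  have hKN : ∀ X ∈ F, X ∉ N → X ∈ K := by
    intro X hXF hXN
    by_contra hXK
    exact hXN (Finset.mem_filter.2 ⟨hXF, hXK⟩)
  have hNK : ∀ X ∈ N, X ∉ K := fun X hX => (Finset.mem_filter.1 hX).2
  have hp : Pert α τ Ω v := by
    refine (Pert.sum N fun X _ => (hw X).mono le_rfl inter_subset_left).mono ?_ le_rfl
    rw [Finset.sum_const, nsmul_eq_mul, hτ', mul_div_assoc', div_le_iff₀ (by positivity), mul_comm]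
    gcongr
    exact le_add_of_nonneg_right zero_le_one
  refine ⟨v, F ∪ N.biUnion Fw, hp, ⟨?_, ?_⟩, ?_, ?_, ?_⟩
  · obtain ⟨L, hL⟩ := hu.lip
    obtain ⟨L', hL'⟩ := hp.lip
    exact ⟨_, hL.add hL'⟩
  · filter_upwards [hu.ae_mem, ae_restrict_of_ae ((eventually_all_finset N).2 hin),
      ae_restrict_mem hΩ.measurableSet] with x ⟨X, hX, hxX⟩ hx hxΩ
    by_cases hXN : X ∈ N
    · obtain ⟨-, Y, hY, hxY⟩ := hx X hXN ⟨hxΩ, hxX⟩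
      exact ⟨Y, Finset.mem_union_right _ (Finset.mem_biUnion.2 ⟨X, hXN, hY⟩), hxY⟩
    · exact ⟨X, Finset.mem_union_left _ hX, hout X hXN x ⟨hxΩ, hxX⟩⟩
  · filter_upwards [hu.ae_mem, ae_restrict_mem hΩ.measurableSet] with x ⟨X, hX, hxX⟩ hxΩ hxK
    rw [grad_eq_of_mem hxX] at hxK ⊢
    exact grad_eq_of_mem (hout X (fun hXN => hNK X hXN hxK) x ⟨hxΩ, hxX⟩)
  · refine le_trans ?_ hsmall
    rw [hu.setLIntegral_eq hΩ.measurableSet, ← hu.sum_volume hΩ.measurableSet, Finset.mul_sum]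
    refine Finset.sum_le_sum fun X hX => ?_
    by_cases hXN : X ∈ N
    · refine le_of_eq_of_le ?_ (hpend X)
      refine setLIntegral_congr_fun_ae (hUm X) ?_
      filter_upwards [hin X hXN] with x hx hxU
      rw [(hx hxU).1]
    · refine le_of_eq_of_le ?_ bot_le
      rw [setLIntegral_congr_fun (g := fun _ => 0) (hUm X), lintegral_zero]
      · rfl
      · intro x hx
        simp only [grad_eq_of_mem (hout X hXN x hx), pending_eq_zero (hKN X hX hXN),
          ENNReal.ofReal_zero]
  · refine le_trans ?_ (add_le_add le_rfl hsmall)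
    rw [hu.setLIntegral_eq hΩ.measurableSet, ← hu.sum_volume hΩ.measurableSet, Finset.mul_sum,
      hu.lintegral_comp_grad hΩ.measurableSet fun X => ENNReal.ofReal (pending α K X),
      Finset.mul_sum, ← Finset.sum_add_distrib]
    refine Finset.sum_le_sum fun X hX => ?_
    by_cases hXN : X ∈ N
    · have h1 : ∫⁻ x in U X, ENNReal.ofReal ‖grad (u + v) x - grad u x‖ =
          ∫⁻ x in U X, ENNReal.ofReal ‖grad (w X) x‖ := by
        refine setLIntegral_congr_fun_ae (hUm X) ?_
        filter_upwards [hin X hXN] with x hx hxU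
        rw [(hx hxU).1, grad_eq_of_mem hxU.2, add_sub_cancel_left]
      rw [h1]
      refine (hgrad X).trans ?_
      rw [← mul_assoc, ← add_mul, pending_eq_price (hNK X hXN)]
      refine mul_le_mul_left ?_ _
      have h2 : (2 : ℝ≥0∞) = ENNReal.ofReal 2 := by simp
      rw [h2, ← ENNReal.ofReal_mul zero_le_two, ← ENNReal.ofReal_add
        (mul_nonneg zero_le_two (price_nonneg X)) (by positivity)]
      refine ENNReal.ofReal_le_ofReal ?_
      -- The factor 2 of the pending price arises here, from `price + ‖X‖ ≤ 2 * price`.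
      linarith [norm_le_price (α := α) (K := K) X]
    · refine le_of_eq_of_le ?_ bot_le
      rw [setLIntegral_congr_fun (g := fun _ => 0) (hUm X), lintegral_zero]
      · rfl
      · intro x hx
        simp only [grad_eq_of_mem (hout X hXN x hx), grad_eq_of_mem hx.2, sub_self, norm_zero,
          ENNReal.ofReal_zero]

/-- A large amount of energy on `K` is inserted into a small ball contained in a given ball. -/
theorem IsPiecewiseAffine.exists_energy_step [Nonempty (Fin m)] {p : ℝ}
    (hK : ∀ X : Mat d m, ∃ c, 0 ≤ c ∧ ∀ ε : ℝ, 0 < ε → ∀ L : ℝ, ∃ k g,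
      PartialResolution α K X k g c ε ∧ L ≤ moment (fun Y => ‖Y‖ ^ p) k)
    (hΩ : IsOpen Ω) {u : Euc m → Euc d} {F : Finset (Mat d m)} (hu : IsPiecewiseAffine Ω u F)
    {c : Euc m} {s : ℝ} (hs : 0 < s) (hcs : Metric.ball c s ⊆ Ω) {ε : ℝ} (hε : 0 < ε)
    {τ : ℝ≥0} (hτ : 0 < τ) :
    ∃ (v : Euc m → Euc d) (F' : Finset (Mat d m)) (B : Set (Euc m)), Pert α τ Ω v ∧
      IsPiecewiseAffine Ω (u + v) F' ∧ MeasurableSet B ∧ B ⊆ Metric.ball c s ∧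
      volume B ≤ ENNReal.ofReal ε ∧
      (∀ᵐ x ∂volume.restrict Ω, x ∉ B → grad (u + v) x = grad u x) ∧
      ∫⁻ x in Ω, ENNReal.ofReal (pending α K (grad (u + v) x)) ≤
        (∫⁻ x in Ω, ENNReal.ofReal (pending α K (grad u x))) + ENNReal.ofReal ε ∧
      ∫⁻ x in Ω, ENNReal.ofReal ‖grad (u + v) x - grad u x‖ ≤ ENNReal.ofReal ε ∧
      2 ≤ ∫⁻ x in B, ENNReal.ofReal (energyOn K p (grad (u + v) x)) := by
  classical
  -- an affine piece meeting the ball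
  obtain ⟨x₀, hx₀, X, hX, hxX⟩ : ∃ x ∈ Metric.ball c s, ∃ X ∈ F, x ∈ affineSet u X := by
    have h1 : ∀ᵐ x ∂volume.restrict (Metric.ball c s), ∃ X ∈ F, x ∈ affineSet u X :=
      ae_mono (Measure.restrict_mono hcs le_rfl) hu.ae_mem
    have : (ae (volume.restrict (Metric.ball c s))).NeBot := by
      rw [ae_neBot, Ne, Measure.restrict_eq_zero]
      exact (Metric.measure_ball_pos volume c hs).ne'
    obtain ⟨x, hx, hx'⟩ := (h1.and (ae_restrict_mem Metric.isOpen_ball.measurableSet)).exists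
    exact ⟨x, hx', hx⟩
  obtain ⟨c₁, hc₁, hres⟩ := hK X
  -- Every cost on the small ball is at most `c₁ + ‖X‖ + 3` times its volume. As `c₁` does not
  -- depend on the truncation, the ball can be chosen first and the energy demanded afterwards.
  set η := ε / (c₁ + ‖X‖ + 3) with hη
  have hη0 : 0 < η := by have := norm_nonneg X; positivity
  -- the small ball
  obtain ⟨ρ, hρ, hρsub, hρvol⟩ : ∃ ρ > 0, Metric.ball x₀ ρ ⊆ Metric.ball c s ∩ affineSet u X ∧
      volume (Metric.ball x₀ ρ) ≤ ENNReal.ofReal η := by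
    obtain ⟨O, hO, hOo, hOv⟩ := Set.exists_isOpen_lt_of_lt ({x₀} : Set (Euc m))
      (ENNReal.ofReal η) (by rw [measure_singleton]; simpa using hη0) (μ := volume)
    obtain ⟨ρ, hρ, hsub⟩ := Metric.isOpen_iff.1
      ((Metric.isOpen_ball.inter (isOpen_affineSet u X)).inter hOo) x₀
      ⟨⟨hx₀, hxX⟩, hO rfl⟩
    exact ⟨ρ, hρ, hsub.trans inter_subset_left,
      (measure_mono (hsub.trans inter_subset_right)).trans hOv.le⟩
  set B := Metric.ball x₀ ρ with hB
  have hBm : MeasurableSet B := Metric.isOpen_ball.measurableSet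
  have hBΩ : B ⊆ Ω := (hρsub.trans inter_subset_left).trans hcs
  have hBpos : 0 < volume B := Metric.measure_ball_pos volume x₀ hρ
  have hBfin : volume B ≠ ⊤ := measure_ball_lt_top.ne
  have hBr : 0 < volume.real B := ENNReal.toReal_pos hBpos.ne' hBfin
  have hBη : volume.real B ≤ η := ENNReal.toReal_le_of_le_ofReal hη0.le hρvol
  -- A density `4 / |B|`, halved in the realization, integrates to 2 over `B`. The crude accuracy `1
  -- / 2` suffices because `B` is small.
  obtain ⟨k, g, hkg, hL⟩ := hres (1 / 2) (by norm_num) (4 / volume.real B)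
  obtain ⟨w, F', hw, hae, hpend, hgrad, hen⟩ := hkg.exists_pert hc₁ (by norm_num) le_rfl p hτ
    Metric.isOpen_ball (Metric.isBounded_ball (x := x₀) (r := ρ))
  have hbound : ∀ t : ℝ, 0 ≤ t → t ≤ c₁ + ‖X‖ + 3 → ENNReal.ofReal t * volume B ≤
      ENNReal.ofReal ε := by
    intro t ht0 ht
    rw [← ofReal_measureReal hBfin, ← ENNReal.ofReal_mul ht0]
    refine ENNReal.ofReal_le_ofReal ?_
    have h3 : 0 < c₁ + ‖X‖ + 3 := by have := norm_nonneg X; positivity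
    calc t * volume.real B ≤ (c₁ + ‖X‖ + 3) * η := by gcongr
      _ = ε := by rw [hη]; field_simp
  have hin : ∀ᵐ x : Euc m, x ∈ B → grad (u + w) x = X + grad w x ∧
      ∃ Y ∈ F', x ∈ affineSet (u + w) Y := by
    filter_upwards [(ae_restrict_iff' hBm).1 hae] with x hx hxB
    obtain ⟨Y, hY, hxY⟩ := hx hxB
    have h1 : x ∈ affineSet (u + w) (X + (Y - X)) := add_mem_affineSet (hρsub hxB).2 hxY
    refine ⟨by rw [grad_eq_of_mem h1, grad_eq_of_mem hxY], Y, hY, ?_⟩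
    rwa [add_sub_cancel] at h1
  have hout : ∀ᵐ x : Euc m, x ∉ B → w =ᶠ[𝓝 x] 0 := by
    have hsph : ∀ᵐ x : Euc m, x ∉ Metric.sphere x₀ ρ :=
      measure_eq_zero_iff_ae_notMem.1 (Measure.addHaar_sphere volume x₀ ρ)
    filter_upwards [hsph] with x hx hxB
    refine hw.eventuallyEq_zero fun hcl => ?_
    have h1 := Metric.closure_ball_subset_closedBall hcl
    rw [← Metric.ball_union_sphere] at h1
    exact h1.elim hxB hx
  have hout' : ∀ᵐ x : Euc m, x ∉ B → grad (u + w) x = grad u x := by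
    filter_upwards [hout] with x hx hxB
    refine grad_congr ?_
    filter_upwards [hx hxB] with y hy
    simp [hy]
  have hp : Pert α τ Ω w := hw.mono le_rfl hBΩ
  have hsplit : ∀ f : Euc m → ℝ≥0∞, ∫⁻ x in Ω, f x =
      (∫⁻ x in B, f x) + ∫⁻ x in Ω \ B, f x := by
    intro f
    have := lintegral_inter_add_sdiff f Ω hBm (μ := volume)
    rw [inter_eq_right.2 hBΩ] at this
    exact this.symm
  refine ⟨w, F ∪ F', B, hp, ⟨?_, ?_⟩, hBm, hρsub.trans inter_subset_left, ?_,
    ae_restrict_of_ae hout', ?_, ?_, ?_⟩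
  · obtain ⟨L, hL⟩ := hu.lip
    obtain ⟨L', hL'⟩ := hp.lip
    exact ⟨_, hL.add hL'⟩
  · filter_upwards [hu.ae_mem, ae_restrict_of_ae hin, ae_restrict_of_ae hout]
      with x ⟨Y, hY, hxY⟩ hx hx'
    by_cases hxB : x ∈ B
    · obtain ⟨-, Z, hZ, hxZ⟩ := hx hxB
      exact ⟨Z, Finset.mem_union_right _ hZ, hxZ⟩
    · refine ⟨Y, Finset.mem_union_left _ hY, ?_⟩
      simpa using add_mem_affineSet hxY (mem_affineSet_zero (hx' hxB))
  · simpa using hbound 1 zero_le_one (by have := norm_nonneg X; linarith)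
  · rw [hsplit fun x => ENNReal.ofReal (pending α K (grad (u + w) x))]
    refine (add_comm _ _).trans_le (add_le_add ?_ ?_)
    · refine le_trans (le_of_eq ?_) (lintegral_mono_set (sdiff_subset : Ω \ B ⊆ Ω))
      refine setLIntegral_congr_fun_ae (hΩ.measurableSet.diff hBm) ?_
      filter_upwards [hout'] with x hx hxB
      rw [hx hxB.2]
    · refine le_trans (le_of_eq ?_) (hpend.trans (hbound _ (by norm_num) ?_))
      · refine setLIntegral_congr_fun_ae hBm ?_
        filter_upwards [hin] with x hx hxB
        rw [(hx hxB).1]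
      · have := norm_nonneg X; linarith
  · rw [hsplit, ← add_zero (ENNReal.ofReal ε)]
    refine add_le_add ?_ (le_of_eq ?_)
    · refine le_trans (le_of_eq ?_) (hgrad.trans (hbound _ ?_ ?_))
      · refine setLIntegral_congr_fun_ae hBm ?_
        filter_upwards [hin] with x hx hxB
        rw [(hx hxB).1, grad_eq_of_mem (hρsub hxB).2, add_sub_cancel_left]
      · have := norm_nonneg X; linarith
      · linarith
    · rw [← lintegral_zero (μ := volume.restrict (Ω \ B))]
      refine setLIntegral_congr_fun_ae (hΩ.measurableSet.diff hBm) ?_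
      filter_upwards [hout'] with x hx hxB
      rw [hx hxB.2]
      simp
  · have h1 : (2 : ℝ≥0∞) ≤ ENNReal.ofReal (moment (fun Y => ‖Y‖ ^ p) k / 2) * volume B := by
      rw [← ofReal_measureReal hBfin, ← ENNReal.ofReal_mul' hBr.le]
      have h2 : (2 : ℝ≥0∞) = ENNReal.ofReal 2 := by simp
      refine h2.trans_le (ENNReal.ofReal_le_ofReal ?_)
      rw [div_le_iff₀ hBr] at hL
      linarith
    refine (h1.trans hen).trans (le_of_eq ?_)
    refine setLIntegral_congr_fun_ae hBm ?_
    filter_upwards [hin] with x hx hxB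
    rw [(hx hxB).1]

end Step

/-! ### The sequence of maps -/

section Iteration

variable {d m : ℕ} {α : ℝ≥0} {K : Set (Mat d m)} {Ω : Set (Euc m)} {p : ℝ}

/-- One stage of the construction: `u` is replaced by `u'`. Gradients in `K` are only changed on the
small set `B`, almost all gradients of `u'` are in `K`, and if the ball is contained in `Ω`, then
`B` is contained in it and carries a lot of energy. -/
structure IsStage (α : ℝ≥0) (K : Set (Mat d m)) (p : ℝ) (Ω : Set (Euc m)) (c : Euc m) (s : ℝ)
    (τ : ℝ≥0) (ε : ℝ) (u u' : Euc m → Euc d) (B : Set (Euc m)) : Prop where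
  pert : Pert α τ Ω (u' - u)
  measurableSet : MeasurableSet B
  volume_le : volume B ≤ ENNReal.ofReal ε
  stable : ∀ᵐ x ∂volume.restrict Ω, x ∉ B → grad u x ∈ K → grad u' x = grad u x
  pending_le : ∫⁻ x in Ω, ENNReal.ofReal (pending α K (grad u' x)) ≤ ENNReal.ofReal ε
  diff_le : ∫⁻ x in Ω, ENNReal.ofReal ‖grad u' x - grad u x‖ ≤
    2 * (∫⁻ x in Ω, ENNReal.ofReal (pending α K (grad u x))) + 4 * ENNReal.ofReal ε
  energy : Metric.ball c s ⊆ Ω → B ⊆ Metric.ball c s ∧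
    2 ≤ ∫⁻ x in B, ENNReal.ofReal (energyOn K p (grad u' x))

theorem IsPiecewiseAffine.mono {u : Euc m → Euc d} {F F' : Finset (Mat d m)}
    (h : IsPiecewiseAffine Ω u F) (hF : F ⊆ F') : IsPiecewiseAffine Ω u F' :=
  ⟨h.lip, h.ae_mem.mono fun _ ⟨X, hX, hx⟩ => ⟨X, hF hX, hx⟩⟩

theorem measurable_norm_grad_sub {u v : Euc m → Euc d} (hu : Continuous u) (hv : Continuous v) :
    Measurable fun x => ENNReal.ofReal ‖grad u x - grad v x‖ := by
  refine ENNReal.measurable_ofReal.comp (measurable_norm_mat.comp ?_)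
  refine measurable_pi_iff.2 fun i => measurable_pi_iff.2 fun j => ?_
  exact (measurable_pi_iff.1 (measurable_pi_iff.1 (measurable_grad hu) i) j).sub
    (measurable_pi_iff.1 (measurable_pi_iff.1 (measurable_grad hv) i) j)

/-- Energy is inserted first and pending gradients are resolved second: the resolution keeps
gradients in `K`, hence the energy on `B`, and also clears what the insertion left unresolved. If
the ball is not contained in `Ω`, only the resolution is made and `B = ∅`. -/
theorem IsPiecewiseAffine.exists_isStage [Nonempty (Fin m)]
    (hK : ∀ X : Mat d m, ∃ c, HasCost α K X c)
    (hK' : ∀ X : Mat d m, ∃ c, 0 ≤ c ∧ ∀ ε : ℝ, 0 < ε → ∀ L : ℝ, ∃ k g,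
      PartialResolution α K X k g c ε ∧ L ≤ moment (fun Y => ‖Y‖ ^ p) k)
    (hΩ : IsOpen Ω) (hΩb : Bornology.IsBounded Ω)
    {u : Euc m → Euc d} {F : Finset (Mat d m)} (hu : IsPiecewiseAffine Ω u F)
    (c : Euc m) {s : ℝ} (hs : 0 < s) {ε : ℝ} (hε : 0 < ε) {τ : ℝ≥0} (hτ : 0 < τ) :
    ∃ (u' : Euc m → Euc d) (F' : Finset (Mat d m)) (B : Set (Euc m)), F ⊆ F' ∧
      IsPiecewiseAffine Ω u' F' ∧ IsStage α K p Ω c s τ ε u u' B := by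
  classical
  by_cases hcs : Metric.ball c s ⊆ Ω
  · obtain ⟨v, F₁, B, hv, hF₁, hB, hBsub, hBvol, hst, hpend, hdiff, hen⟩ :=
      hu.exists_energy_step hK' hΩ hs hcs hε (half_pos hτ)
    obtain ⟨w, F₂, hw, hF₂, hst', hpend', hdiff'⟩ :=
      hF₁.exists_resolve_step hK hΩ hΩb hε (half_pos hτ)
    refine ⟨u + v + w, F ∪ F₂, B, Finset.subset_union_left, hF₂.mono Finset.subset_union_right,
      ?_, hB, hBvol, ?_, hpend', ?_, fun _ => ⟨hBsub, hen.trans ?_⟩⟩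
    · have := (hv.add hw).mono (add_halves τ).le le_rfl
      rwa [show u + v + w - u = v + w by abel]
    · filter_upwards [hst, hst'] with x h1 h2 hxB hxK
      rw [h2 (by rwa [h1 hxB]), h1 hxB]
    · have hle : ∀ x, ENNReal.ofReal ‖grad (u + v + w) x - grad u x‖ ≤
          ENNReal.ofReal ‖grad (u + v + w) x - grad (u + v) x‖ +
            ENNReal.ofReal ‖grad (u + v) x - grad u x‖ := by
        intro x
        rw [← ENNReal.ofReal_add (norm_nonneg _) (norm_nonneg _)]
        exact ENNReal.ofReal_le_ofReal (norm_sub_le_norm_sub_add_norm_sub _ _ _)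
      obtain ⟨L, hL⟩ := hu.lip
      obtain ⟨L₁, hL₁⟩ := hF₁.lip
      have hmeas := measurable_norm_grad_sub hL₁.continuous hL.continuous
      refine (lintegral_mono hle).trans ?_
      rw [lintegral_add_right _ hmeas]
      -- The coefficient 4 comes from twice the price added by the insertion and one `ε` for each of
      -- the two increments.
      calc _ ≤ 2 * ((∫⁻ x in Ω, ENNReal.ofReal (pending α K (grad u x))) + ENNReal.ofReal ε)
            + ENNReal.ofReal ε + ENNReal.ofReal ε :=
            add_le_add (hdiff'.trans (by gcongr)) hdiff
        _ = _ := by ring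
    · refine lintegral_mono_ae ?_
      have hBΩ : volume.restrict B ≤ volume.restrict Ω :=
        Measure.restrict_mono (hBsub.trans hcs) le_rfl
      filter_upwards [ae_mono hBΩ hst'] with x hx
      by_cases hxK : grad (u + v) x ∈ K
      · rw [hx hxK]
      · rw [energyOn, if_neg hxK, ENNReal.ofReal_zero]
        exact bot_le
  · obtain ⟨w, F₂, hw, hF₂, hst, hpend, hdiff⟩ := hu.exists_resolve_step hK hΩ hΩb hε hτ
    refine ⟨u + w, F ∪ F₂, ∅, Finset.subset_union_left, hF₂.mono Finset.subset_union_right,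
      ?_, MeasurableSet.empty, by simp, hst.mono fun x hx _ => hx, hpend, hdiff.trans ?_,
      fun h => absurd h hcs⟩
    · rwa [add_sub_cancel_left]
    · gcongr
      exact le_mul_of_one_le_left bot_le (by norm_num)

/-- A sequence of maps produced by successive stages, the `k`-th of which uses the ball with center
`c k` and radius `s k`. -/
structure IsStageSeq (α : ℝ≥0) (K : Set (Mat d m)) (p : ℝ) (Ω : Set (Euc m)) (c : ℕ → Euc m)
    (s : ℕ → ℝ) (τ : ℝ≥0) (u : ℕ → Euc m → Euc d) (B : ℕ → Set (Euc m)) (R : ℕ → ℝ) : Prop where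
  isPiecewiseAffine : ∀ k, ∃ F, IsPiecewiseAffine Ω (u k) F
  pert : ∀ k, Pert α (τ * 2⁻¹ ^ (k + 1)) Ω (u (k + 1) - u k)
  measurableSet : ∀ k, MeasurableSet (B k)
  volume_le : ∀ k, volume (B k) ≤ 2⁻¹ ^ (k + 1)
  stable : ∀ k, ∀ᵐ x ∂volume.restrict Ω, x ∉ B k → grad (u k) x ∈ K →
    grad (u (k + 1)) x = grad (u k) x
  pending_le : ∀ k, ∫⁻ x in Ω, ENNReal.ofReal (pending α K (grad (u (k + 1)) x)) ≤ 2⁻¹ ^ (k + 1)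
  diff_le : ∀ k, ∫⁻ x in Ω, ENNReal.ofReal ‖grad (u (k + 1)) x - grad (u k) x‖ ≤
    2 * (∫⁻ x in Ω, ENNReal.ofReal (pending α K (grad (u k) x))) + 4 * 2⁻¹ ^ (k + 1)
  energy : ∀ k, Metric.ball (c k) (s k) ⊆ Ω → B k ⊆ Metric.ball (c k) (s k) ∧
    2 ≤ ∫⁻ x in B k, ENNReal.ofReal (energyOn K p (grad (u (k + 1)) x))
  energy_le : ∀ k, ∀ᵐ x ∂volume.restrict Ω, energyOn K p (grad (u k) x) ≤ R k
  mul_volume_le : ∀ k j, k ≤ j → ENNReal.ofReal (R k) * volume (B j) ≤ 2⁻¹ ^ (j + 1)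

theorem exists_isStageSeq [Nonempty (Fin m)]
    (hK : ∀ X : Mat d m, ∃ c, HasCost α K X c)
    (hK' : ∀ X : Mat d m, ∃ c, 0 ≤ c ∧ ∀ ε : ℝ, 0 < ε → ∀ L : ℝ, ∃ k g,
      PartialResolution α K X k g c ε ∧ L ≤ moment (fun Y => ‖Y‖ ^ p) k)
    (hΩ : IsOpen Ω) (hΩb : Bornology.IsBounded Ω) (c : ℕ → Euc m) {s : ℕ → ℝ} (hs : ∀ k, 0 < s k)
    {τ : ℝ≥0} (hτ : 0 < τ) (A : Mat d m) (b : Euc d) :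
    ∃ u B R, IsStageSeq α K p Ω c s τ u B R ∧ u 0 = affineMap A b := by
  classical
  let S := {q : (Euc m → Euc d) × Finset (Mat d m) // IsPiecewiseAffine Ω q.1 q.2}
  let r : Finset (Mat d m) → ℝ := fun F => ∑ X ∈ F, ‖X‖ ^ p
  -- The tolerance is chosen once the gradients are known: it makes a set so small that even the
  -- largest energy density attained so far contributes at most `2^{-k-1}` on it. The finite sets of
  -- gradients are nested, so later tolerances also protect the energy of all earlier stages.
  let e : ℕ → Finset (Mat d m) → ℝ := fun k F => (1 / 2) ^ (k + 1) / (1 + r F)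
  have hr0 : ∀ F, 0 ≤ r F := fun F =>
    Finset.sum_nonneg fun X _ => Real.rpow_nonneg (norm_nonneg X) p
  have he0 : ∀ k F, 0 < e k F := fun k F => div_pos (by positivity) (by linarith [hr0 F])
  have hstep : ∀ (k : ℕ) (q : S), ∃ (q' : S) (B : Set (Euc m)), q.1.2 ⊆ q'.1.2 ∧
      IsStage α K p Ω (c k) (s k) (τ * 2⁻¹ ^ (k + 1)) (e k q.1.2) q.1.1 q'.1.1 B := by
    rintro k ⟨⟨u, F⟩, hu⟩
    obtain ⟨u', F', B, hF, hu', hB⟩ := hu.exists_isStage hK hK' hΩ hΩb (c k) (hs k) (he0 k F)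
      (τ := τ * 2⁻¹ ^ (k + 1)) (by positivity)
    exact ⟨⟨⟨u', F'⟩, hu'⟩, B, hF, hB⟩
  choose next B hF hst using hstep
  have h0 : IsPiecewiseAffine Ω (affineMap A b) {A} :=
    ⟨exists_lipschitzWith_affineMap A b, Eventually.of_forall fun x =>
      ⟨A, Finset.mem_singleton_self A, mem_affineSet_affineMap A b x⟩⟩
  let q : ℕ → S := fun k => Nat.rec ⟨⟨affineMap A b, {A}⟩, h0⟩ (fun k q => next k q) k
  have hmono : Monotone fun k => (q k).1.2 := monotone_nat_of_le_succ fun k => hF k (q k)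
  have hst' : ∀ k, IsStage α K p Ω (c k) (s k) (τ * 2⁻¹ ^ (k + 1)) (e k (q k).1.2) (q k).1.1
      (q (k + 1)).1.1 (B k (q k)) := fun k => hst k (q k)
  have hhalf : ∀ k : ℕ, ENNReal.ofReal ((1 / 2) ^ k) = 2⁻¹ ^ k := by
    intro k
    rw [ENNReal.ofReal_pow (by norm_num), one_div, ENNReal.ofReal_inv_of_pos two_pos,
      ENNReal.ofReal_ofNat]
  have he : ∀ k F, ENNReal.ofReal (e k F) ≤ 2⁻¹ ^ (k + 1) := by
    intro k F
    rw [← hhalf]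
    exact ENNReal.ofReal_le_ofReal (div_le_self (by positivity) (by linarith [hr0 F]))
  refine ⟨fun k => (q k).1.1, fun k => B k (q k), fun k => r (q k).1.2,
    ⟨fun k => ⟨_, (q k).2⟩, fun k => (hst' k).pert, fun k => (hst' k).measurableSet,
      fun k => (hst' k).volume_le.trans (he _ _), fun k => (hst' k).stable,
      fun k => (hst' k).pending_le.trans (he _ _), fun k => (hst' k).diff_le.trans ?_,
      fun k => (hst' k).energy, fun k => ?_, fun k j hkj => ?_⟩, rfl⟩
  · gcongr
    exact he _ _
  · filter_upwards [(q k).2.ae_mem] with x ⟨X, hX, hx⟩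
    rw [grad_eq_of_mem hx]
    have h1 : energyOn K p X ≤ ‖X‖ ^ p := by
      unfold energyOn
      split_ifs
      exacts [le_rfl, Real.rpow_nonneg (norm_nonneg X) p]
    exact h1.trans (Finset.single_le_sum (f := fun X : Mat d m => ‖X‖ ^ p)
      (fun Y _ => Real.rpow_nonneg (norm_nonneg Y) p) hX)
  · refine (mul_le_mul_right (hst' j).volume_le _).trans ?_
    rw [← ENNReal.ofReal_mul (hr0 _), ← hhalf]
    refine ENNReal.ofReal_le_ofReal ?_
    have h1 : r (q k).1.2 ≤ r (q j).1.2 :=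
      Finset.sum_le_sum_of_subset_of_nonneg (hmono hkj) fun X _ _ =>
        Real.rpow_nonneg (norm_nonneg X) p
    have h2 := hr0 (q j).1.2
    calc r (q k).1.2 * e j (q j).1.2 ≤ (1 + r (q j).1.2) * e j (q j).1.2 :=
          mul_le_mul_of_nonneg_right (by linarith) (he0 _ _).le
      _ = (1 / 2) ^ (j + 1) := by simp only [e]; field_simp

/-- A sequence of balls which are contained in any given ball infinitely often. -/
theorem exists_ball_sequence (E : Type*) [PseudoMetricSpace E] [TopologicalSpace.SeparableSpace E]
    [Nonempty E] : ∃ (c : ℕ → E) (s : ℕ → ℝ), (∀ k, 0 < s k) ∧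
      ∀ (x : E) (r : ℝ), 0 < r → ∃ᶠ k in atTop, Metric.ball (c k) (s k) ⊆ Metric.ball x r := by
  -- All pairs of a dense center and a radius `1 / (n + 1)` are enumerated, so every center recurs
  -- with ever smaller radii.
  refine ⟨fun k => TopologicalSpace.denseSeq E k.unpair.1, fun k => 1 / (k.unpair.2 + 1),
    fun k => by positivity, fun x r hr => ?_⟩
  obtain ⟨i, hi⟩ := (TopologicalSpace.denseRange_denseSeq E).exists_dist_lt x (half_pos hr)
  obtain ⟨n₀, hn₀⟩ := exists_nat_one_div_lt (half_pos hr)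
  refine frequently_atTop.2 fun a => ⟨Nat.pair i (max a n₀), ?_, ?_⟩
  · exact (le_max_left _ _).trans (Nat.right_le_pair _ _)
  · simp only [Nat.unpair_pair]
    refine Metric.ball_subset_ball' ?_
    have h1 : (1 : ℝ) / ((max a n₀ : ℕ) + 1) ≤ 1 / (n₀ + 1) :=
      one_div_le_one_div_of_le (by positivity) (by
        have : (n₀ : ℝ) ≤ (max a n₀ : ℕ) := by exact_mod_cast le_max_right a n₀
        linarith)
    rw [dist_comm] at hi
    linarith

end Iteration

/-! ### The limit map -/

section Limit

variable {d m : ℕ} {α τ : ℝ≥0} {K : Set (Mat d m)} {Ω : Set (Euc m)} {p : ℝ}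

/-- The tolerances form a geometric series with sum `τ`, so every partial sum obeys the bounds with
`τ`, and both the supremum bound and the Hölder bound survive pointwise limits. -/
theorem exists_limit_of_pert {u : ℕ → Euc m → Euc d}
    (h : ∀ k, Pert α (τ * 2⁻¹ ^ (k + 1)) Ω (u (k + 1) - u k)) :
    ∃ w : Euc m → Euc d, Continuous w ∧ (∀ x ∉ Ω, w x = 0) ∧ (∀ x, ‖w x‖ ≤ τ) ∧ HolderWith τ α w ∧
      (∀ x, Tendsto (fun k => u k x) atTop (𝓝 (u 0 x + w x))) ∧
      ∀ k x, ‖u k x - u 0 x‖ ≤ τ := by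
  have hpart : ∀ k, Pert α τ Ω (u k - u 0) := by
    intro k
    rw [← Finset.sum_range_sub u k]
    refine (Pert.sum (Finset.range k) fun i _ => h i).mono ?_ le_rfl
    have h1 : ∀ k, ∑ i ∈ Finset.range k, (2⁻¹ : ℝ≥0) ^ (i + 1) + 2⁻¹ ^ k = 1 := by
      intro k
      induction k with
      | zero => simp
      | succ k ih =>
        rw [Finset.sum_range_succ, add_assoc, ← ih, pow_succ, ← mul_add]
        norm_num
    rw [← Finset.mul_sum]
    exact mul_le_of_le_one_right' (le_of_add_le_left (h1 k).le)
  have hbound : ∀ k x, ‖u (k + 1) x - u k x‖ ≤ τ * 2⁻¹ ^ (k + 1) := fun k x => by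
    simpa using (h k).bound x
  have hsum : Summable fun k : ℕ => (τ : ℝ) * 2⁻¹ ^ (k + 1) :=
    ((summable_nat_add_iff 1).2 (summable_geometric_of_lt_one (by norm_num)
      (by norm_num : (2⁻¹ : ℝ) < 1))).mul_left _
  set w : Euc m → Euc d := fun x => ∑' k, (u (k + 1) x - u k x) with hw
  have hlim : ∀ x, Tendsto (fun k => u k x - u 0 x) atTop (𝓝 (w x)) := by
    intro x
    have h1 := (Summable.of_norm_bounded hsum fun k => hbound k x).hasSum.tendsto_sum_nat
    simpa only [Finset.sum_range_sub fun k => u k x] using h1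
  refine ⟨w, ?_, fun x hx => ?_, fun x => ?_, fun x y => ?_, fun x => ?_, fun k x => ?_⟩
  · refine continuous_tsum (fun k => ?_) hsum hbound
    obtain ⟨L, hL⟩ := (h k).lip
    exact hL.continuous
  · refine tendsto_nhds_unique (hlim x) (tendsto_const_nhds.congr fun k => ?_)
    exact ((hpart k).zero x hx).symm
  · exact le_of_tendsto (hlim x).norm (Eventually.of_forall fun k => (hpart k).bound x)
  · exact le_of_tendsto ((hlim x).edist (hlim y))
      (Eventually.of_forall fun k => (hpart k).holder x y)
  · simpa using (hlim x).const_add (u 0 x)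
  · exact (hpart k).bound x

theorem tsum_two_inv_pow_succ : ∑' k : ℕ, (2⁻¹ : ℝ≥0∞) ^ (k + 1) = 1 := by
  rw [ENNReal.tsum_geometric_add_one, ENNReal.one_sub_inv_two, inv_inv]
  exact ENNReal.inv_mul_cancel two_ne_zero ENNReal.ofNat_ne_top

/-- Chebyshev's inequality: the summand 1 in the price makes the integrand at least 1 wherever the
gradient is outside of `K`. -/
theorem IsPiecewiseAffine.measure_grad_notMem_le {u : Euc m → Euc d} {F : Finset (Mat d m)}
    (h : IsPiecewiseAffine Ω u F) (hΩ : MeasurableSet Ω) :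
    volume.restrict Ω {x | grad u x ∉ K} ≤
      ∫⁻ x in Ω, ENNReal.ofReal (pending α K (grad u x)) := by
  classical
  rw [h.lintegral_comp_grad hΩ fun X => ENNReal.ofReal (pending α K X)]
  have h1 : volume.restrict Ω {x | grad u x ∉ K} ≤
      volume.restrict Ω (⋃ X ∈ F.filter (· ∉ K), affineSet u X) := by
    refine measure_mono_ae ?_
    filter_upwards [h.ae_mem] with x ⟨X, hX, hx⟩ hxK
    have hXK : X ∉ K := grad_eq_of_mem hx ▸ hxK
    exact mem_biUnion (Finset.mem_coe.2 (Finset.mem_filter.2 ⟨hX, hXK⟩)) hx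
  refine (h1.trans (measure_biUnion_finset_le _ _)).trans ?_
  refine le_trans (Finset.sum_le_sum fun X hX => ?_)
    (Finset.sum_le_sum_of_subset (Finset.filter_subset (· ∉ K) F))
  rw [Measure.restrict_apply (measurableSet_affineSet u X), inter_comm]
  refine le_mul_of_one_le_left bot_le ?_
  rw [pending_eq_price (Finset.mem_filter.1 hX).2, ← ENNReal.ofReal_one]
  refine ENNReal.ofReal_le_ofReal ?_
  have h2 := one_add_norm_le_price (α := α) (K := K) X
  linarith [norm_nonneg X]

variable {c : ℕ → Euc m} {s : ℕ → ℝ} {u : ℕ → Euc m → Euc d} {B : ℕ → Set (Euc m)} {R : ℕ → ℝ}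

theorem IsStageSeq.continuous (h : IsStageSeq α K p Ω c s τ u B R) (k : ℕ) : Continuous (u k) := by
  obtain ⟨F, hF⟩ := h.isPiecewiseAffine k
  obtain ⟨L, hL⟩ := hF.lip
  exact hL.continuous

/-- The gradients are eventually constant almost everywhere. -/
theorem IsStageSeq.exists_grad (h : IsStageSeq α K p Ω c s τ u B R) (hΩ : MeasurableSet Ω) :
    ∃ G : Euc m → Mat d m, ∀ᵐ x ∂volume.restrict Ω, G x ∈ K ∧
      (∀ᶠ k in atTop, grad (u k) x = G x) ∧
      ∀ n, (∀ j, n ≤ j → x ∉ B j) → grad (u n) x ∈ K → grad (u n) x = G x := by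
  classical
  -- The default 0 is taken only where the gradients are not eventually constant, a null part of
  -- `Ω`.
  set G : Euc m → Mat d m := fun x =>
    if h : ∃ Y, ∀ᶠ k in atTop, grad (u k) x = Y then h.choose else 0 with hG
  have hGeq : ∀ x Y, (∀ᶠ k in atTop, grad (u k) x = Y) → G x = Y := by
    intro x Y hY
    have h1 : ∃ Y, ∀ᶠ k in atTop, grad (u k) x = Y := ⟨Y, hY⟩
    simp only [hG, dif_pos h1]
    obtain ⟨k, hk, hk'⟩ := (h1.choose_spec.and hY).exists
    exact hk.symm.trans hk'
  -- Borel–Cantelli, here for the sets `B k` and below for the sets where the gradient is not in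
  -- `K`; both have measures bounded by a geometric series.
  have hB : ∀ᵐ x ∂volume.restrict Ω, ∀ᶠ k in atTop, x ∉ B k := by
    refine ae_eventually_notMem (ne_top_of_le_ne_top ENNReal.one_ne_top ?_)
    rw [← tsum_two_inv_pow_succ]
    exact ENNReal.tsum_le_tsum fun k => (Measure.restrict_apply_le _ _).trans (h.volume_le k)
  have hK : ∀ᵐ x ∂volume.restrict Ω, ∀ᶠ k in atTop, x ∉ {x | grad (u (k + 1)) x ∉ K} := by
    refine ae_eventually_notMem (ne_top_of_le_ne_top ENNReal.one_ne_top ?_)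
    rw [← tsum_two_inv_pow_succ]
    refine ENNReal.tsum_le_tsum fun k => ?_
    obtain ⟨F, hF⟩ := h.isPiecewiseAffine (k + 1)
    exact (hF.measure_grad_notMem_le hΩ).trans (h.pending_le k)
  refine ⟨G, ?_⟩
  filter_upwards [hB, hK, ae_all_iff.2 h.stable] with x hxB hxK hst
  have hpers : ∀ n, (∀ j, n ≤ j → x ∉ B j) → grad (u n) x ∈ K →
      ∀ k, n ≤ k → grad (u k) x = grad (u n) x := by
    intro n hn hnK k hk
    induction k, hk using Nat.le_induction with
    | base => rfl
    | succ k hk ih => rw [← ih]; exact hst k (hn k hk) (by rwa [ih])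
  have hev : ∀ n, (∀ j, n ≤ j → x ∉ B j) → grad (u n) x ∈ K →
      ∀ᶠ k in atTop, grad (u k) x = grad (u n) x := fun n hn hnK =>
    (eventually_ge_atTop n).mono fun k hk => hpers n hn hnK k hk
  obtain ⟨n, hn⟩ := eventually_atTop.1 (hxB.and hxK)
  have hnB : ∀ j, n + 1 ≤ j → x ∉ B j := fun j hj => (hn j (by omega)).1
  have hnK : grad (u (n + 1)) x ∈ K := not_not.1 (hn n le_rfl).2
  have h1 := hev (n + 1) hnB hnK
  rw [hGeq x _ h1]
  refine ⟨hnK, h1, fun n' hB' hK' => ?_⟩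
  rw [← hGeq x _ h1, ← hGeq x _ (hev n' hB' hK')]

/-- Each increment is controlled by the price pending before it, which decays geometrically after
the first stage; the initial price is finite but not small, and the factor `P + 1` accounts for it.
-/
theorem IsStageSeq.tsum_diff_ne_top (h : IsStageSeq α K p Ω c s τ u B R)
    (h0 : ∫⁻ x in Ω, ENNReal.ofReal (pending α K (grad (u 0) x)) ≠ ⊤) :
    ∑' k, ∫⁻ x in Ω, ENNReal.ofReal ‖grad (u (k + 1)) x - grad (u k) x‖ ≠ ⊤ := by
  set P := ∫⁻ x in Ω, ENNReal.ofReal (pending α K (grad (u 0) x)) with hP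
  have h2 : (2 : ℝ≥0∞) * 2⁻¹ = 1 := ENNReal.mul_inv_cancel two_ne_zero ENNReal.ofNat_ne_top
  have hle : ∀ k, ∫⁻ x in Ω, ENNReal.ofReal (pending α K (grad (u k) x)) ≤
      2 * (P + 1) * 2⁻¹ ^ (k + 1) := by
    intro k
    have h3 : 2 * (P + 1) * 2⁻¹ ^ (k + 1) = (P + 1) * 2⁻¹ ^ k := by
      calc 2 * (P + 1) * 2⁻¹ ^ (k + 1) = (2 * 2⁻¹) * ((P + 1) * 2⁻¹ ^ k) := by ring
        _ = _ := by rw [h2, one_mul]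
    rw [h3]
    cases k with
    | zero => simp [hP]
    | succ k =>
      refine (h.pending_le k).trans (le_mul_of_one_le_left bot_le ?_)
      exact le_add_left le_rfl
  refine ne_top_of_le_ne_top (b := (2 * (2 * (P + 1)) + 4) * 1) ?_ ?_
  · finiteness
  · refine le_of_le_of_eq ?_ (congrArg _ tsum_two_inv_pow_succ)
    rw [← ENNReal.tsum_mul_left]
    refine ENNReal.tsum_le_tsum fun k => (h.diff_le k).trans ?_
    rw [add_mul, mul_assoc 2]
    gcongr
    exact hle k

/-- An integrable bound for all the gradients. -/
theorem IsStageSeq.exists_bound (h : IsStageSeq α K p Ω c s τ u B R)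
    (hΩb : Bornology.IsBounded Ω)
    {A : Mat d m} (hA : ∀ x, grad (u 0) x = A) :
    ∃ H : Euc m → ℝ, IntegrableOn H Ω ∧
      ∀ᵐ x ∂volume.restrict Ω, ∀ k, ‖grad (u k) x‖ ≤ H x := by
  have hfin : volume Ω ≠ ⊤ := hΩb.measure_lt_top.ne
  have h0 : ∫⁻ x in Ω, ENNReal.ofReal (pending α K (grad (u 0) x)) ≠ ⊤ := by
    simp only [hA, setLIntegral_const]
    finiteness
  have hmeas : ∀ k, Measurable fun x => ENNReal.ofReal ‖grad (u (k + 1)) x - grad (u k) x‖ :=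
    fun k => measurable_norm_grad_sub (h.continuous _) (h.continuous _)
  -- The total variation of the gradients along the sequence; added to `‖A‖` it dominates all of
  -- them at once.
  set D : Euc m → ℝ≥0∞ := fun x => ∑' k, ENNReal.ofReal ‖grad (u (k + 1)) x - grad (u k) x‖
  have hD : Measurable D := Measurable.tsum hmeas
  have hDint : ∫⁻ x in Ω, D x ≠ ⊤ := by
    rw [lintegral_tsum fun k => (hmeas k).aemeasurable]
    exact h.tsum_diff_ne_top h0
  refine ⟨fun x => ‖A‖ + (D x).toReal, ?_, ?_⟩
  · exact (integrableOn_const hfin).add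
      (integrable_toReal_of_lintegral_ne_top hD.aemeasurable hDint)
  · filter_upwards [ae_lt_top hD hDint] with x hx k
    have h1 : ENNReal.ofReal ‖grad (u k) x‖ ≤ ENNReal.ofReal ‖A‖ +
        ∑ i ∈ Finset.range k, ENNReal.ofReal ‖grad (u (i + 1)) x - grad (u i) x‖ := by
      induction k with
      | zero => simp [hA]
      | succ k ih =>
        rw [Finset.sum_range_succ, ← add_assoc]
        refine le_trans ?_ (add_le_add_left ih _)
        rw [← ENNReal.ofReal_add (norm_nonneg _) (norm_nonneg _)]
        refine ENNReal.ofReal_le_ofReal ?_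
        have := norm_add_le (grad (u k) x) (grad (u (k + 1)) x - grad (u k) x)
        rwa [add_sub_cancel] at this
    have h2 : ENNReal.ofReal ‖grad (u k) x‖ ≤ ENNReal.ofReal ‖A‖ + D x :=
      h1.trans (add_le_add_right (ENNReal.sum_le_tsum _) _)
    rw [← ENNReal.ofReal_toReal hx.ne, ← ENNReal.ofReal_add (norm_nonneg _)
      ENNReal.toReal_nonneg] at h2
    exact (ENNReal.ofReal_le_ofReal_iff (by positivity)).1 h2

/-- Integration by parts for Lipschitz maps. -/
theorem LipschitzWith.setIntegral_grad_mul {v : Euc m → Euc d} {L : ℝ≥0} (hv : LipschitzWith L v)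
    {φ : Euc m → ℝ} (hφ : ContDiff ℝ (⊤ : ℕ∞) φ) (hc : HasCompactSupport φ) (hs : tsupport φ ⊆ Ω)
    (i : Fin d) (j : Fin m) :
    ∫ x in Ω, v x i * fderiv ℝ φ x (EuclideanSpace.single j 1) =
      -∫ x in Ω, grad v x i j * φ x := by
  obtain ⟨L', hL'⟩ := hφ.lipschitzWith_of_hasCompactSupport hc (by simp)
  have hvi : LipschitzWith _ fun x => v x i :=
    (EuclideanSpace.proj i : Euc d →L[ℝ] ℝ).lipschitz.comp hv
  have hnot : ∀ x ∉ Ω, x ∉ tsupport φ := fun x hx hx' => hx (hs hx')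
  rw [setIntegral_eq_integral_of_forall_compl_eq_zero fun x hx => ?_,
    setIntegral_eq_integral_of_forall_compl_eq_zero fun x hx => ?_]
  · have h1 := hvi.integral_lineDeriv_mul_eq (μ := volume) hL' hc (EuclideanSpace.single j (1 : ℝ))
    refine Eq.trans ?_ (congrArg Neg.neg h1).symm
    rw [← integral_neg]
    refine integral_congr_ae (Eventually.of_forall fun x => ?_)
    have hd : DifferentiableAt ℝ φ x := (hφ.differentiable (by simp)).differentiableAt
    simp only [hd.lineDeriv_eq_fderiv, map_neg]
    ring
  · rw [image_eq_zero_of_notMem_tsupport (hnot x hx), mul_zero]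
  · rw [fderiv_of_notMem_tsupport ℝ (hnot x hx)]
    simp

/-- Every Lipschitz `u k` satisfies the integration by parts formula, and both sides converge by
dominated convergence: the values stay within `τ` of `u 0`, the gradients below the common
integrable bound. -/
theorem IsStageSeq.isSobolevW11 (h : IsStageSeq α K p Ω c s τ u B R)
    (hΩb : Bornology.IsBounded Ω) {A : Mat d m} (hA : ∀ x, grad (u 0) x = A)
    {U : Euc m → Euc d} (hU : Continuous U) (hlim : ∀ x, Tendsto (fun k => u k x) atTop (𝓝 (U x)))
    (hbound : ∀ k x, ‖u k x - u 0 x‖ ≤ τ) {G : Euc m → Mat d m}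
    (hG : ∀ᵐ x ∂volume.restrict Ω, ∀ᶠ k in atTop, grad (u k) x = G x) : IsSobolevW11 Ω U G := by
  obtain ⟨H, hH, hH'⟩ := h.exists_bound hΩb hA
  have hmeas : ∀ k i j, Measurable fun x => grad (u k) x i j := fun k i j =>
    measurable_pi_iff.1 (measurable_pi_iff.1 (measurable_grad (h.continuous k)) i) j
  have hGlim : ∀ i j, ∀ᵐ x ∂volume.restrict Ω,
      Tendsto (fun k => grad (u k) x i j) atTop (𝓝 (G x i j)) := by
    intro i j
    filter_upwards [hG] with x hx
    exact tendsto_const_nhds.congr' (hx.mono fun k hk => (congrFun (congrFun hk i) j).symm)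
  have hle : ∀ k i j, ∀ᵐ x ∂volume.restrict Ω, ‖grad (u k) x i j‖ ≤ H x := by
    intro k i j
    filter_upwards [hH'] with x hx
    exact (abs_apply_le_norm _ i j).trans (hx k)
  refine ⟨?_, fun i j => ?_, fun φ hφ hc hs i j => ?_⟩
  · exact (hU.continuousOn.integrableOn_compact hΩb.isCompact_closure).mono_set subset_closure
  · refine Integrable.mono' hH (aestronglyMeasurable_of_tendsto_ae atTop
      (fun k => (hmeas k i j).aestronglyMeasurable) (hGlim i j)) ?_
    filter_upwards [hGlim i j, ae_all_iff.2 fun k => hle k i j] with x hx hx'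
    exact le_of_tendsto hx.norm (Eventually.of_forall hx')
  · have hdc : Continuous fun x => fderiv ℝ φ x (EuclideanSpace.single j 1) :=
      (hφ.continuous_fderiv (by simp)).clm_apply continuous_const
    have hds : HasCompactSupport fun x => fderiv ℝ φ x (EuclideanSpace.single j 1) :=
      hc.fderiv_apply ℝ _
    have hcomp : ∀ v : Euc m → Euc d, Continuous v → Continuous fun x => v x i := fun v hv => by
      fun_prop
    have h1 : Tendsto (fun k => ∫ x in Ω, u k x i * fderiv ℝ φ x (EuclideanSpace.single j 1)) atTop
        (𝓝 (∫ x in Ω, U x i * fderiv ℝ φ x (EuclideanSpace.single j 1))) := by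
      refine tendsto_integral_of_dominated_convergence
        (fun x => (‖u 0 x‖ + τ) * ‖fderiv ℝ φ x (EuclideanSpace.single j 1)‖)
        (fun k => ((hcomp _ (h.continuous k)).mul hdc).aestronglyMeasurable) ?_
        (fun k => Eventually.of_forall fun x => ?_) (Eventually.of_forall fun x => ?_)
      · refine (Continuous.integrable_of_hasCompactSupport ?_ ?_).integrableOn
        · exact ((h.continuous 0).norm.add continuous_const).mul hdc.norm
        · exact hds.norm.mul_left
      · rw [norm_mul]
        refine mul_le_mul_of_nonneg_right ?_ (norm_nonneg _)
        refine (PiLp.norm_apply_le (u k x) i).trans ?_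
        have h2 := norm_add_le (u 0 x) (u k x - u 0 x)
        rw [add_sub_cancel] at h2
        linarith [hbound k x]
      · exact (((EuclideanSpace.proj i : Euc d →L[ℝ] ℝ).continuous.tendsto _).comp
          (hlim x)).mul_const _
    have h2 : Tendsto (fun k => ∫ x in Ω, grad (u k) x i j * φ x) atTop
        (𝓝 (∫ x in Ω, G x i j * φ x)) := by
      obtain ⟨C, hC⟩ := hc.exists_bound_of_continuous hφ.continuous
      refine tendsto_integral_of_dominated_convergence (fun x => H x * C)
        (fun k => ((hmeas k i j).mul hφ.continuous.measurable).aestronglyMeasurable)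
        (hH.mul_const C) (fun k => ?_) ?_
      · filter_upwards [hle k i j] with x hx
        rw [norm_mul]
        exact mul_le_mul hx (hC x) (norm_nonneg _) ((norm_nonneg _).trans hx)
      · filter_upwards [hGlim i j] with x hx
        exact hx.mul_const _
    refine tendsto_nhds_unique h1 (h2.neg.congr fun k => ?_)
    obtain ⟨F, hF⟩ := h.isPiecewiseAffine k
    obtain ⟨L, hL⟩ := hF.lip
    exact (hL.setIntegral_grad_mul hφ hc hs i j).symm

/-- Right after stage `k` the set `B k` carries energy at least 2. Later stages alter gradients in
`K` only on `T`, where the density at that moment is at most `R (k + 1)`; as `R (k + 1) * volume T ≤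
1`, at most 1 is lost. -/
theorem IsStageSeq.one_le_lintegral (h : IsStageSeq α K p Ω c s τ u B R) {G : Euc m → Mat d m}
    (hG : ∀ᵐ x ∂volume.restrict Ω, ∀ n, (∀ j, n ≤ j → x ∉ B j) → grad (u n) x ∈ K →
      grad (u n) x = G x) {k : ℕ} (hk : Metric.ball (c k) (s k) ⊆ Ω) :
    1 ≤ ∫⁻ x in B k, ENNReal.ofReal (‖G x‖ ^ p) := by
  obtain ⟨hsub, hen⟩ := h.energy k hk
  set T := ⋃ j, B (k + 1 + j) with hT
  have hTm : MeasurableSet T := MeasurableSet.iUnion fun j => h.measurableSet _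
  have hle : volume.restrict (B k) ≤ volume.restrict Ω :=
    Measure.restrict_mono (hsub.trans hk) le_rfl
  have hT1 : ENNReal.ofReal (R (k + 1)) * volume T ≤ 1 := by
    refine (mul_le_mul_right (measure_iUnion_le _) _).trans ?_
    rw [← ENNReal.tsum_mul_left, ← tsum_two_inv_pow_succ]
    refine ENNReal.tsum_le_tsum fun j => (h.mul_volume_le (k + 1) (k + 1 + j) (by omega)).trans ?_
    exact pow_le_pow_of_le_one bot_le (by simp) (by omega)
  have h1 : ∫⁻ x in B k, ENNReal.ofReal (energyOn K p (grad (u (k + 1)) x)) ≤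
      ∫⁻ x in B k, (ENNReal.ofReal (‖G x‖ ^ p) +
        T.indicator (fun _ => ENNReal.ofReal (R (k + 1))) x) := by
    refine lintegral_mono_ae ?_
    filter_upwards [ae_mono hle hG, ae_mono hle (h.energy_le (k + 1))] with x hx hx'
    by_cases hxT : x ∈ T
    · rw [indicator_of_mem hxT]
      exact le_add_left (ENNReal.ofReal_le_ofReal hx')
    · rw [indicator_of_notMem hxT, add_zero]
      by_cases hxK : grad (u (k + 1)) x ∈ K
      · have hxB : ∀ j, k + 1 ≤ j → x ∉ B j := by
          intro j hj hxj
          obtain ⟨i, rfl⟩ := Nat.exists_eq_add_of_le hj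
          exact hxT (mem_iUnion.2 ⟨i, hxj⟩)
        rw [energyOn, if_pos hxK, hx (k + 1) hxB hxK]
      · rw [energyOn, if_neg hxK, ENNReal.ofReal_zero]
        exact bot_le
  rw [lintegral_add_right _ (measurable_const.indicator hTm), lintegral_indicator_const hTm] at h1
  have h2 : ENNReal.ofReal (R (k + 1)) * volume.restrict (B k) T ≤ 1 :=
    (mul_le_mul_right (Measure.restrict_apply_le _ _) _).trans hT1
  have h3 := hen.trans (h1.trans (add_le_add_right h2 _))
  exact (ENNReal.add_le_add_iff_right ENNReal.one_ne_top).1 (one_add_one_eq_two.trans_le h3)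

/-- A finite energy on `U` would be absolutely continuous, so its integrals over the sets `B k`,
whose volumes tend to 0, would vanish in the limit. Yet infinitely many of them lie in `U` and carry
at least 1. The sets may overlap. -/
theorem IsStageSeq.lintegral_eq_top (h : IsStageSeq α K p Ω c s τ u B R) {G : Euc m → Mat d m}
    (hG : ∀ᵐ x ∂volume.restrict Ω, ∀ n, (∀ j, n ≤ j → x ∉ B j) → grad (u n) x ∈ K →
      grad (u n) x = G x) {U : Set (Euc m)} (hU : U ⊆ Ω)
    (hcs : ∃ᶠ k in atTop, Metric.ball (c k) (s k) ⊆ U) :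
    ∫⁻ x in U, ENNReal.ofReal (‖G x‖ ^ p) = ⊤ := by
  by_contra hfin
  have h0 : Tendsto (volume.restrict U ∘ B) atTop (𝓝 0) := by
    have h1 : Tendsto (fun k : ℕ => (2⁻¹ : ℝ≥0∞) ^ (k + 1)) atTop (𝓝 0) :=
      (tendsto_add_atTop_iff_nat 1).2 (ENNReal.tendsto_pow_atTop_nhds_zero_of_lt_one (by simp))
    exact tendsto_of_tendsto_of_tendsto_of_le_of_le tendsto_const_nhds h1 (fun _ => bot_le)
      fun k => (Measure.restrict_apply_le _ _).trans (h.volume_le k)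
  have h2 := (tendsto_setLIntegral_zero hfin h0).eventually (gt_mem_nhds zero_lt_one)
  obtain ⟨k, hk, hk'⟩ := (hcs.and_eventually h2).exists
  have hB : B k ⊆ U := (h.energy k (hk.trans hU)).1.trans hk
  rw [Measure.restrict_restrict (h.measurableSet k), inter_eq_left.2 hB] at hk'
  exact (h.one_le_lintegral hG (hk.trans hU)).not_gt hk'

end Limit

/-! ### Hölder norm of the limit map. -/

section Holder

variable {d m : ℕ} {α τ : ℝ≥0}

theorem holderNormOn_le {S : Set (Euc m)} {v : Euc m → Euc d} (hv : ∀ x ∈ S, ‖v x‖ ≤ τ)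
    (hv' : HolderOnWith τ α v S) : holderNormOn α S v ≤ τ + τ := by
  refine add_le_add (iSup₂_le fun x hx => ?_) (HolderWith.restrict_iff.2 hv').eHolderNorm_le
  rw [← ofReal_norm, ← ENNReal.ofReal_coe_nnreal]
  exact ENNReal.ofReal_le_ofReal (hv x hx)

theorem memHolderOn_add_of_lipschitz {Ω : Set (Euc m)} (hΩ : Bornology.IsBounded Ω) (hα : α ≤ 1)
    {v w : Euc m → Euc d} (hv : ∃ L, LipschitzWith L v) (hwc : Continuous w)
    (hw : ∀ x, ‖w x‖ ≤ τ) (hw' : HolderWith τ α w) : MemHolderOn α (closure Ω) (v + w) := by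
  obtain ⟨L, hL⟩ := hv
  obtain ⟨C, hC⟩ := HolderOnWith.exists_holderOnWith_of_le
    ⟨L, (hL.lipschitzOnWith (s := closure Ω)).holderOnWith⟩ hα hΩ.closure
  obtain ⟨C', hC'⟩ := hΩ.isCompact_closure.exists_bound_of_continuousOn hL.continuous.continuousOn
  refine ⟨(hL.continuous.add hwc).continuousOn, ?_⟩
  set T : ℝ≥0 := C + C'.toNNReal + τ
  refine (holderNormOn_le (τ := T) (fun x hx => ?_) ?_).trans_lt
    (ENNReal.add_lt_top.2 ⟨ENNReal.coe_lt_top, ENNReal.coe_lt_top⟩)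
  · refine (norm_add_le _ _).trans ?_
    simp only [T, NNReal.coe_add]
    have h1 := (hC' x hx).trans (Real.le_coe_toNNReal C')
    linarith [hw x, C.coe_nonneg]
  · refine HolderWith.restrict_iff.1 (HolderWith.mono ((HolderWith.restrict_iff.2 hC).add
      (HolderWith.restrict_iff.2 (hw'.holderOnWith (closure Ω)))) ?_)
    simp only [T]
    gcongr
    exact le_self_add

end Holder

/-! ### Assembly of the proof. -/

theorem corollaryA4 {d m : ℕ} (K : Set (Mat d m)) (p r ρ M : ℝ)
    (hp : 1 < p) (hpr : p ≤ r) (hρ : 0 ≤ ρ) (hρr : ρ ≤ r) (hM : 1 < M)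
    (hK : ∀ A : Mat d m, ∃ ν : Measure (Mat d m),
      IsProbabilityMeasure ν ∧ IsExtendedStaircaseLaminate K A ν ∧ HasBarycenter ν A ∧
      ν Kᶜ = 0 ∧
      ∀ t : ℝ, 1 + ‖A‖ < t →
        M ^ (-p) * (1 + ‖A‖ ^ ρ) * t ^ (-p) ≤ ν.real {X : Mat d m | t < ‖X‖} ∧
        ν.real {X : Mat d m | t < ‖X‖} ≤ M ^ p * (1 + ‖A‖ ^ r) * t ^ (-p))
    (Ω : Set (EuclideanSpace ℝ (Fin m))) (hΩ : IsRegularDomain Ω)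
    (A : Mat d m) (b : EuclideanSpace ℝ (Fin d))
    (δ : ℝ) (hδ : 0 < δ) (α : ℝ≥0) (hα : α < 1) :
    ∃ (u : EuclideanSpace ℝ (Fin m) → EuclideanSpace ℝ (Fin d))
      (G : EuclideanSpace ℝ (Fin m) → Mat d m),
      IsSobolevW11 Ω u G ∧
      MemHolderOn α (closure Ω) u ∧
      (∀ x ∈ frontier Ω, u x = affineMap A b x) ∧
      (∀ᵐ x ∂volume.restrict Ω, G x ∈ K) ∧
      holderNormOn α (closure Ω) (fun x => u x - affineMap A b x) < ENNReal.ofReal δ ∧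
      ∀ (c : EuclideanSpace ℝ (Fin m)) (s : ℝ), 0 < s → Metric.ball c s ⊆ Ω →
        ∫⁻ x in Metric.ball c s, ENNReal.ofReal (‖G x‖ ^ p) = ⊤ := by
  -- For `m = 0` every matrix has norm 0, which contradicts the positive lower bound of the tail at
  -- `t = 2`.
  have hm : Nonempty (Fin m) := by
    by_contra hm
    have hempty : IsEmpty (Fin m) := not_nonempty_iff.1 hm
    obtain ⟨ν, -, -, -, -, hν⟩ := hK A
    have h0 : ∀ X : Mat d m, ‖X‖ = 0 := fun X => by rw [Subsingleton.elim X 0, norm_zero]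
    have h1 := (hν 2 (by rw [h0]; norm_num)).1
    have h2 : {X : Mat d m | 2 < ‖X‖} = ∅ := by
      refine eq_empty_of_forall_notMem fun X (hX : 2 < ‖X‖) => ?_
      rw [h0] at hX
      linarith
    rw [h2, measureReal_empty] at h1
    have h3 : 0 < M ^ (-p) * (1 + ‖A‖ ^ ρ) * 2 ^ (-p) := by
      have := Real.rpow_nonneg (norm_nonneg A) ρ
      have : 0 < M := by linarith
      positivity
    linarith
  have hcost : ∀ X : Mat d m, ∃ c, HasCost α K X c := fun X => by
    obtain ⟨ν, -, hν, -⟩ := hK X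
    exact hν.exists_hasCost hα
  have henergy : ∀ X : Mat d m, ∃ c, 0 ≤ c ∧ ∀ ε : ℝ, 0 < ε → ∀ L : ℝ, ∃ k g,
      PartialResolution α K X k g c ε ∧ L ≤ moment (fun Y => ‖Y‖ ^ p) k := fun X => by
    obtain ⟨ν, hprob, hν, -, -, htail⟩ := hK X
    refine hν.exists_partialResolution_energy hα
      (fun Y => Real.rpow_nonneg (norm_nonneg Y) p) ?_
    refine lintegral_norm_rpow_eq_top (c := M ^ (-p) * (1 + ‖X‖ ^ ρ)) (t₀ := 1 + ‖X‖)
      (by linarith) ?_ fun t ht => (htail t ht).1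
    have := Real.rpow_nonneg (norm_nonneg X) ρ
    have : 0 < M := by linarith
    positivity
  obtain ⟨c, s, hs, hcs⟩ := exists_ball_sequence (Euc m)
  -- The supremum and the seminorm contribute `τ` each; a third of `δ` leaves the inequality strict.
  set τ : ℝ≥0 := ⟨δ / 3, by positivity⟩ with hτ
  obtain ⟨u, B, R, hu, hu0⟩ := exists_isStageSeq hcost henergy hΩ.isOpen hΩ.isBounded c hs
    (τ := τ) (show (0 : ℝ) < δ / 3 by positivity) A b
  obtain ⟨w, hwc, hw0, hwb, hwh, hlim, hbound⟩ := exists_limit_of_pert hu.pert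
  obtain ⟨G, hG⟩ := hu.exists_grad hΩ.isOpen.measurableSet
  rw [hu0] at hlim
  have hlip := exists_lipschitzWith_affineMap A b
  have hcont : Continuous (affineMap A b + w) := by
    obtain ⟨L, hL⟩ := hlip
    exact hL.continuous.add hwc
  refine ⟨affineMap A b + w, G, ?_, ?_, fun x hx => ?_, hG.mono fun x hx => hx.1, ?_,
    fun x r hr hsub => ?_⟩
  · exact hu.isSobolevW11 hΩ.isBounded (A := A) (fun x => by rw [hu0, grad_affineMap]) hcont hlim
      hbound (hG.mono fun x hx => hx.2.1)
  · exact memHolderOn_add_of_lipschitz hΩ.isBounded hα.le hlip hwc hwb hwh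
  · have hxΩ : x ∉ Ω := fun hxΩ => notMem_empty x (hΩ.isOpen.inter_frontier_eq ▸ ⟨hxΩ, hx⟩)
    simp [hw0 x hxΩ]
  · simp only [Pi.add_apply, add_sub_cancel_left]
    refine (holderNormOn_le (fun x _ => hwb x) (hwh.holderOnWith _)).trans_lt ?_
    rw [← ENNReal.coe_add, ← ENNReal.ofReal_coe_nnreal]
    refine (ENNReal.ofReal_lt_ofReal_iff hδ).2 ?_
    rw [NNReal.coe_add]
    change δ / 3 + δ / 3 < δ
    linarith
  · exact hu.lintegral_eq_top (hG.mono fun x hx => hx.2.2) hsub (hcs x r hr)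

end
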